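/- Let $d\ge 1$ and let $V=(V(x))_{x\in\mathbb Z^d}$ be i.i.d. non-negative real random variables on a probability space $(\Omega,\mathbb P)$ with $\mathbb P[V(0)>0]>0$ and $\mathbb E[\ln(V(0)+1)]<\infty$; $\mathbb E[V(0)]\in(0,\infty]$ may be infinite. Let $\Delta f(y)=\frac1{2d}\sum_{|e|=1}f(y+e)-f(y)$ be the discrete Laplacian on $\mathbb Z^d$ and, for a potential $W\ge0$ on $\mathbb Z^d$, let $y\mapsto G(0,y,W)$ be the unique bounded solution of $(-\Delta+W)G(0,\cdot,W)=\delta_0$. Then for every $\gamma>0$ the following are well defined: $\mathbb P$-almost surely the Green's function $G(0,\cdot,\gamma V)$; the quenched Lyapunov exponent $A_{\gamma V}$, which is the unique norm on $\mathbb R^d$ such that $\mathbb P$-almost surely, for all $\ell\in\mathbb Z^d$, $$A_{\gamma V}(\ell)=\lim_{k\to\infty}\frac{-\ln G(0,k\ell,\gamma V)}{k}=\lim_{k\to\infty}\frac{-\mathbb E[\ln G(0,k\ell,\gamma V)]}{k}$$ (where $\ln G(0,y,\gamma V)$ is integrable for every $y\in\mathbb Z^d$); and the annealed Lyapunov exponent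 $B_{\gamma V}$, which is the unique norm on $\mathbb R^d$ such that for all $\ell\in\mathbb Z^d$, $$B_{\gamma V}(\ell)=\lim_{k\to\infty}\frac{-\ln\mathbb E[G(0,k\ell,\gamma V)]}{k}$$ (where $G(0,y,\gamma V)$ is integrable for every $y\in\mathbb Z^d$). Moreover, for every $\ell\in\mathbb R^d$ with $\|\ell\|_2=1$, $$\lim_{\gamma\searrow0}\frac{A_{\gamma V}(\ell)}{\sqrt\gamma}=\lim_{\gamma\searrow0}\frac{B_{\gamma V}(\ell)}{\sqrt\gamma}=\sqrt{2d\,\mathbb E[V(0)]}\in(0,\infty].$$ In particular, there is a constant $c>0$ with $$c<\liminf_{\gamma\searrow0}\frac{B_{\gamma V}(\ell)}{\sqrt\gamma}\le\limsup_{\gamma\searrow0}\frac{A_{\gamma V}(\ell)}{\sqrt\gamma}<\infty$$ if and only if $\mathbb E[V(0)]<\infty$; and if $\mathbb E[V(0)]<\infty$, these bounds hold for every real $c<\sqrt{2d\,\mathbb E[V(0)]}$, hence with a constant $c>0$ that depends only on $d$ and $\mathbb E[V(0)]$. -/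

import Mathlib

open MeasureTheory ProbabilityTheory Filter Topology
open scoped ENNReal

/-- The discrete Laplacian on `ℤ^d`: `Δ f (y) = (∑_{|e| = 1} f (y + e)) / (2 d) - f y`. -/
noncomputable def latticeLaplacian {d : ℕ} (f : (Fin d → ℤ) → ℝ) (y : Fin d → ℤ) : ℝ :=
  (∑ i : Fin d, (f (y + Pi.single i 1) + f (y - Pi.single i 1))) / (2 * (d : ℝ)) - f y

/-- `u` is a bounded solution of `(-Δ + W) u = δ_0` on `ℤ^d`. -/
def IsBoundedGreenSolution {d : ℕ} (W : (Fin d → ℤ) → ℝ) (u : (Fin d → ℤ) → ℝ) : Prop :=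
  (∃ C : ℝ, ∀ y, |u y| ≤ C) ∧
    ∀ y, -latticeLaplacian u y + W y * u y = if y = 0 then 1 else 0

open Classical in
/-- The Green's function `y ↦ G(0, y, W)` of the operator `-Δ + W`: the unique bounded solution of
`(-Δ + W) u = δ_0` (and `0` if there is no unique bounded solution). -/
noncomputable def operatorGreen {d : ℕ} (W : (Fin d → ℤ) → ℝ) : (Fin d → ℤ) → ℝ :=
  if h : ∃! u, IsBoundedGreenSolution W u then h.choose else 0

/-- The embedding of the lattice `ℤ^d` into Euclidean space `ℝ^d`. -/
noncomputable def latticeVec {d : ℕ} (x : Fin d → ℤ) : EuclideanSpace ℝ (Fin d) :=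
  WithLp.toLp 2 (fun i => (x i : ℝ))

/-- `A` is a norm on `ℝ^d` which on lattice vectors `ℓ` equals both the almost sure limit of
`-ln G(0, kℓ, W) / k` and the limit of `-𝔼[ln G(0, kℓ, W)] / k` as `k → ∞`. -/
structure IsQuenchedExponent {d : ℕ} {Ω : Type*} [MeasurableSpace Ω] (μ : Measure Ω)
    (W : (Fin d → ℤ) → Ω → ℝ) (A : Seminorm ℝ (EuclideanSpace ℝ (Fin d))) : Prop where
  definite : ∀ x, A x = 0 → x = 0
  ae_tendsto : ∀ᵐ ω ∂μ, ∀ l : Fin d → ℤ,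
    Tendsto (fun k : ℕ => -Real.log (operatorGreen (fun x => W x ω) (k • l)) / (k : ℝ))
      atTop (𝓝 (A (latticeVec l)))
  integrable_log : ∀ y : Fin d → ℤ,
    Integrable (fun ω => Real.log (operatorGreen (fun x => W x ω) y)) μ
  mean_tendsto : ∀ l : Fin d → ℤ,
    Tendsto (fun k : ℕ =>
        -(∫ ω, Real.log (operatorGreen (fun x => W x ω) (k • l)) ∂μ) / (k : ℝ))
      atTop (𝓝 (A (latticeVec l)))

/-- `B` is a norm on `ℝ^d` which on lattice vectors `ℓ` equals the limit of
`-ln 𝔼[G(0, kℓ, W)] / k` as `k → ∞`. -/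
structure IsAnnealedExponent {d : ℕ} {Ω : Type*} [MeasurableSpace Ω] (μ : Measure Ω)
    (W : (Fin d → ℤ) → Ω → ℝ) (B : Seminorm ℝ (EuclideanSpace ℝ (Fin d))) : Prop where
  definite : ∀ x, B x = 0 → x = 0
  integrable : ∀ y : Fin d → ℤ, Integrable (fun ω => operatorGreen (fun x => W x ω) y) μ
  tendsto : ∀ l : Fin d → ℤ,
    Tendsto (fun k : ℕ =>
        -Real.log (∫ ω, operatorGreen (fun x => W x ω) (k • l) ∂μ) / (k : ℝ))
      atTop (𝓝 (B (latticeVec l)))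

open Classical in
/-- The quenched Lyapunov exponent `A_W` of the Green's function of `-Δ + W`. -/
noncomputable def quenchedExponent {d : ℕ} {Ω : Type*} [MeasurableSpace Ω] (μ : Measure Ω)
    (W : (Fin d → ℤ) → Ω → ℝ) : Seminorm ℝ (EuclideanSpace ℝ (Fin d)) :=
  if h : ∃! A, IsQuenchedExponent μ W A then h.choose else 0

open Classical in
/-- The annealed Lyapunov exponent `B_W` of the Green's function of `-Δ + W`. -/
noncomputable def annealedExponent {d : ℕ} {Ω : Type*} [MeasurableSpace Ω] (μ : Measure Ω)
    (W : (Fin d → ℤ) → Ω → ℝ) : Seminorm ℝ (EuclideanSpace ℝ (Fin d)) :=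
  if h : ∃! B, IsAnnealedExponent μ W B then h.choose else 0

/-- `A_{γ V}(ℓ) / √γ`, as an extended real. -/
noncomputable def scaledQuenched {d : ℕ} {Ω : Type*} [MeasurableSpace Ω] (μ : Measure Ω)
    (V : (Fin d → ℤ) → Ω → ℝ) (l : EuclideanSpace ℝ (Fin d)) (γ : ℝ) : EReal :=
  ((quenchedExponent μ (fun x ω => γ * V x ω) l / √γ : ℝ) : EReal)

/-- `B_{γ V}(ℓ) / √γ`, as an extended real. -/
noncomputable def scaledAnnealed {d : ℕ} {Ω : Type*} [MeasurableSpace Ω] (μ : Measure Ω)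
    (V : (Fin d → ℤ) → Ω → ℝ) (l : EuclideanSpace ℝ (Fin d)) (γ : ℝ) : EReal :=
  ((annealedExponent μ (fun x ω => γ * V x ω) l / √γ : ℝ) : EReal)

/-- Wang's bounds with constant `c`:
`c < liminf_{γ ↘ 0} B_{γ V}(ℓ) / √γ ≤ limsup_{γ ↘ 0} A_{γ V}(ℓ) / √γ < ∞`. -/
def WangBounds {d : ℕ} {Ω : Type*} [MeasurableSpace Ω] (μ : Measure Ω)
    (V : (Fin d → ℤ) → Ω → ℝ) (l : EuclideanSpace ℝ (Fin d)) (c : ℝ) : Prop :=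
  (c : EReal) < liminf (scaledAnnealed μ V l) (𝓝[>] 0) ∧
    liminf (scaledAnnealed μ V l) (𝓝[>] 0) ≤ limsup (scaledQuenched μ V l) (𝓝[>] 0) ∧
    limsup (scaledQuenched μ V l) (𝓝[>] 0) < ⊤

/-- The mean `𝔼[V(0)] ∈ [0, ∞]` of a nonnegative potential. -/
noncomputable def potentialMean {d : ℕ} {Ω : Type*} [MeasurableSpace Ω] (μ : Measure Ω)
    (V : (Fin d → ℤ) → Ω → ℝ) : ℝ≥0∞ :=
  ∫⁻ ω, ENNReal.ofReal (V 0 ω) ∂μ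

/-- The constant `√(2 d 𝔼[V(0)]) ∈ [0, ∞]`. -/
noncomputable def limitConstant {d : ℕ} {Ω : Type*} [MeasurableSpace Ω] (μ : Measure Ω)
    (V : (Fin d → ℤ) → Ω → ℝ) : ℝ≥0∞ :=
  (2 * (d : ℝ≥0∞) * potentialMean μ V) ^ (1 / 2 : ℝ)

/-! Dividing the equation by `1 + W` turns it into the first-step equation of a simple random walk
that collects the factor `X = 1 / (1 + W)` at each visited site. The Green's function is thus a sum
over weighted walks, and it factors as `hit y 0 * green 0 0`. The second factor does not depend on
`y`, so both exponents can be computed from the hitting weights.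

Existence. Concatenating walks gives `hit x y * hit y z ≤ hit x z`. Hence `meanCost = -𝔼[ln hit]` is
subadditive. So is `costMean = -ln 𝔼[hit]`, because hitting weights are positively associated:
moments of a variable in `(0, 1]` satisfy `Λ j * Λ k ≤ Λ (j + k)`. An even subadditive function on
the lattice has a limiting seminorm. The almost sure limit is a Kingman argument: the upper bound
comes from the strong law for passages of finite range, the lower bound from covering orbits by
cheap blocks. The total weight of walks has finite mean in every dimension, since a walk that visits
few sites is confined to a narrow slab and cannot stay there long.

Upper bound, for every `γ`. By Jensen, `exp (-meanCost)` is a supersolution for the constant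
potential `w = γ 𝔼[V(0)]`, so it dominates the hitting weights of that potential (`meanCost_super`).
Let `g = ⟨v, ·⟩` be a supporting functional of `A` at a given point. As `g ≤ A ≤ meanCost`, the
hitting weights tilted by `exp g` are at most `1`. Their sum over the lattice grows at least like `κ
^ n` with `κ = (∑ cosh vᵢ) / (d (1 + w))`, but is at most the number of sites within reach, which is
polynomial in `n`. So `κ ≤ 1`, which gives `∑ vᵢ² ≤ 2 d w` and `A ≤ √(2 d w) ‖·‖`
(`seminorm_le_sqrt_mul_norm`).

Lower bound, as `γ → 0`. Space is cut orthogonally to `l` into slabs of width `K / √γ`. Different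
slabs use disjoint sites, so the averaged weight of reaching a far point is at most a product of one
factor `β` per slab (`walkAvg_hit_le_pow`). Inside one slab a single site is rarely visited more
than `δ / γ` times. Up to that number the moments of `X` are at most those of the constant killing
factor `exp (-c γ)`, for any `c < 𝔼[V(0)]`; truncating `V` covers an infinite mean. Crossing with
constant killing costs about `1 / cosh (κ K)` for any `κ < √(2 d c)` (`walkAvg_crossW_le`), and a
large `K` gives the rate `κ`.

Jensen's inequality also gives `B ≤ A`, so both quotients are squeezed to `√(2 d 𝔼[V(0)])`. -/

set_option linter.unusedSectionVars false

/-! ### The averaging operator of the simple random walk -/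

/-- The unit steps of the simple random walk on `ℤ^d`. -/
def stepVec {d : ℕ} (s : Fin d × Bool) : Fin d → ℤ :=
  if s.2 then Pi.single s.1 1 else -Pi.single s.1 1

/-- The average of `f` over the nearest neighbours of `x`. -/
noncomputable def nbrAvg {d : ℕ} (f : (Fin d → ℤ) → ℝ) (x : Fin d → ℤ) : ℝ :=
  (∑ s : Fin d × Bool, f (x + stepVec s)) / (2 * (d : ℝ))

section NbrAvg

variable {d : ℕ} {f g : (Fin d → ℤ) → ℝ} {x : Fin d → ℤ}

lemma sum_step {M : Type*} [AddCommMonoid M] (F : (Fin d → ℤ) → M) :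
    ∑ s : Fin d × Bool, F (stepVec s) = ∑ i : Fin d, (F (Pi.single i 1) + F (-Pi.single i 1)) := by
  rw [Fintype.sum_prod_type]
  refine Finset.sum_congr rfl fun i _ => ?_
  simp [stepVec]

lemma abs_stepVec_apply_le (s : Fin d × Bool) (i : Fin d) : |stepVec s i| ≤ 1 := by
  unfold stepVec
  by_cases hi : s.1 = i
  · subst hi
    split_ifs <;> simp
  · split_ifs <;> simp [Ne.symm hi]

lemma latticeLaplacian_eq (f : (Fin d → ℤ) → ℝ) (x : Fin d → ℤ) :
    latticeLaplacian f x = nbrAvg f x - f x := by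
  unfold latticeLaplacian nbrAvg
  rw [sum_step (fun e => f (x + e))]
  simp [sub_eq_add_neg]

lemma nbrAvg_mono_of_step (h : ∀ s, f (x + stepVec s) ≤ g (x + stepVec s)) :
    nbrAvg f x ≤ nbrAvg g x := by
  unfold nbrAvg
  gcongr with s _
  exact h s

lemma nbrAvg_mono (h : ∀ y, f y ≤ g y) : nbrAvg f x ≤ nbrAvg g x :=
  nbrAvg_mono_of_step fun _ => h _

lemma nbrAvg_nonneg (h : ∀ y, 0 ≤ f y) : 0 ≤ nbrAvg f x := by
  unfold nbrAvg
  have := Finset.sum_nonneg (s := Finset.univ) fun s _ => h (x + stepVec (d := d) s)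
  positivity

lemma nbrAvg_const (hd : 1 ≤ d) (c : ℝ) : nbrAvg (fun _ => c) x = c := by
  have : (d : ℝ) ≠ 0 := by positivity
  simp [nbrAvg]
  field_simp

lemma nbrAvg_mul_left (c : ℝ) : nbrAvg (fun y => c * f y) x = c * nbrAvg f x := by
  simp [nbrAvg, ← Finset.mul_sum, mul_div_assoc]

lemma nbrAvg_mul_right (c : ℝ) : nbrAvg (fun y => f y * c) x = nbrAvg f x * c := by
  simp only [mul_comm _ c, nbrAvg_mul_left]

lemma nbrAvg_add : nbrAvg (fun y => f y + g y) x = nbrAvg f x + nbrAvg g x := by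
  simp [nbrAvg, Finset.sum_add_distrib, add_div]

lemma nbrAvg_sub : nbrAvg (fun y => f y - g y) x = nbrAvg f x - nbrAvg g x := by
  simp [nbrAvg, Finset.sum_sub_distrib, sub_div]

lemma nbrAvg_sum {ι : Type*} (s : Finset ι) (F : ι → (Fin d → ℤ) → ℝ) :
    nbrAvg (fun y => ∑ i ∈ s, F i y) x = ∑ i ∈ s, nbrAvg (F i) x := by
  simp only [nbrAvg]
  rw [Finset.sum_comm, Finset.sum_div]

lemma abs_nbrAvg_le : |nbrAvg f x| ≤ nbrAvg (fun y => |f y|) x := by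
  unfold nbrAvg
  rw [abs_div, abs_of_nonneg (by positivity : (0 : ℝ) ≤ 2 * d)]
  gcongr
  exact Finset.abs_sum_le_sum_abs _ _

lemma nbrAvg_le_of_le (hd : 1 ≤ d) {c : ℝ} (h : ∀ y, f y ≤ c) : nbrAvg f x ≤ c :=
  (nbrAvg_mono h).trans (nbrAvg_const hd c).le

lemma le_nbrAvg_of_step (hf : ∀ y, 0 ≤ f y) (s : Fin d × Bool) :
    f (x + stepVec s) / (2 * d) ≤ nbrAvg f x := by
  unfold nbrAvg
  gcongr
  exact Finset.single_le_sum (f := fun s => f (x + stepVec s)) (fun _ _ => hf _)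
    (Finset.mem_univ s)

lemma tendsto_nbrAvg {ι : Type*} {l : Filter ι} {F : ι → (Fin d → ℤ) → ℝ}
    (h : ∀ y, Tendsto (fun i => F i y) l (𝓝 (f y))) :
    Tendsto (fun i => nbrAvg (F i) x) l (𝓝 (nbrAvg f x)) :=
  (tendsto_finsetSum _ fun _ _ => h _).div_const _

lemma nbrAvg_comp_add (z : Fin d → ℤ) :
    nbrAvg (fun y => f (y + z)) x = nbrAvg f (x + z) := by
  simp [nbrAvg, add_right_comm]

lemma nbrAvg_comp_neg : nbrAvg (fun y => f (-y)) x = nbrAvg f (-x) := by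
  simp only [nbrAvg]
  congr 1
  rw [← (Equiv.prodCongr (Equiv.refl (Fin d)) Equiv.boolNot).sum_comp]
  refine Finset.sum_congr rfl fun s _ => ?_
  obtain ⟨i, b⟩ := s
  congr 1
  cases b <;> simp [stepVec, add_comm]

lemma measurable_nbrAvg {Ω : Type*} [MeasurableSpace Ω] {F : Ω → (Fin d → ℤ) → ℝ}
    (h : ∀ y, Measurable fun ω => F ω y) : Measurable fun ω => nbrAvg (F ω) x := by
  unfold nbrAvg
  have := fun s => h (x + stepVec s)
  fun_prop

end NbrAvg

/-! ### Hitting weights, survival weights and Green's function -/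

section Weights

variable {d : ℕ}

/-- The total weight of the walks from `x` to `y` of length at most `n`, stopped when they first
reach `y`, where a visit to a site `z` contributes a factor `X z`. -/
noncomputable def hitW (X : (Fin d → ℤ) → ℝ) (y : Fin d → ℤ) : ℕ → (Fin d → ℤ) → ℝ
  | 0, x => if x = y then 1 else 0
  | n + 1, x => if x = y then 1 else X x * nbrAvg (hitW X y n) x

/-- The total weight of all walks from `x` to `y`, stopped when they first reach `y`. -/
noncomputable def hit (X : (Fin d → ℤ) → ℝ) (x y : Fin d → ℤ) : ℝ := ⨆ n, hitW X y n x

/-- The total weight of the first `n` positions of the walk started at `x`. -/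
noncomputable def surv (X : (Fin d → ℤ) → ℝ) : ℕ → (Fin d → ℤ) → ℝ
  | 0, _ => 1
  | n + 1, x => X x * nbrAvg (surv X n) x

/-- The total weight of the walks with `n` steps from `x` to `y`. -/
noncomputable def greenTerm (X : (Fin d → ℤ) → ℝ) (y : Fin d → ℤ) : ℕ → (Fin d → ℤ) → ℝ
  | 0, x => if x = y then X x else 0
  | n + 1, x => X x * nbrAvg (greenTerm X y n) x

/-- The total weight of all walks from `x` to `y`. -/
noncomputable def green (X : (Fin d → ℤ) → ℝ) (x y : Fin d → ℤ) : ℝ := ∑' n, greenTerm X y n x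

/-- Site weights in `(0, 1]`. -/
def IsWeight (X : (Fin d → ℤ) → ℝ) : Prop := ∀ x, 0 < X x ∧ X x ≤ 1

variable {X : (Fin d → ℤ) → ℝ} {x y z : Fin d → ℤ}

@[simp] lemma hitW_self (n : ℕ) : hitW X y n y = 1 := by
  cases n <;> simp [hitW]

lemma hitW_zero : hitW X y 0 x = if x = y then 1 else 0 := rfl

lemma hitW_succ_of_ne (h : x ≠ y) (n : ℕ) :
    hitW X y (n + 1) x = X x * nbrAvg (hitW X y n) x := by
  simp [hitW, h]

lemma hitW_nonneg (hX : IsWeight X) (n : ℕ) : 0 ≤ hitW X y n x := by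
  induction n generalizing x with
  | zero => rw [hitW_zero]; split_ifs <;> norm_num
  | succ n ih =>
    by_cases h : x = y
    · subst h; simp
    · rw [hitW_succ_of_ne h]
      exact mul_nonneg (hX x).1.le (nbrAvg_nonneg fun _ => ih)

/-- Comparison with supersolutions. -/
lemma hitW_le_of_super (hX : IsWeight X) {φ : (Fin d → ℤ) → ℝ} (h0 : ∀ x, 0 ≤ φ x)
    (hy : 1 ≤ φ y) (hφ : ∀ x, x ≠ y → X x * nbrAvg φ x ≤ φ x) (n : ℕ) (x : Fin d → ℤ) :
    hitW X y n x ≤ φ x := by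
  induction n generalizing x with
  | zero =>
    rw [hitW_zero]
    split_ifs with h
    · exact h ▸ hy
    · exact h0 x
  | succ n ih =>
    by_cases h : x = y
    · subst h; simpa using hy
    · rw [hitW_succ_of_ne h]
      exact (mul_le_mul_of_nonneg_left (nbrAvg_mono fun z => ih z) (hX x).1.le).trans (hφ x h)

lemma hitW_le_one (hd : 1 ≤ d) (hX : IsWeight X) (n : ℕ) : hitW X y n x ≤ 1 := by
  refine hitW_le_of_super hX (φ := fun _ => 1) (by simp) le_rfl (fun x _ => ?_) n x
  rw [nbrAvg_const hd, mul_one]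
  exact (hX x).2

lemma hitW_mono (hX : IsWeight X) : Monotone fun n => hitW X y n x := by
  refine monotone_nat_of_le_succ fun n => ?_
  induction n generalizing x with
  | zero =>
    rw [hitW_zero]
    split_ifs with h
    · subst h; simp
    · exact hitW_nonneg hX _
  | succ n ih =>
    by_cases h : x = y
    · subst h; simp
    · rw [hitW_succ_of_ne h, hitW_succ_of_ne h]
      exact mul_le_mul_of_nonneg_left (nbrAvg_mono fun z => ih) (hX x).1.le

lemma bddAbove_hitW (hd : 1 ≤ d) (hX : IsWeight X) :
    BddAbove (Set.range fun n => hitW X y n x) :=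
  ⟨1, by rintro _ ⟨n, rfl⟩; exact hitW_le_one hd hX n⟩

lemma tendsto_hitW (hd : 1 ≤ d) (hX : IsWeight X) (x y : Fin d → ℤ) :
    Tendsto (fun n => hitW X y n x) atTop (𝓝 (hit X x y)) :=
  tendsto_atTop_ciSup (hitW_mono hX) (bddAbove_hitW hd hX)

lemma hitW_le_hit (hd : 1 ≤ d) (hX : IsWeight X) (n : ℕ) : hitW X y n x ≤ hit X x y :=
  le_ciSup (bddAbove_hitW hd hX) n

@[simp] lemma hit_self : hit X y y = 1 := by simp [hit]

lemma hit_nonneg (hd : 1 ≤ d) (hX : IsWeight X) : 0 ≤ hit X x y :=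
  (hitW_nonneg hX 0).trans (hitW_le_hit hd hX 0)

lemma hit_le_one (hd : 1 ≤ d) (hX : IsWeight X) : hit X x y ≤ 1 :=
  ciSup_le fun n => hitW_le_one hd hX n

lemma hit_of_ne (hd : 1 ≤ d) (hX : IsWeight X) (h : x ≠ y) :
    hit X x y = X x * nbrAvg (fun z => hit X z y) x := by
  refine tendsto_nhds_unique ((tendsto_add_atTop_iff_nat 1).2 (tendsto_hitW hd hX x y)) ?_
  simp only [hitW_succ_of_ne h]
  exact (tendsto_nbrAvg fun z => tendsto_hitW hd hX z y).const_mul _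

lemma hit_le_weight (hd : 1 ≤ d) (hX : IsWeight X) (h : x ≠ y) : hit X x y ≤ X x := by
  rw [hit_of_ne hd hX h]
  exact mul_le_of_le_one_right (hX x).1.le (nbrAvg_le_of_le hd fun z => hit_le_one hd hX)

/-- A walk to `y` followed by a walk to `z` is a walk to `z`, except that it may meet `z` on the way
to `y`. Stopping at that earlier visit replaces a total weight of at most `1` by `1`. -/
lemma hitW_mul_le (hd : 1 ≤ d) (hX : IsWeight X) (m n : ℕ) (x y z : Fin d → ℤ) :
    hitW X y m x * hitW X z n y ≤ hitW X z (m + n) x := by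
  induction m generalizing x with
  | zero =>
    rw [hitW_zero]
    split_ifs with h
    · simp [h]
    · simpa using hitW_nonneg hX n
  | succ m ih =>
    by_cases h : x = y
    · subst h
      simpa using hitW_mono hX (show n ≤ m + 1 + n by omega)
    by_cases hz : x = z
    · subst hz
      simpa using mul_le_one₀ (hitW_le_one hd hX (m + 1)) (hitW_nonneg hX n)
        (hitW_le_one hd hX n)
    rw [show m + 1 + n = (m + n) + 1 by omega, hitW_succ_of_ne h, hitW_succ_of_ne hz, mul_assoc,
      ← nbrAvg_mul_right]
    exact mul_le_mul_of_nonneg_left (nbrAvg_mono ih) (hX x).1.le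

lemma hit_mul_le (hd : 1 ≤ d) (hX : IsWeight X) (x y z : Fin d → ℤ) :
    hit X x y * hit X y z ≤ hit X x z :=
  le_of_tendsto' ((tendsto_hitW hd hX x y).mul (tendsto_hitW hd hX y z)) fun n =>
    (hitW_mul_le hd hX n n x y z).trans (hitW_le_hit hd hX _)

lemma hitW_one_step (hX : IsWeight X) (x : Fin d → ℤ) (s : Fin d × Bool) :
    X x / (2 * d) ≤ hitW X (x + stepVec s) 1 x := by
  have hs : stepVec s ≠ (0 : Fin d → ℤ) := by
    unfold stepVec
    split_ifs <;> simp
  have hne : x ≠ x + stepVec s := by simpa using hs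
  rw [hitW_succ_of_ne hne]
  have := le_nbrAvg_of_step (f := hitW X (x + stepVec s) 0) (x := x)
    (fun z => hitW_nonneg hX 0) s
  rw [hitW_self] at this
  calc X x / (2 * d) = X x * (1 / (2 * d)) := by ring
    _ ≤ _ := mul_le_mul_of_nonneg_left this (hX x).1.le

lemma hitW_comp_add (n : ℕ) (x y z : Fin d → ℤ) :
    hitW (fun u => X (u + z)) y n x = hitW X (y + z) n (x + z) := by
  induction n generalizing x with
  | zero => simp [hitW_zero]
  | succ n ih =>
    by_cases h : x = y
    · subst h; simp
    · rw [hitW_succ_of_ne h, hitW_succ_of_ne (by simpa using h), ← nbrAvg_comp_add]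
      congr 2
      ext u
      exact ih u

lemma hitW_comp_neg (n : ℕ) (x y : Fin d → ℤ) :
    hitW (fun u => X (-u)) y n x = hitW X (-y) n (-x) := by
  induction n generalizing x with
  | zero => simp [hitW_zero]
  | succ n ih =>
    by_cases h : x = y
    · subst h; simp
    · rw [hitW_succ_of_ne h, hitW_succ_of_ne (by simpa using h), ← nbrAvg_comp_neg]
      congr 2
      ext u
      exact ih u

lemma hit_comp_add (x y z : Fin d → ℤ) :
    hit (fun u => X (u + z)) x y = hit X (x + z) (y + z) := by
  simp [hit, hitW_comp_add]

lemma hit_comp_neg (x y : Fin d → ℤ) : hit (fun u => X (-u)) x y = hit X (-x) (-y) := by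
  simp [hit, hitW_comp_neg]

lemma surv_zero : surv X 0 x = 1 := rfl

lemma surv_succ (n : ℕ) : surv X (n + 1) x = X x * nbrAvg (surv X n) x := rfl

lemma surv_one (hd : 1 ≤ d) : surv X 1 x = X x := by
  rw [surv_succ, show surv X 0 = fun _ => 1 from rfl, nbrAvg_const hd, mul_one]

lemma surv_nonneg (hX : IsWeight X) (n : ℕ) : 0 ≤ surv X n x := by
  induction n generalizing x with
  | zero => simp [surv]
  | succ n ih => exact mul_nonneg (hX x).1.le (nbrAvg_nonneg fun _ => ih)

lemma greenTerm_nonneg (hX : IsWeight X) (n : ℕ) : 0 ≤ greenTerm X y n x := by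
  induction n generalizing x with
  | zero => simp only [greenTerm]; split_ifs <;> simp [(hX x).1.le]
  | succ n ih => exact mul_nonneg (hX x).1.le (nbrAvg_nonneg fun _ => ih)

lemma greenTerm_le_surv (hd : 1 ≤ d) (hX : IsWeight X) (n : ℕ) :
    greenTerm X y n x ≤ surv X (n + 1) x := by
  induction n generalizing x with
  | zero =>
    simp only [greenTerm, surv, nbrAvg_const hd, mul_one]
    split_ifs
    · rfl
    · exact (hX x).1.le
  | succ n ih => exact mul_le_mul_of_nonneg_left (nbrAvg_mono fun z => ih) (hX x).1.le

/-- The walk is transient or killed: the total survival weight is finite. -/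
def SummableSurv (X : (Fin d → ℤ) → ℝ) : Prop := ∀ x, Summable fun n => surv X n x

lemma summable_greenTerm (hd : 1 ≤ d) (hX : IsWeight X) (hs : SummableSurv X) :
    Summable fun n => greenTerm X y n x :=
  Summable.of_nonneg_of_le (fun n => greenTerm_nonneg hX n) (fun n => greenTerm_le_surv hd hX n)
    ((summable_nat_add_iff 1).2 (hs x))

/-- A bounded function dominated by the average of its absolute value vanishes. -/
lemma eq_zero_of_abs_le (hX : IsWeight X) (hs : SummableSurv X)
    {u : (Fin d → ℤ) → ℝ} {C : ℝ} (hC : ∀ y, |u y| ≤ C)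
    (hu : ∀ y, |u y| ≤ X y * nbrAvg (fun z => |u z|) y) (y : Fin d → ℤ) : u y = 0 := by
  -- Iterating the hypothesis `n` times puts the survival weight of `n` steps in front of the
  -- uniform bound; by summability it tends to `0`.
  have key : ∀ n y, |u y| ≤ C * surv X n y := by
    intro n
    induction n with
    | zero => intro y; simpa [surv] using hC y
    | succ n ih =>
      intro y
      calc |u y| ≤ X y * nbrAvg (fun z => |u z|) y := hu y
        _ ≤ X y * nbrAvg (fun z => C * surv X n z) y :=
            mul_le_mul_of_nonneg_left (nbrAvg_mono ih) (hX y).1.le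
        _ = C * surv X (n + 1) y := by rw [nbrAvg_mul_left, surv]; ring
  have h1 : Tendsto (fun n => C * surv X n y) atTop (𝓝 (C * 0)) :=
    (hs y).tendsto_atTop_zero.const_mul C
  have h2 : |u y| ≤ C * 0 := ge_of_tendsto' h1 fun n => key n y
  simpa using h2

lemma green_eq (hd : 1 ≤ d) (hX : IsWeight X) (hs : SummableSurv X) :
    green X x y = (if x = y then X x else 0) + X x * nbrAvg (fun z => green X z y) x := by
  unfold green
  rw [(summable_greenTerm hd hX hs).tsum_eq_zero_add]
  congr 1
  simp only [greenTerm]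
  rw [tsum_mul_left]
  congr 1
  unfold nbrAvg
  rw [tsum_div_const, Summable.tsum_finsetSum fun s _ => summable_greenTerm hd hX hs]

lemma green_nonneg (hX : IsWeight X) : 0 ≤ green X x y := tsum_nonneg fun n => greenTerm_nonneg hX n

lemma weight_le_green_self (hd : 1 ≤ d) (hX : IsWeight X) (hs : SummableSurv X) :
    X y ≤ green X y y := by
  rw [green_eq hd hX hs, if_pos rfl]
  exact le_add_of_nonneg_right (mul_nonneg (hX y).1.le (nbrAvg_nonneg fun z => green_nonneg hX))

/-- Maximum principle, applied to partial sums over the length of the walk: away from `y` such a sum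
is a weight at most `1` times an average of the previous one. -/
lemma green_le_self (hd : 1 ≤ d) (hX : IsWeight X) (hs : SummableSurv X) :
    green X x y ≤ green X y y := by
  have key : ∀ n x, ∑ k ∈ Finset.range n, greenTerm X y k x ≤ green X y y := by
    intro n
    induction n with
    | zero => intro x; simpa using green_nonneg hX
    | succ n ih =>
      intro x
      by_cases h : x = y
      · subst h
        exact (summable_greenTerm hd hX hs).sum_le_tsum _ fun k _ => greenTerm_nonneg hX k
      · rw [Finset.sum_range_succ']
        simp only [greenTerm, if_neg h, add_zero, ← Finset.mul_sum]
        rw [← nbrAvg_sum]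
        calc X x * nbrAvg (fun z => ∑ k ∈ Finset.range n, greenTerm X y k z) x
            ≤ 1 * green X y y := by
              refine mul_le_mul (hX x).2 (nbrAvg_le_of_le hd ih) (nbrAvg_nonneg fun z =>
                Finset.sum_nonneg fun k _ => greenTerm_nonneg hX k) zero_le_one
          _ = green X y y := one_mul _
  exact le_of_tendsto' (summable_greenTerm hd hX hs).hasSum.tendsto_sum_nat fun n => key n x

/-- Both sides agree at `y` and solve the same homogeneous equation elsewhere. Their difference is
bounded, so `eq_zero_of_abs_le` applies. -/
lemma green_eq_hit_mul (hd : 1 ≤ d) (hX : IsWeight X) (hs : SummableSurv X)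
    (x y : Fin d → ℤ) : green X x y = hit X x y * green X y y := by
  have := eq_zero_of_abs_le hX hs (u := fun x => green X x y - hit X x y * green X y y)
    (C := green X y y) ?_ ?_ x
  · linarith
  · intro x
    have h1 := green_le_self (x := x) (y := y) hd hX hs
    have h2 : 0 ≤ green X x y := green_nonneg hX
    have h3 : 0 ≤ green X y y := green_nonneg hX
    have h4 := mul_le_of_le_one_left h3 (hit_le_one (x := x) (y := y) hd hX)
    have h5 := mul_nonneg (hit_nonneg (x := x) (y := y) hd hX) h3
    rw [abs_le]
    constructor <;> linarith
  · intro x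
    by_cases h : x = y
    · subst h
      simpa using mul_nonneg (hX x).1.le (nbrAvg_nonneg fun _ => abs_nonneg _)
    · rw [green_eq hd hX hs, hit_of_ne hd hX h, if_neg h, zero_add, mul_assoc,
        ← nbrAvg_mul_right, ← mul_sub, ← nbrAvg_sub, abs_mul, abs_of_pos (hX x).1]
      exact mul_le_mul_of_nonneg_left abs_nbrAvg_le (hX x).1.le

end Weights

/-! ### Green's function of the operator as a sum over weighted walks -/

section Potential

variable {d : ℕ}

/-- The site weight `1 / (1 + W)` of a potential `W`. -/
noncomputable def siteWeight (W : (Fin d → ℤ) → ℝ) (x : Fin d → ℤ) : ℝ := (1 + W x)⁻¹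

lemma isWeight_siteWeight {W : (Fin d → ℤ) → ℝ} (hW : ∀ x, 0 ≤ W x) : IsWeight (siteWeight W) := by
  intro x
  have := hW x
  exact ⟨by unfold siteWeight; positivity, inv_le_one_of_one_le₀ (by linarith)⟩

/-- Division by `1 + W y > 0` turns the operator equation into the first-step equation of the
weighted walk. -/
lemma greenSolution_iff {W u : (Fin d → ℤ) → ℝ} (hW : ∀ x, 0 ≤ W x) (y : Fin d → ℤ) :
    (-latticeLaplacian u y + W y * u y = if y = 0 then 1 else 0) ↔
      u y = (if y = 0 then siteWeight W y else 0) + siteWeight W y * nbrAvg u y := by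
  have h : 0 < 1 + W y := by have := hW y; linarith
  rw [latticeLaplacian_eq]
  unfold siteWeight
  split_ifs
  · field_simp
    constructor <;> intro h <;> linarith
  · field_simp
    constructor <;> intro h <;> linarith

lemma isBoundedGreenSolution_green (hd : 1 ≤ d) {W : (Fin d → ℤ) → ℝ} (hW : ∀ x, 0 ≤ W x)
    (hs : SummableSurv (siteWeight W)) :
    IsBoundedGreenSolution W fun y => green (siteWeight W) y 0 := by
  have hX := isWeight_siteWeight hW
  refine ⟨⟨green (siteWeight W) 0 0, fun y => ?_⟩, fun y => ?_⟩
  · rw [abs_of_nonneg (green_nonneg hX)]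
    exact green_le_self hd hX hs
  · rw [greenSolution_iff hW]
    exact green_eq hd hX hs

lemma existsUnique_green (hd : 1 ≤ d) {W : (Fin d → ℤ) → ℝ} (hW : ∀ x, 0 ≤ W x)
    (hs : SummableSurv (siteWeight W)) : ∃! u, IsBoundedGreenSolution W u := by
  have hX := isWeight_siteWeight hW
  refine ⟨_, isBoundedGreenSolution_green hd hW hs, ?_⟩
  rintro u ⟨⟨C, hC⟩, hu⟩
  have hD : 0 ≤ green (siteWeight W) 0 0 := green_nonneg hX
  ext y
  have := eq_zero_of_abs_le hX hs (u := fun y => u y - green (siteWeight W) y 0)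
    (C := C + green (siteWeight W) 0 0) (fun y => ?_) (fun y => ?_) y
  · linarith
  · refine (abs_sub _ _).trans (add_le_add (hC y) ?_)
    rw [abs_of_nonneg (green_nonneg hX)]
    exact green_le_self hd hX hs
  · rw [(greenSolution_iff hW y).1 (hu y), green_eq hd hX hs, add_sub_add_left_eq_sub, ← mul_sub,
      ← nbrAvg_sub, abs_mul, abs_of_pos (hX y).1]
    exact mul_le_mul_of_nonneg_left abs_nbrAvg_le (hX y).1.le

lemma operatorGreen_eq (hd : 1 ≤ d) {W : (Fin d → ℤ) → ℝ} (hW : ∀ x, 0 ≤ W x)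
    (hs : SummableSurv (siteWeight W)) (y : Fin d → ℤ) :
    operatorGreen W y = green (siteWeight W) y 0 := by
  have h := existsUnique_green hd hW hs
  rw [operatorGreen, dif_pos h]
  exact congrFun (h.unique h.choose_spec.1 (isBoundedGreenSolution_green hd hW hs)) y

end Potential

/-! ### Averages over random walk paths -/

section WalkAvg

variable {d : ℕ}

/-- The average of `F` over the nearest-neighbour paths with `n` steps that start at `x`. -/
noncomputable def walkAvg : ℕ → (Fin d → ℤ) → (List (Fin d → ℤ) → ℝ) → ℝ
  | 0, x, F => F [x]
  | n + 1, x, F => nbrAvg (fun y => walkAvg n y fun l => F (x :: l)) x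

/-- `l` is a nearest-neighbour path with `n` steps that starts at `x`. -/
def IsWalk (n : ℕ) (x : Fin d → ℤ) (l : List (Fin d → ℤ)) : Prop :=
  l.IsChain (fun a b => ∃ s, b = a + stepVec s) ∧ l.head? = some x ∧ l.length = n + 1

variable {F G : List (Fin d → ℤ) → ℝ} {x y : Fin d → ℤ} {n : ℕ}

lemma IsWalk.cons {l : List (Fin d → ℤ)} {s : Fin d × Bool} (h : IsWalk n (x + stepVec s) l) :
    IsWalk (n + 1) x (x :: l) := by
  obtain ⟨h1, h2, h3⟩ := h
  refine ⟨List.isChain_cons.2 ⟨fun z hz => ?_, h1⟩, rfl, by simp [h3]⟩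
  rw [h2] at hz
  exact ⟨s, by simpa using hz.symm⟩

lemma walkAvg_mono_of_isWalk (h : ∀ l, IsWalk n x l → F l ≤ G l) :
    walkAvg n x F ≤ walkAvg n x G := by
  induction n generalizing x F G with
  | zero => exact h _ ⟨List.isChain_singleton _, rfl, rfl⟩
  | succ n ih => exact nbrAvg_mono_of_step fun s => ih fun l hl => h _ hl.cons

lemma walkAvg_mono (h : ∀ l, F l ≤ G l) : walkAvg n x F ≤ walkAvg n x G :=
  walkAvg_mono_of_isWalk fun l _ => h l

lemma walkAvg_const (hd : 1 ≤ d) (c : ℝ) : walkAvg n x (fun _ => c) = c := by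
  induction n generalizing x with
  | zero => rfl
  | succ n ih => simp only [walkAvg, ih, nbrAvg_const hd]

lemma walkAvg_nonneg (h : ∀ l, 0 ≤ F l) : 0 ≤ walkAvg n x F := by
  induction n generalizing x F with
  | zero => exact h _
  | succ n ih => exact nbrAvg_nonneg fun y => ih fun l => h _

lemma walkAvg_mul_left (c : ℝ) : walkAvg n x (fun l => c * F l) = c * walkAvg n x F := by
  induction n generalizing x F with
  | zero => rfl
  | succ n ih => simp only [walkAvg, ih, nbrAvg_mul_left]

lemma walkAvg_mul_right (c : ℝ) : walkAvg n x (fun l => F l * c) = walkAvg n x F * c := by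
  simp only [mul_comm _ c, walkAvg_mul_left]

lemma walkAvg_add : walkAvg n x (fun l => F l + G l) = walkAvg n x F + walkAvg n x G := by
  induction n generalizing x F G with
  | zero => rfl
  | succ n ih => simp only [walkAvg, ih, nbrAvg_add]

lemma walkAvg_sum {ι : Type*} (s : Finset ι) (F : ι → List (Fin d → ℤ) → ℝ) :
    walkAvg n x (fun l => ∑ i ∈ s, F i l) = ∑ i ∈ s, walkAvg n x (F i) := by
  classical
  induction s using Finset.induction_on with
  | empty => simpa using walkAvg_mul_left (n := n) (x := x) (F := fun _ => 0) 0
  | insert i s hi ih => simp only [Finset.sum_insert hi, walkAvg_add, ih]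

lemma surv_eq_walkAvg (hd : 1 ≤ d) (X : (Fin d → ℤ) → ℝ) (n : ℕ) (x : Fin d → ℤ) :
    surv X (n + 1) x = walkAvg n x fun l => (l.map X).prod := by
  induction n generalizing x with
  | zero => simp [surv, walkAvg, nbrAvg_const hd]
  | succ n ih =>
    rw [surv, walkAvg]
    simp only [List.map_cons, List.prod_cons, walkAvg_mul_left]
    rw [nbrAvg_mul_left]
    congr 2
    ext y
    exact ih y

/-- Paths of fixed length `n` are used even though the walk stops at `y`: what follows the first
visit carries no weight and averages to `1`. The site `y` itself contributes no factor. -/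
lemma hitW_eq_walkAvg (hd : 1 ≤ d) (X : (Fin d → ℤ) → ℝ) (y : Fin d → ℤ) (n : ℕ)
    (x : Fin d → ℤ) :
    hitW X y n x = walkAvg n x fun l =>
      if y ∈ l then ((l.takeWhile (· ≠ y)).map X).prod else 0 := by
  induction n generalizing x with
  | zero =>
    by_cases h : x = y
    · simp [walkAvg, h]
    · simp [hitW_zero, walkAvg, h, Ne.symm h]
  | succ n ih =>
    by_cases h : x = y
    · subst h
      simp [walkAvg, walkAvg_const hd, nbrAvg_const hd]
    · rw [hitW_succ_of_ne h, walkAvg, ← nbrAvg_mul_left]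
      congr 1
      ext z
      rw [ih, ← walkAvg_mul_left]
      congr 1
      ext l
      by_cases hl : y ∈ l <;> simp [hl, h, Ne.symm h]

/-- The strong Markov inequality at the exit time of the set `{x | p x}`. -/
lemma walkAvg_exit_le (hd : 1 ≤ d) {p : (Fin d → ℤ) → Bool} {I : (Fin d → ℤ) → Prop}
    (hI : ∀ x, I x → p x → ∀ s, I (x + stepVec s)) {C : ℝ} (hnil : F [] = 0)
    (hF : ∀ j y, I y → ¬ p y → walkAvg j y F ≤ C)
    {Ψ : List (Fin d → ℤ) → ℝ} (hΨ : ∀ l, 0 ≤ Ψ l) (n : ℕ) (x : Fin d → ℤ) (hx : I x) :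
    walkAvg n x (fun l => Ψ (l.takeWhile p) * F (l.dropWhile p)) ≤
      C * walkAvg n x (fun l => if l.all p then 0 else Ψ (l.takeWhile p)) := by
  induction n generalizing x Ψ with
  | zero =>
    by_cases h : p x
    -- A path without exit leaves an empty `dropWhile`, and `hnil` makes its contribution `0`.
    · simp [walkAvg, h, hnil]
    · have := mul_le_mul_of_nonneg_left (hF 0 x hx h) (hΨ [])
      simpa [walkAvg, h, mul_comm] using this
  | succ n ih =>
    by_cases h : p x
    · simp only [walkAvg, List.takeWhile_cons, h, List.dropWhile_cons, if_true, List.all_cons,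
        Bool.true_and]
      rw [← nbrAvg_mul_left]
      exact nbrAvg_mono_of_step fun s => ih (Ψ := fun l => Ψ (x :: l)) (fun l => hΨ _) _
        (hI x hx h s)
    · have h1 := mul_le_mul_of_nonneg_left (hF (n + 1) x hx h) (hΨ [])
      rw [← walkAvg_mul_left] at h1
      rw [Bool.not_eq_true] at h
      simp only [walkAvg, List.takeWhile_cons, h, List.dropWhile_cons] at h1 ⊢
      simpa [walkAvg_const hd, nbrAvg_const hd, mul_comm C, h] using h1

end WalkAvg

/-! ### Heights in a direction -/

section Height

variable {d : ℕ}

/-- The scalar product `⟨v, x⟩` of a vector with a lattice point. -/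
noncomputable def height (v : Fin d → ℝ) (x : Fin d → ℤ) : ℝ := ∑ i, v i * x i

variable {v : Fin d → ℝ} {x y : Fin d → ℤ}

lemma height_add : height v (x + y) = height v x + height v y := by
  simp [height, mul_add, Finset.sum_add_distrib]

lemma height_neg : height v (-x) = -height v x := by
  simp [height]

lemma height_zero : height v 0 = 0 := by simp [height]

lemma height_single (i : Fin d) : height v (Pi.single i 1) = v i := by
  unfold height
  rw [Finset.sum_eq_single i] <;> simp +contextual

lemma height_of_single (i : Fin d) : height (Pi.single i 1) x = x i := by
  unfold height
  rw [Finset.sum_eq_single i] <;> simp +contextual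

lemma height_nsmul (k : ℕ) : height v (k • x) = k * height v x := by
  simp [height, Finset.mul_sum, mul_left_comm]

lemma abs_height_stepVec (hv : ∀ i, |v i| ≤ 1) (s : Fin d × Bool) : |height v (stepVec s)| ≤ 1 := by
  unfold stepVec
  split_ifs
  · rw [height_single]; exact hv _
  · rw [height_neg, height_single, abs_neg]; exact hv _

lemma nbrAvg_height (f : ℝ → ℝ) :
    nbrAvg (fun y => f (height v y)) x =
      (∑ i, (f (height v x + v i) + f (height v x - v i))) / (2 * d) := by
  unfold nbrAvg
  simp only [height_add]
  rw [sum_step (fun e => f (height v x + height v e))]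
  simp [height_single, height_neg, sub_eq_add_neg]

end Height

/-! ### The range of the walk -/

section Range

variable {d : ℕ}

/-- Discrete intermediate value property: a step changes each coordinate by at most `1`. -/
lemma IsWalk.exists_mem_coord {n : ℕ} {x : Fin d → ℤ} {l : List (Fin d → ℤ)} (h : IsWalk n x l)
    (i : Fin d) {z : Fin d → ℤ} (hz : z ∈ l) {t : ℤ} (ht : t ∈ Set.uIcc (x i) (z i)) :
    ∃ y ∈ l, y i = t := by
  induction l generalizing n x with
  | nil => simp at hz
  | cons a l ih =>
    obtain ⟨h1, h2, h3⟩ := h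
    obtain rfl : a = x := by simpa using h2
    by_cases hta : t = a i
    · exact ⟨a, by simp, hta.symm⟩
    rcases List.mem_cons.1 hz with rfl | hz'
    · simp at ht
      exact absurd ht hta
    obtain ⟨b, l', rfl⟩ : ∃ b l', l = b :: l' := by
      cases l with
      | nil => simp at hz'
      | cons b l' => exact ⟨b, l', rfl⟩
    obtain ⟨s, hs⟩ := (List.isChain_cons_cons.1 h1).1
    have hb : |b i - a i| ≤ 1 := by
      simpa [hs] using abs_stepVec_apply_le s i
    have ht' : t ∈ Set.uIcc (b i) (z i) := by
      rw [Set.mem_uIcc] at ht ⊢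
      rw [abs_le] at hb
      omega
    obtain ⟨y, hy, hyt⟩ := ih (n := l'.length) ⟨(List.isChain_cons_cons.1 h1).2, rfl, by simp⟩
      hz' ht'
    exact ⟨y, List.mem_cons_of_mem _ hy, hyt⟩

lemma IsWalk.abs_coord_lt_card {n : ℕ} {x : Fin d → ℤ} {l : List (Fin d → ℤ)} (h : IsWalk n x l)
    (i : Fin d) {z : Fin d → ℤ} (hz : z ∈ l) : |z i - x i| < (l.toFinset.card : ℤ) := by
  have hsub : Finset.uIcc (x i) (z i) ⊆ l.toFinset.image fun y => y i := by
    intro t ht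
    rw [← Finset.mem_coe, Finset.coe_uIcc] at ht
    obtain ⟨y, hy, hyt⟩ := h.exists_mem_coord i hz ht
    exact Finset.mem_image.2 ⟨y, by simpa using hy, hyt⟩
  have := (Finset.card_le_card hsub).trans Finset.card_image_le
  rw [Int.card_uIcc] at this
  rw [Int.abs_eq_natAbs]
  omega

/-- The walk leaves a slab of width `2 * r` after at most `d r²` steps on average. -/
lemma sum_surv_slab_le (hd : 1 ≤ d) (i : Fin d) (a : ℤ) (r : ℕ) (N : ℕ) (x : Fin d → ℤ)
    (hx : |x i - a| ≤ r) :
    ∑ n ∈ Finset.range N, surv (fun y => if |y i - a| < (r : ℤ) then 1 else 0) (n + 1) x ≤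
      d * ((r : ℝ) ^ 2 - ((x i - a : ℤ) : ℝ) ^ 2) := by
  have hd0 : (d : ℝ) ≠ 0 := by positivity
  induction N generalizing x with
  | zero =>
    have : ((x i - a : ℤ) : ℝ) ^ 2 ≤ (r : ℝ) ^ 2 := by
      rw [sq_le_sq, abs_of_nonneg (by positivity : (0 : ℝ) ≤ r)]
      exact_mod_cast hx
    simpa using mul_nonneg (by positivity : (0 : ℝ) ≤ d) (sub_nonneg.2 this)
  | succ N ih =>
    rcases hx.lt_or_eq with h | h
    · rw [Finset.sum_range_succ']
      rw [surv_one hd, if_pos h]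
      simp only [surv_succ (_ + 1), if_pos h, one_mul]
      rw [← nbrAvg_sum]
      have h1 : nbrAvg (fun y => ∑ n ∈ Finset.range N,
          surv (fun y => if |y i - a| < (r : ℤ) then 1 else 0) (n + 1) y) x ≤
          nbrAvg (fun y => d * ((r : ℝ) ^ 2 - (height (Pi.single i 1) y - a) ^ 2)) x := by
        refine nbrAvg_mono_of_step fun s => ?_
        rw [height_of_single]
        have := ih (x + stepVec s) ?_
        · simpa using this
        · have hs := abs_stepVec_apply_le s i
          rw [Pi.add_apply]
          rw [abs_le] at hs ⊢
          rw [abs_lt] at h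
          omega
      rw [nbrAvg_height (fun t => (d : ℝ) * ((r : ℝ) ^ 2 - (t - a) ^ 2)), height_of_single] at h1
      -- Only the two steps along `i` change the square, so the average of `d (r² - t²)` over the
      -- neighbours is smaller by exactly `1`. This pays for the time spent at `x`.
      have h2 : ∑ j : Fin d, ((d : ℝ) * ((r : ℝ) ^ 2 - ((x i : ℝ) + (Pi.single i 1 : Fin d → ℝ) j
          - a) ^ 2) + d * ((r : ℝ) ^ 2 - ((x i : ℝ) - (Pi.single i 1 : Fin d → ℝ) j - a) ^ 2)) =
          2 * d * (d * ((r : ℝ) ^ 2 - ((x i : ℝ) - a) ^ 2) - 1) := by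
        have : ∀ j : Fin d, ((d : ℝ) * ((r : ℝ) ^ 2 - ((x i : ℝ) + (Pi.single i 1 : Fin d → ℝ) j
            - a) ^ 2) + d * ((r : ℝ) ^ 2 - ((x i : ℝ) - (Pi.single i 1 : Fin d → ℝ) j - a) ^ 2)) =
            2 * (d * ((r : ℝ) ^ 2 - ((x i : ℝ) - a) ^ 2)) - if j = i then 2 * d else 0 := by
          intro j
          by_cases hj : j = i
          · subst hj; simp; ring
          · simp [hj]; ring
        simp only [this, Finset.sum_sub_distrib]
        simp
        ring
      rw [h2, mul_div_cancel_left₀ _ (by positivity)] at h1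
      push_cast
      linarith
    · have h0 : ∀ n, surv (fun y => if |y i - a| < (r : ℤ) then 1 else 0) (n + 1) x = 0 := by
        intro n
        rw [surv_succ, if_neg (by omega), zero_mul]
      simp only [h0, Finset.sum_const_zero]
      have : ((x i - a : ℤ) : ℝ) ^ 2 = (r : ℝ) ^ 2 := by
        rw [← sq_abs]
        congr 1
        exact_mod_cast h
      rw [this, sub_self, mul_zero]

/-- A walk with `r` distinct sites stays within distance less than `r` of its start in the chosen
coordinate. The expected time spent in that slab is at most `d r²`, and `∑ q ^ r * d r²` converges.
-/
lemma summable_walkAvg_pow_card (hd : 1 ≤ d) {q : ℝ} (hq0 : 0 ≤ q) (hq1 : q < 1)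
    (x : Fin d → ℤ) : Summable fun n => walkAvg n x fun l => q ^ l.toFinset.card := by
  have hsum : Summable fun r : ℕ => q ^ r * (d * (r : ℝ) ^ 2) := by
    have := (summable_pow_mul_geometric_of_norm_lt_one (R := ℝ) 2 (r := q)
      (by rwa [Real.norm_of_nonneg hq0])).mul_left (d : ℝ)
    refine this.congr fun r => by ring
  refine summable_of_sum_range_le (c := ∑' r : ℕ, q ^ r * (d * (r : ℝ) ^ 2))
    (fun n => walkAvg_nonneg fun l => by positivity) fun N => ?_
  let i : Fin d := ⟨0, hd⟩
  have h1 : ∀ n ∈ Finset.range N, walkAvg n x (fun l => q ^ l.toFinset.card) ≤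
      ∑ r ∈ Finset.range (N + 1), q ^ r *
        surv (fun y => if |y i - x i| < (r : ℤ) then 1 else 0) (n + 1) x := by
    intro n hn
    simp only [surv_eq_walkAvg hd, ← walkAvg_mul_left]
    rw [← walkAvg_sum]
    refine walkAvg_mono_of_isWalk fun l hl => ?_
    have hcard : l.toFinset.card ∈ Finset.range (N + 1) := by
      have := l.toFinset_card_le
      have := hl.2.2
      simp at hn ⊢
      omega
    have hprod : ∀ r : ℕ, 0 ≤ (l.map fun y => if |y i - x i| < (r : ℤ) then (1 : ℝ) else 0).prod :=
      fun r => List.prod_nonneg fun a ha => by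
        obtain ⟨y, _, rfl⟩ := List.mem_map.1 ha
        positivity
    refine le_trans (le_of_eq ?_) (Finset.single_le_sum (f := fun r : ℕ => q ^ r *
      (l.map fun y => if |y i - x i| < (r : ℤ) then (1 : ℝ) else 0).prod)
      (fun r _ => mul_nonneg (by positivity) (hprod r)) hcard)
    rw [List.prod_eq_one, mul_one]
    intro a ha
    obtain ⟨y, hy, rfl⟩ := List.mem_map.1 ha
    rw [if_pos (hl.abs_coord_lt_card i hy)]
  refine (Finset.sum_le_sum h1).trans ?_
  rw [Finset.sum_comm]
  refine le_trans (Finset.sum_le_sum fun r _ => ?_) (hsum.sum_le_tsum (Finset.range (N + 1))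
    fun r _ => by positivity)
  rw [← Finset.mul_sum]
  refine mul_le_mul_of_nonneg_left ?_ (by positivity)
  have := sum_surv_slab_le hd i (x i) r N x (by simp)
  simpa using this

end Range

/-! ### Averaged weights of paths -/

section AnnW

variable {d : ℕ}

/-- The product over the sites of a path of `Λ` evaluated at the number of visits. -/
noncomputable def annW (Λ : ℕ → ℝ) (l : List (Fin d → ℤ)) : ℝ :=
  ∏ z ∈ l.toFinset, Λ (l.count z)

/-- The properties of the moments of a random variable with values in `(0, 1]` that are used. -/
structure IsMomentSeq (Λ : ℕ → ℝ) : Prop where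
  zero : Λ 0 = 1
  nonneg : ∀ k, 0 ≤ Λ k
  antitone : Antitone Λ
  mul_le : ∀ j k, Λ j * Λ k ≤ Λ (j + k)

variable {Λ : ℕ → ℝ} {l l' : List (Fin d → ℤ)}

lemma annW_eq_prod (h : IsMomentSeq Λ) {S : Finset (Fin d → ℤ)} (hS : l.toFinset ⊆ S) :
    annW Λ l = ∏ z ∈ S, Λ (l.count z) := by
  refine Finset.prod_subset hS fun z _ hz => ?_
  rw [List.count_eq_zero_of_not_mem (by simpa using hz), h.zero]

lemma annW_nil : annW Λ ([] : List (Fin d → ℤ)) = 1 := by simp [annW]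

lemma annW_nonneg (h : IsMomentSeq Λ) (l : List (Fin d → ℤ)) : 0 ≤ annW Λ l :=
  Finset.prod_nonneg fun _ _ => h.nonneg _

lemma annW_le_of_count (h : IsMomentSeq Λ) (hc : ∀ z, l'.count z ≤ l.count z) :
    annW Λ l ≤ annW Λ l' := by
  rw [annW_eq_prod h (Finset.subset_union_left (s₂ := l'.toFinset)),
    annW_eq_prod h (Finset.subset_union_right (s₁ := l.toFinset))]
  exact Finset.prod_le_prod (fun _ _ => h.nonneg _) fun z _ => h.antitone (hc z)

lemma annW_le_of_sublist (h : IsMomentSeq Λ) (hl : l'.Sublist l) : annW Λ l ≤ annW Λ l' :=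
  annW_le_of_count h fun z => hl.count_le z

lemma annW_le_one (h : IsMomentSeq Λ) (l : List (Fin d → ℤ)) : annW Λ l ≤ 1 :=
  annW_nil (d := d) (Λ := Λ) ▸ annW_le_of_sublist h (List.nil_sublist l)

/-- The source of all positive association below: only sites common to both paths make a difference,
and there visit numbers add. -/
lemma annW_mul_le_append (h : IsMomentSeq Λ) : annW Λ l * annW Λ l' ≤ annW Λ (l ++ l') := by
  rw [annW_eq_prod h (Finset.subset_union_left (s₂ := l'.toFinset)),
    annW_eq_prod h (Finset.subset_union_right (s₁ := l.toFinset)), ← Finset.prod_mul_distrib,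
    annW, List.toFinset_append]
  refine Finset.prod_le_prod (fun _ _ => mul_nonneg (h.nonneg _) (h.nonneg _)) fun z _ => ?_
  rw [List.count_append]
  exact h.mul_le _ _

lemma annW_append_of_disjoint (hl : l.Disjoint l') :
    annW Λ (l ++ l') = annW Λ l * annW Λ l' := by
  unfold annW
  rw [List.toFinset_append, Finset.prod_union (by simpa using hl)]
  congr 1
  · refine Finset.prod_congr rfl fun z hz => ?_
    rw [List.count_append, List.count_eq_zero_of_not_mem (l := l'), add_zero]
    exact fun h => hl (by simpa using hz) h
  · refine Finset.prod_congr rfl fun z hz => ?_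
    rw [List.count_append, List.count_eq_zero_of_not_mem (l := l), zero_add]
    exact fun h => hl h (by simpa using hz)

lemma annW_le_pow_card (h : IsMomentSeq Λ) (l : List (Fin d → ℤ)) :
    annW Λ l ≤ Λ 1 ^ l.toFinset.card := by
  unfold annW
  rw [← Finset.prod_const]
  refine Finset.prod_le_prod (fun _ _ => h.nonneg _) fun z hz => h.antitone ?_
  exact List.count_pos_iff.2 (by simpa using hz)

end AnnW

/-! ### Independent random site weights -/

section RandomWeights

variable {d : ℕ} {Ω : Type*} [MeasurableSpace Ω]

/-- Independent, identically distributed site weights in `(0, 1]` which are not almost surely `1`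
and have an integrable logarithm. -/
structure RandomWeights (μ : Measure Ω) (X : (Fin d → ℤ) → Ω → ℝ) : Prop where
  measurable : ∀ x, Measurable (X x)
  isWeight : ∀ ω, IsWeight fun x => X x ω
  indep : iIndepFun X μ
  ident : ∀ x, IdentDistrib (X x) (X 0) μ μ
  mean_lt_one : ∫ ω, X 0 ω ∂μ < 1
  integrable_log : Integrable (fun ω => Real.log (X 0 ω)) μ

/-- The moments of the site weights. -/
noncomputable def siteMoment (μ : Measure Ω) (X : (Fin d → ℤ) → Ω → ℝ) (k : ℕ) : ℝ :=
  ∫ ω, X 0 ω ^ k ∂μ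

lemma integrable_of_mem_unit {μ : Measure Ω} [IsFiniteMeasure μ] {f : Ω → ℝ}
    (hf : AEStronglyMeasurable f μ) (h0 : ∀ ω, 0 ≤ f ω) (h1 : ∀ ω, f ω ≤ 1) : Integrable f μ :=
  Integrable.of_bound hf 1 (ae_of_all _ fun ω => by
    rw [Real.norm_of_nonneg (h0 ω)]; exact h1 ω)

namespace RandomWeights

variable {μ : Measure Ω} [IsProbabilityMeasure μ] {X : (Fin d → ℤ) → Ω → ℝ}

section
variable (h : RandomWeights μ X)
include h

lemma integrable_pow (x : Fin d → ℤ) (k : ℕ) : Integrable (fun ω => X x ω ^ k) μ :=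
  integrable_of_mem_unit ((h.measurable x).pow_const k).aestronglyMeasurable
    (fun ω => pow_nonneg (h.isWeight ω x).1.le k)
    fun ω => pow_le_one₀ (h.isWeight ω x).1.le (h.isWeight ω x).2

lemma isMomentSeq : IsMomentSeq (siteMoment μ X) where
  zero := by simp [siteMoment]
  nonneg k := integral_nonneg fun ω => pow_nonneg (h.isWeight ω 0).1.le k
  antitone j k hjk := integral_mono (h.integrable_pow 0 k) (h.integrable_pow 0 j) fun ω =>
    pow_le_pow_of_le_one (h.isWeight ω 0).1.le (h.isWeight ω 0).2 hjk
  mul_le j k := by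
    rcases Nat.eq_zero_or_pos j with rfl | hj
    · simp [siteMoment]
    have ht : 0 ≤ siteMoment μ X j := integral_nonneg fun ω => pow_nonneg (h.isWeight ω 0).1.le j
    -- With `s ^ j = 𝔼[X ^ j]`, integrating `(X ^ j - s ^ j) * (X ^ k - s ^ k) ≥ 0` makes the two
    -- terms with `s ^ k` cancel and leaves the claim. The sign holds because both factors change
    -- sign at `s`.
    obtain ⟨s, hs0, hs⟩ : ∃ s : ℝ, 0 ≤ s ∧ s ^ j = siteMoment μ X j :=
      ⟨siteMoment μ X j ^ (j⁻¹ : ℝ), by positivity, Real.rpow_inv_natCast_pow ht hj.ne'⟩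
    have key : ∀ ω, s ^ j * X 0 ω ^ k + s ^ k * X 0 ω ^ j - s ^ j * s ^ k ≤ X 0 ω ^ (j + k) := by
      intro ω
      have hX := (h.isWeight ω 0).1.le
      have : 0 ≤ (X 0 ω ^ j - s ^ j) * (X 0 ω ^ k - s ^ k) := by
        rcases le_total s (X 0 ω) with hle | hle
        · exact mul_nonneg (sub_nonneg.2 (pow_le_pow_left₀ hs0 hle j))
            (sub_nonneg.2 (pow_le_pow_left₀ hs0 hle k))
        · exact mul_nonneg_of_nonpos_of_nonpos (sub_nonpos.2 (pow_le_pow_left₀ hX hle j))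
            (sub_nonpos.2 (pow_le_pow_left₀ hX hle k))
      rw [pow_add]
      nlinarith
    have hi1 := (h.integrable_pow 0 k).const_mul (s ^ j)
    have hi2 := (h.integrable_pow 0 j).const_mul (s ^ k)
    have hi3 : Integrable (fun ω => s ^ j * X 0 ω ^ k + s ^ k * X 0 ω ^ j) μ := hi1.add hi2
    have := integral_mono (hi3.sub (integrable_const (s ^ j * s ^ k)))
      (h.integrable_pow 0 (j + k)) key
    simp only [Pi.sub_apply] at this
    rw [integral_sub hi3 (integrable_const _), integral_add hi1 hi2] at this
    simp only [integral_const_mul, integral_const, probReal_univ, one_smul] at this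
    change s ^ j * siteMoment μ X k + s ^ k * siteMoment μ X j - s ^ j * s ^ k ≤
      siteMoment μ X (j + k) at this
    rw [← hs] at this ⊢
    linarith

lemma siteMoment_one_lt : siteMoment μ X 1 < 1 := by
  simpa [siteMoment] using h.mean_lt_one

lemma measurable_prod (l : List (Fin d → ℤ)) :
    Measurable fun ω => (l.map fun x => X x ω).prod := by
  induction l with
  | nil => simp
  | cons a l ih =>
    simp only [List.map_cons, List.prod_cons]
    exact (h.measurable a).mul ih

lemma prod_mem_unit (l : List (Fin d → ℤ)) (ω : Ω) :
    0 ≤ (l.map fun x => X x ω).prod ∧ (l.map fun x => X x ω).prod ≤ 1 := by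
  induction l with
  | nil => simp
  | cons a l ih =>
    simp only [List.map_cons, List.prod_cons]
    exact ⟨mul_nonneg (h.isWeight ω a).1.le ih.1, mul_le_one₀ (h.isWeight ω a).2 ih.1 ih.2⟩

lemma integrable_prod (l : List (Fin d → ℤ)) :
    Integrable (fun ω => (l.map fun x => X x ω).prod) μ :=
  integrable_of_mem_unit (h.measurable_prod l).aestronglyMeasurable
    (fun ω => (h.prod_mem_unit l ω).1) fun ω => (h.prod_mem_unit l ω).2

lemma integral_prod (l : List (Fin d → ℤ)) :
    ∫ ω, (l.map fun x => X x ω).prod ∂μ = annW (siteMoment μ X) l := by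
  simp only [Finset.prod_list_map_count]
  have hind : iIndepFun (fun (z : l.toFinset) ω => X z ω ^ l.count (z : Fin d → ℤ)) μ :=
    (h.indep.precomp (g := ((↑) : l.toFinset → Fin d → ℤ)) Subtype.val_injective).comp
      (fun z t => t ^ l.count (z : Fin d → ℤ)) fun z => by fun_prop
  have := hind.integral_fun_prod_eq_prod_integral fun z =>
    ((h.measurable z).pow_const _).aestronglyMeasurable
  simp only [← Finset.prod_coe_sort l.toFinset, annW]
  rw [this]
  refine Finset.prod_congr rfl fun z _ => ?_
  exact ((h.ident z).comp (measurable_id.pow_const _)).integral_eq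

lemma measurable_hitW (y : Fin d → ℤ) (n : ℕ) (x : Fin d → ℤ) :
    Measurable fun ω => hitW (fun z => X z ω) y n x := by
  induction n generalizing x with
  | zero => simp [hitW_zero]
  | succ n ih =>
    by_cases hxy : x = y
    · subst hxy; simp
    · simp only [hitW_succ_of_ne hxy]
      exact (h.measurable x).mul (measurable_nbrAvg ih)

lemma measurable_hit (hd : 1 ≤ d) (x y : Fin d → ℤ) :
    Measurable fun ω => hit (fun z => X z ω) x y :=
  measurable_of_tendsto_metrizable (fun n => h.measurable_hitW y n x)
    (tendsto_pi_nhds.2 fun ω => tendsto_hitW hd (h.isWeight ω) x y)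

lemma integrable_hit (hd : 1 ≤ d) (x y : Fin d → ℤ) :
    Integrable (fun ω => hit (fun z => X z ω) x y) μ :=
  integrable_of_mem_unit (h.measurable_hit hd x y).aestronglyMeasurable
    (fun ω => hit_nonneg hd (h.isWeight ω)) fun ω => hit_le_one hd (h.isWeight ω)

lemma measurable_surv (n : ℕ) (x : Fin d → ℤ) : Measurable fun ω => surv (fun z => X z ω) n x := by
  induction n generalizing x with
  | zero => simp [surv_zero]
  | succ n ih => exact (h.measurable x).mul (measurable_nbrAvg ih)

lemma surv_le_one (hd : 1 ≤ d) (n : ℕ) (x : Fin d → ℤ) (ω : Ω) : surv (fun z => X z ω) n x ≤ 1 := by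
  induction n generalizing x with
  | zero => simp [surv_zero]
  | succ n ih =>
    exact mul_le_one₀ (h.isWeight ω x).2 (nbrAvg_nonneg fun z => surv_nonneg (h.isWeight ω) n)
      (nbrAvg_le_of_le hd fun z => ih z)

lemma measurable_greenTerm (y : Fin d → ℤ) (n : ℕ) (x : Fin d → ℤ) :
    Measurable fun ω => greenTerm (fun z => X z ω) y n x := by
  induction n generalizing x with
  | zero =>
    simp only [greenTerm]
    split_ifs
    · exact h.measurable x
    · exact measurable_const
  | succ n ih => exact (h.measurable x).mul (measurable_nbrAvg ih)

end

lemma integrable_walkAvg {F : Ω → List (Fin d → ℤ) → ℝ}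
    (hF : ∀ l, Integrable (fun ω => F ω l) μ) (n : ℕ) (x : Fin d → ℤ) :
    Integrable (fun ω => walkAvg n x (F ω)) μ := by
  induction n generalizing x F with
  | zero => exact hF _
  | succ n ih =>
    exact (integrable_finsetSum _ fun s _ => ih (F := fun ω l => F ω (x :: l)) (fun l => hF _)
      _).div_const _

lemma integral_walkAvg {F : Ω → List (Fin d → ℤ) → ℝ}
    (hF : ∀ l, Integrable (fun ω => F ω l) μ) (n : ℕ) (x : Fin d → ℤ) :
    ∫ ω, walkAvg n x (F ω) ∂μ = walkAvg n x fun l => ∫ ω, F ω l ∂μ := by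
  induction n generalizing x F with
  | zero => rfl
  | succ n ih =>
    simp only [walkAvg, nbrAvg]
    rw [integral_div, integral_finsetSum _ fun s _ =>
      integrable_walkAvg (F := fun ω l => F ω (x :: l)) (fun l => hF _) _ _]
    simp only [ih (F := fun ω l => F ω (x :: l)) (fun l => hF _)]

variable (h : RandomWeights μ X)
include h

lemma integral_surv_le (hd : 1 ≤ d) (n : ℕ) (x : Fin d → ℤ) :
    ∫ ω, surv (fun z => X z ω) (n + 1) x ∂μ ≤
      walkAvg n x fun l => siteMoment μ X 1 ^ l.toFinset.card := by
  simp only [surv_eq_walkAvg hd]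
  rw [integral_walkAvg fun l => h.integrable_prod l]
  simp only [h.integral_prod]
  exact walkAvg_mono fun l => annW_le_pow_card h.isMomentSeq l

lemma integrable_surv (hd : 1 ≤ d) (n : ℕ) (x : Fin d → ℤ) :
    Integrable (fun ω => surv (fun z => X z ω) n x) μ :=
  integrable_of_mem_unit (h.measurable_surv n x).aestronglyMeasurable
    (fun ω => surv_nonneg (h.isWeight ω) n) fun ω => h.surv_le_one hd n x ω

lemma summable_integral_surv (hd : 1 ≤ d) (x : Fin d → ℤ) :
    Summable fun n => ∫ ω, surv (fun z => X z ω) n x ∂μ := by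
  rw [← summable_nat_add_iff 1]
  exact Summable.of_nonneg_of_le
    (fun n => integral_nonneg fun ω => surv_nonneg (h.isWeight ω) _)
    (fun n => h.integral_surv_le hd n x)
    (summable_walkAvg_pow_card hd (h.isMomentSeq.nonneg 1) h.siteMoment_one_lt x)

/-- The total survival weight has finite mean by the range estimate. This almost sure property is
all that the well-posedness of the Green's function needs. -/
lemma ae_summableSurv (hd : 1 ≤ d) : ∀ᵐ ω ∂μ, SummableSurv fun z => X z ω := by
  refine ae_all_iff.2 fun x => ?_
  have h1 : ∫⁻ ω, ∑' n, ENNReal.ofReal (surv (fun z => X z ω) n x) ∂μ ≠ ∞ := by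
    rw [lintegral_tsum fun n => (h.measurable_surv n x).ennreal_ofReal.aemeasurable]
    have : ∀ n, ∫⁻ ω, ENNReal.ofReal (surv (fun z => X z ω) n x) ∂μ =
        ENNReal.ofReal (∫ ω, surv (fun z => X z ω) n x ∂μ) := fun n =>
      (ofReal_integral_eq_lintegral_ofReal (h.integrable_surv hd n x)
        (ae_of_all _ fun ω => surv_nonneg (h.isWeight ω) n)).symm
    simp only [this]
    exact (h.summable_integral_surv hd x).tsum_ofReal_ne_top
  have hm : Measurable fun ω => ∑' n, ENNReal.ofReal (surv (fun z => X z ω) n x) :=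
    Measurable.tsum fun n => (h.measurable_surv n x).ennreal_ofReal
  filter_upwards [ae_lt_top hm h1] with ω hω
  have := ENNReal.summable_toReal hω.ne
  refine this.congr fun n => ?_
  exact ENNReal.toReal_ofReal (surv_nonneg (h.isWeight ω) n)

lemma measurable_green (x y : Fin d → ℤ) :
    Measurable fun ω => green (fun z => X z ω) x y :=
  Measurable.tsum fun n => h.measurable_greenTerm y n x

lemma integral_hitW (hd : 1 ≤ d) (y : Fin d → ℤ) (n : ℕ) (x : Fin d → ℤ) :
    ∫ ω, hitW (fun z => X z ω) y n x ∂μ =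
      walkAvg n x fun l => if y ∈ l then annW (siteMoment μ X) (l.takeWhile (· ≠ y)) else 0 := by
  simp only [hitW_eq_walkAvg hd]
  rw [integral_walkAvg]
  · congr 1
    ext l
    split_ifs
    · exact h.integral_prod _
    · simp
  · intro l
    split_ifs
    · exact h.integrable_prod _
    · simp

lemma tendsto_integral_hitW (hd : 1 ≤ d) (x y : Fin d → ℤ) :
    Tendsto (fun n => ∫ ω, hitW (fun z => X z ω) y n x ∂μ) atTop
      (𝓝 (∫ ω, hit (fun z => X z ω) x y ∂μ)) := by
  refine tendsto_integral_of_dominated_convergence (fun _ => 1)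
    (fun n => (h.measurable_hitW y n x).aestronglyMeasurable) (integrable_const _)
    (fun n => ae_of_all _ fun ω => ?_) (ae_of_all _ fun ω => tendsto_hitW hd (h.isWeight ω) x y)
  rw [Real.norm_of_nonneg (hitW_nonneg (h.isWeight ω) n)]
  exact hitW_le_one hd (h.isWeight ω) n

/-- Positive association of hitting weights. -/
lemma integral_hit_mul_le (hd : 1 ≤ d) (x y x' y' : Fin d → ℤ) :
    (∫ ω, hit (fun z => X z ω) x y ∂μ) * ∫ ω, hit (fun z => X z ω) x' y' ∂μ ≤
      ∫ ω, hit (fun z => X z ω) x y * hit (fun z => X z ω) x' y' ∂μ := by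
  have hlim : Tendsto (fun n => ∫ ω, hitW (fun z => X z ω) y n x * hitW (fun z => X z ω) y' n x' ∂μ)
      atTop (𝓝 (∫ ω, hit (fun z => X z ω) x y * hit (fun z => X z ω) x' y' ∂μ)) := by
    refine tendsto_integral_of_dominated_convergence (fun _ => 1)
      (fun n => ((h.measurable_hitW y n x).mul (h.measurable_hitW y' n x')).aestronglyMeasurable)
      (integrable_const _) (fun n => ae_of_all _ fun ω => ?_) (ae_of_all _ fun ω =>
        (tendsto_hitW hd (h.isWeight ω) x y).mul (tendsto_hitW hd (h.isWeight ω) x' y'))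
    have h0 := hitW_nonneg (x := x) (y := y) (h.isWeight ω) n
    have h0' := hitW_nonneg (x := x') (y := y') (h.isWeight ω) n
    rw [Real.norm_of_nonneg (mul_nonneg h0 h0')]
    exact mul_le_one₀ (hitW_le_one hd (h.isWeight ω) n) h0' (hitW_le_one hd (h.isWeight ω) n)
  refine le_of_tendsto_of_tendsto' ((h.tendsto_integral_hitW hd x y).mul
    (h.tendsto_integral_hitW hd x' y')) hlim fun n => ?_
  have hinteg : ∀ l l' : List (Fin d → ℤ), Integrable (fun ω =>
      (if y ∈ l then ((l.takeWhile (· ≠ y)).map fun z => X z ω).prod else 0) *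
      (if y' ∈ l' then ((l'.takeWhile (· ≠ y')).map fun z => X z ω).prod else 0)) μ := by
    intro l l'
    split_ifs
    · simp only [← List.prod_append, ← List.map_append]
      exact h.integrable_prod _
    all_goals simp
  -- The product is an average over independent pairs of paths in one environment. For a fixed pair,
  -- the claim is the moment inequality for the concatenated path.
  have e1 : ∀ ω, hitW (fun z => X z ω) y n x * hitW (fun z => X z ω) y' n x' =
      walkAvg n x fun l => walkAvg n x' fun l' =>
      (if y ∈ l then ((l.takeWhile (· ≠ y)).map fun z => X z ω).prod else 0) *
      (if y' ∈ l' then ((l'.takeWhile (· ≠ y')).map fun z => X z ω).prod else 0) := by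
    intro ω
    simp only [hitW_eq_walkAvg hd, walkAvg_mul_left, walkAvg_mul_right]
  simp only [e1]
  rw [integral_walkAvg fun l => integrable_walkAvg (fun l' => hinteg l l') n x']
  simp only [integral_walkAvg (hinteg _)]
  rw [h.integral_hitW hd, h.integral_hitW hd, ← walkAvg_mul_right]
  refine walkAvg_mono fun l => ?_
  rw [← walkAvg_mul_left]
  refine walkAvg_mono fun l' => ?_
  split_ifs
  · simp only [← List.prod_append, ← List.map_append]
    rw [h.integral_prod]
    exact annW_mul_le_append h.isMomentSeq
  all_goals simp

end RandomWeights

end RandomWeights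

/-! ### Seminorms from subadditive functions on the lattice -/

section SeminormExtension

variable {d : ℕ}

/-- The coordinatewise integer part. -/
noncomputable def floorVec (x : EuclideanSpace ℝ (Fin d)) : Fin d → ℤ := fun i => ⌊x i⌋

lemma latticeVec_apply (x : Fin d → ℤ) (i : Fin d) : latticeVec x i = x i := rfl

lemma floorVec_smul_latticeVec (k : ℕ) (l : Fin d → ℤ) :
    floorVec ((k : ℝ) • latticeVec l) = k • l := by
  ext i
  simp only [floorVec, PiLp.smul_apply, latticeVec_apply, smul_eq_mul, Pi.smul_apply,
    nsmul_eq_mul]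
  rw [Int.floor_eq_iff]
  push_cast
  constructor <;> linarith

lemma norm_sub_latticeVec_floorVec_le (x : EuclideanSpace ℝ (Fin d)) :
    ‖x - latticeVec (floorVec x)‖ ≤ d := by
  rw [EuclideanSpace.norm_eq]
  have h1 : ∑ i, ‖(x - latticeVec (floorVec x)) i‖ ^ 2 ≤ (d : ℝ) := by
    calc ∑ i, ‖(x - latticeVec (floorVec x)) i‖ ^ 2 ≤ ∑ i : Fin d, (1 : ℝ) := by
          refine Finset.sum_le_sum fun i _ => ?_
          have h0 : (x - latticeVec (floorVec x)) i = Int.fract (x i) := rfl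
          rw [h0, Real.norm_of_nonneg (Int.fract_nonneg _)]
          exact pow_le_one₀ (Int.fract_nonneg _) (Int.fract_lt_one _).le
      _ = d := by simp
  rw [Real.sqrt_le_iff]
  refine ⟨by positivity, h1.trans ?_⟩
  rcases Nat.eq_zero_or_pos d with h | h
  · simp [h]
  · have : (1 : ℝ) ≤ d := by exact_mod_cast h
    nlinarith

lemma tendsto_inv_smul_latticeVec (x : EuclideanSpace ℝ (Fin d)) :
    Tendsto (fun k : ℕ => (k : ℝ)⁻¹ • latticeVec (floorVec ((k : ℝ) • x))) atTop (𝓝 x) := by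
  rw [tendsto_iff_norm_sub_tendsto_zero]
  have h0 : Tendsto (fun k : ℕ => (k : ℝ)⁻¹ * d) atTop (𝓝 0) := by
    simpa using (tendsto_inv_atTop_nhds_zero_nat (𝕜 := ℝ)).mul_const (d : ℝ)
  refine squeeze_zero' (Eventually.of_forall fun _ => norm_nonneg _) ?_ h0
  filter_upwards [eventually_gt_atTop 0] with k hk
  have hk' : (0 : ℝ) < k := by exact_mod_cast hk
  have : (k : ℝ)⁻¹ • latticeVec (floorVec ((k : ℝ) • x)) - x =
      -((k : ℝ)⁻¹ • ((k : ℝ) • x - latticeVec (floorVec ((k : ℝ) • x)))) := by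
    rw [smul_sub, smul_smul, inv_mul_cancel₀ hk'.ne', one_smul]
    abel
  rw [this, norm_neg, norm_smul, norm_inv, Real.norm_of_nonneg hk'.le]
  exact mul_le_mul_of_nonneg_left (norm_sub_latticeVec_floorVec_le _) (by positivity)

lemma continuous_seminorm (p : Seminorm ℝ (EuclideanSpace ℝ (Fin d))) : Continuous p := by
  rw [← continuousOn_univ]
  exact p.convexOn.continuousOn isOpen_univ

/-- A continuous, positively homogeneous function which is dominated by a seminorm on lattice
vectors is dominated by it everywhere. -/
lemma le_seminorm_of_lattice (p : Seminorm ℝ (EuclideanSpace ℝ (Fin d)))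
    {g : EuclideanSpace ℝ (Fin d) → ℝ} (hg : Continuous g)
    (hhom : ∀ c : ℝ, 0 ≤ c → ∀ x, g (c • x) = c * g x)
    (h : ∀ y : Fin d → ℤ, g (latticeVec y) ≤ p (latticeVec y)) (x : EuclideanSpace ℝ (Fin d)) :
    g x ≤ p x := by
  have ht := tendsto_inv_smul_latticeVec x
  refine le_of_tendsto_of_tendsto' ((hg.tendsto x).comp ht)
    (((continuous_seminorm p).tendsto x).comp ht) fun k => ?_
  simp only [Function.comp]
  rw [hhom _ (by positivity), map_smul_eq_mul, Real.norm_of_nonneg (by positivity)]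
  exact mul_le_mul_of_nonneg_left (h _) (by positivity)

lemma seminorm_le_of_lattice {p q : Seminorm ℝ (EuclideanSpace ℝ (Fin d))}
    (h : ∀ y : Fin d → ℤ, p (latticeVec y) ≤ q (latticeVec y)) (x : EuclideanSpace ℝ (Fin d)) :
    p x ≤ q x :=
  le_seminorm_of_lattice q (continuous_seminorm p)
    (fun c hc x => by rw [map_smul_eq_mul, Real.norm_of_nonneg hc]) h x

/-- Rescaled lattice points approximate every vector, and seminorms are homogeneous and continuous.
This is the uniqueness of both exponents. -/
lemma seminorm_ext_lattice {p q : Seminorm ℝ (EuclideanSpace ℝ (Fin d))}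
    (h : ∀ y : Fin d → ℤ, p (latticeVec y) = q (latticeVec y)) : p = q := by
  ext x
  exact le_antisymm (seminorm_le_of_lattice (fun y => (h y).le) x)
    (seminorm_le_of_lattice (fun y => (h y).ge) x)

variable {f : (Fin d → ℤ) → ℝ}

/-- Decomposition into unit steps. With subadditivity this makes `f` Lipschitz, so that rounding to
the lattice costs only a bounded amount. -/
lemma subadditive_bound (h0 : f 0 = 0) (hnn : ∀ x, 0 ≤ f x) (hneg : ∀ x, f (-x) = f x)
    (hadd : ∀ x y, f (x + y) ≤ f x + f y) :
    ∃ C, 0 ≤ C ∧ ∀ (z : Fin d → ℤ) (D : ℝ), (∀ i, |(z i : ℝ)| ≤ D) → f z ≤ C * D := by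
  refine ⟨∑ i, f (Pi.single i 1), Finset.sum_nonneg fun i _ => hnn _, fun z D hD => ?_⟩
  have h1 : ∀ (k : ℕ) (x : Fin d → ℤ), f (k • x) ≤ k * f x := by
    intro k x
    induction k with
    | zero => simp [h0]
    | succ k ih =>
      rw [succ_nsmul]
      push_cast
      linarith [hadd (k • x) x]
  have h2 : ∀ i, f (Pi.single i (z i)) ≤ D * f (Pi.single i 1) := by
    intro i
    have h3 : f (Pi.single i (z i)) ≤ |(z i : ℝ)| * f (Pi.single i 1) := by
      obtain ⟨n, hn | hn⟩ := Int.eq_nat_or_neg (z i)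
      · have : (Pi.single i (z i) : Fin d → ℤ) = n • Pi.single i 1 := by
          rw [hn, ← Pi.single_smul]; simp
        rw [this, hn]
        simpa using h1 n (Pi.single i 1)
      · have : (Pi.single i (z i) : Fin d → ℤ) = -(n • Pi.single i 1) := by
          rw [hn, ← Pi.single_smul, ← Pi.single_neg]; simp
        rw [this, hn, hneg]
        simpa using h1 n (Pi.single i 1)
    exact h3.trans (mul_le_mul_of_nonneg_right (hD i) (hnn _))
  have h4 : ∀ s : Finset (Fin d), f (∑ i ∈ s, Pi.single i (z i)) ≤
      ∑ i ∈ s, f (Pi.single i (z i)) := fun s =>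
    Finset.le_sum_of_subadditive f h0.le hadd s _
  have h5 := h4 Finset.univ
  rw [Finset.univ_sum_single] at h5
  calc f z ≤ ∑ i, f (Pi.single i (z i)) := h5
    _ ≤ ∑ i, D * f (Pi.single i 1) := Finset.sum_le_sum fun i _ => h2 i
    _ = _ := by rw [← Finset.mul_sum, mul_comm]

/-- An even, nonnegative, subadditive function on the lattice is asymptotic to a seminorm. -/
theorem exists_seminorm_of_subadditive (h0 : f 0 = 0) (hnn : ∀ x, 0 ≤ f x)
    (hneg : ∀ x, f (-x) = f x) (hadd : ∀ x y, f (x + y) ≤ f x + f y) :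
    ∃ p : Seminorm ℝ (EuclideanSpace ℝ (Fin d)),
      (∀ l : Fin d → ℤ, Tendsto (fun k : ℕ => f (k • l) / k) atTop (𝓝 (p (latticeVec l)))) ∧
      ∀ l : Fin d → ℤ, p (latticeVec l) ≤ f l := by
  obtain ⟨C, hC0, hC⟩ := subadditive_bound h0 hnn hneg hadd
  have hlip : ∀ (x y : Fin d → ℤ) (D : ℝ), (∀ i, |((x i - y i : ℤ) : ℝ)| ≤ D) →
      f x ≤ f y + C * D := by
    intro x y D hD
    have h1 := hadd y (x - y)
    rw [add_sub_cancel] at h1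
    exact h1.trans (add_le_add_right (hC (x - y) D hD) _)
  have hquasi : ∀ x y : EuclideanSpace ℝ (Fin d),
      f (floorVec (x + y)) ≤ f (floorVec x) + f (floorVec y) + C * 1 := by
    intro x y
    refine (hlip _ (floorVec x + floorVec y) 1 fun i => ?_).trans
      (add_le_add_left (hadd _ _) _)
    have h1 := Int.le_floor_add (x i) (y i)
    have h2 := Int.le_floor_add_floor (x i) (y i)
    have : |⌊x i + y i⌋ - (⌊x i⌋ + ⌊y i⌋)| ≤ 1 := by rw [abs_le]; omega
    simp only [floorVec, Pi.add_apply, PiLp.add_apply]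
    exact_mod_cast this
  have hlim : ∀ x : EuclideanSpace ℝ (Fin d), ∃ a : ℝ,
      Tendsto (fun k : ℕ => f (floorVec ((k : ℝ) • x)) / k) atTop (𝓝 a) := by
    intro x
    -- Rounding breaks subadditivity by at most a constant. Adding that constant to every term
    -- restores it, so Fekete's lemma applies, and the constant vanishes on division by `k`.
    have hsub : Subadditive fun k : ℕ => f (floorVec ((k : ℝ) • x)) + C * 1 := by
      intro j k
      have := hquasi ((j : ℝ) • x) ((k : ℝ) • x)
      rw [← add_smul] at this
      push_cast
      linarith
    have hb : BddBelow (Set.range fun k : ℕ => (f (floorVec ((k : ℝ) • x)) + C * 1) / k) :=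
      ⟨0, by rintro _ ⟨k, rfl⟩; have := hnn (floorVec ((k : ℝ) • x)); positivity⟩
    refine ⟨hsub.lim, ?_⟩
    have h1 := (hsub.tendsto_lim hb).sub (tendsto_const_div_atTop_nhds_zero_nat (C * 1))
    rw [sub_zero] at h1
    refine h1.congr fun k => ?_
    rw [← sub_div]
    ring
  choose p hp using hlim
  have hp_add : ∀ x y, p (x + y) ≤ p x + p y := by
    intro x y
    have h1 := ((hp x).add (hp y)).add (tendsto_const_div_atTop_nhds_zero_nat (C * 1))
    rw [add_zero] at h1
    refine le_of_tendsto_of_tendsto' (hp (x + y)) h1 fun k => ?_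
    rw [← add_div, ← add_div, smul_add]
    gcongr
    exact hquasi _ _
  have hclose : ∀ (u w : ℕ → Fin d → ℤ) (D a b : ℝ),
      (∀ k i, |((u k i - w k i : ℤ) : ℝ)| ≤ D) →
      Tendsto (fun k : ℕ => f (u k) / k) atTop (𝓝 a) →
      Tendsto (fun k : ℕ => f (w k) / k) atTop (𝓝 b) → a = b := by
    have : ∀ (u w : ℕ → Fin d → ℤ) (D a b : ℝ),
      (∀ k i, |((u k i - w k i : ℤ) : ℝ)| ≤ D) →
      Tendsto (fun k : ℕ => f (u k) / k) atTop (𝓝 a) →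
      Tendsto (fun k : ℕ => f (w k) / k) atTop (𝓝 b) → a ≤ b := by
      intro u w D a b hD ha hb
      have h1 := hb.add (tendsto_const_div_atTop_nhds_zero_nat (C * D))
      rw [add_zero] at h1
      refine le_of_tendsto_of_tendsto' ha h1 fun k => ?_
      rw [← add_div]
      gcongr
      exact hlip _ _ D (hD k)
    intro u w D a b hD ha hb
    refine le_antisymm (this u w D a b hD ha hb) (this w u D b a (fun k i => ?_) hb ha)
    have := hD k i
    rw [← abs_neg] at this
    simpa using this
  have hp_neg : ∀ x, p (-x) = p x := by
    intro x
    refine hclose (fun k => floorVec ((k : ℝ) • -x)) (fun k => -floorVec ((k : ℝ) • x)) 1 _ _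
      (fun k i => ?_) (hp (-x)) (by simpa only [hneg] using hp x)
    simp only [floorVec, Pi.neg_apply, PiLp.smul_apply, PiLp.neg_apply, smul_eq_mul, mul_neg]
    have h1 := Int.floor_neg (a := (k : ℝ) * x i)
    have h2 := Int.ceil_le_floor_add_one ((k : ℝ) * x i)
    have h3 := Int.floor_le_ceil ((k : ℝ) * x i)
    have : |⌊-((k : ℝ) * x i)⌋ - -⌊(k : ℝ) * x i⌋| ≤ 1 := by rw [abs_le]; omega
    exact_mod_cast this
  have hp_pos : ∀ (t : ℝ), 0 < t → ∀ x, p (t • x) = t * p x := by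
    intro t ht x
    -- Real scaling is read off along the indices `⌊k t⌋`, where the rate of `x` is multiplied by
    -- `t`. The points obtained stay within bounded distance of those that define `p (t • x)`.
    have hm : Tendsto (fun k : ℕ => ⌊(k : ℝ) * t⌋₊) atTop atTop :=
      tendsto_nat_floor_atTop.comp (tendsto_natCast_atTop_atTop.atTop_mul_const ht)
    have hr : Tendsto (fun k : ℕ => ((⌊(k : ℝ) * t⌋₊ : ℕ) : ℝ) / k) atTop (𝓝 t) := by
      have := (tendsto_nat_floor_mul_div_atTop (R := ℝ) ht.le).comp
        (tendsto_natCast_atTop_atTop (R := ℝ))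
      refine this.congr fun k => ?_
      simp [mul_comm]
    have h1 := hr.mul ((hp x).comp hm)
    have h2 : Tendsto (fun k : ℕ => f (floorVec (((⌊(k : ℝ) * t⌋₊ : ℕ) : ℝ) • x)) / k) atTop
        (𝓝 (t * p x)) := by
      refine h1.congr' ?_
      filter_upwards [hm.eventually_gt_atTop 0] with k hk
      have hk' : ((⌊(k : ℝ) * t⌋₊ : ℕ) : ℝ) ≠ 0 := by exact_mod_cast hk.ne'
      simp only [Function.comp]
      field_simp
    refine hclose _ _ (‖x‖ + 1) _ _ (fun k i => ?_) (hp (t • x)) h2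
    simp only [floorVec, PiLp.smul_apply, smul_eq_mul]
    have e1 := Int.floor_le ((k : ℝ) * (t * x i))
    have e2 := Int.lt_floor_add_one ((k : ℝ) * (t * x i))
    have e3 := Int.floor_le (((⌊(k : ℝ) * t⌋₊ : ℕ) : ℝ) * x i)
    have e4 := Int.lt_floor_add_one (((⌊(k : ℝ) * t⌋₊ : ℕ) : ℝ) * x i)
    have e5 : |((k : ℝ) * t - (⌊(k : ℝ) * t⌋₊ : ℕ)) * x i| ≤ 1 * ‖x‖ := by
      rw [abs_mul]
      refine mul_le_mul ?_ (PiLp.norm_apply_le x i) (abs_nonneg _) zero_le_one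
      have f1 := Nat.floor_le (by positivity : 0 ≤ (k : ℝ) * t)
      have f2 := Nat.lt_floor_add_one ((k : ℝ) * t)
      rw [abs_le]
      constructor <;> linarith
    rw [abs_le] at e5 ⊢
    push_cast
    constructor <;> nlinarith
  have hp_zero : p 0 = 0 := by
    refine tendsto_nhds_unique (hp 0) ?_
    have : floorVec (0 : EuclideanSpace ℝ (Fin d)) = 0 := by ext i; simp [floorVec]
    simp [this, h0]
  refine ⟨Seminorm.of p hp_add fun t x => ?_, fun l => ?_, fun l => ?_⟩
  · rcases lt_trichotomy t 0 with ht | rfl | ht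
    · have := hp_pos (-t) (by linarith) (-x)
      rw [hp_neg, smul_neg, neg_smul, neg_neg] at this
      rw [this, Real.norm_of_nonpos ht.le]
    · simp [hp_zero]
    · rw [hp_pos t ht, Real.norm_of_nonneg ht.le]
  · have := hp (latticeVec l)
    simp only [floorVec_smul_latticeVec] at this
    exact this
  · have h1 := hp (latticeVec l)
    simp only [floorVec_smul_latticeVec] at h1
    refine le_of_tendsto h1 ?_
    filter_upwards [eventually_gt_atTop 0] with k hk
    have hk' : (0 : ℝ) < k := by exact_mod_cast hk
    rw [div_le_iff₀ hk']
    clear hk hk' h1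
    induction k with
    | zero => simp [h0]
    | succ k ih =>
      rw [succ_nsmul]
      push_cast
      linarith [hadd (k • l) l]

end SeminormExtension

/-! ### Stationarity, logarithms of hitting weights, and integrability of Green's function -/

section Measurability

variable {d : ℕ}

lemma measurable_hitW_env (y : Fin d → ℤ) (n : ℕ) (x : Fin d → ℤ) :
    Measurable fun X : (Fin d → ℤ) → ℝ => hitW X y n x := by
  induction n generalizing x with
  | zero => simp [hitW_zero]
  | succ n ih =>
    by_cases hxy : x = y
    · subst hxy; simp
    · simp only [hitW_succ_of_ne hxy]
      exact (measurable_pi_apply x).mul (measurable_nbrAvg ih)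

lemma measurable_hit_env (x y : Fin d → ℤ) :
    Measurable fun X : (Fin d → ℤ) → ℝ => hit X x y :=
  Measurable.iSup fun n => measurable_hitW_env y n x

end Measurability

lemma integrable_log_of_le {Ω : Type*} [MeasurableSpace Ω] {μ : Measure Ω} {a b : Ω → ℝ}
    (ha : ∀ ω, 0 < a ω) (hab : ∀ ω, a ω ≤ b ω) (hb : ∀ ω, b ω ≤ 1) (hbm : Measurable b)
    (hi : Integrable (fun ω => Real.log (a ω)) μ) : Integrable (fun ω => Real.log (b ω)) μ := by
  refine hi.mono hbm.log.aestronglyMeasurable (ae_of_all _ fun ω => ?_)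
  have h1 := Real.log_le_log (ha ω) (hab ω)
  have h2 := Real.log_nonpos ((ha ω).le.trans (hab ω)) (hb ω)
  rw [Real.norm_of_nonpos h2, Real.norm_of_nonpos (h1.trans h2)]
  linarith

namespace RandomWeights

variable {d : ℕ} {Ω : Type*} [MeasurableSpace Ω] {μ : Measure Ω} [IsProbabilityMeasure μ]
  {X : (Fin d → ℤ) → Ω → ℝ} (h : RandomWeights μ X)
include h

/-- The law of an i.i.d. field is a product measure, hence unchanged by injective relabelling of the
sites. Translations give stationarity, and the reflection `x ↦ -x` makes the costs even. -/
lemma map_env_comp {σ : (Fin d → ℤ) → Fin d → ℤ} (hσ : Function.Injective σ) :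
    μ.map (fun ω x => X (σ x) ω) = Measure.infinitePi fun _ => μ.map (X 0) := by
  rw [(h.indep.precomp hσ).map_fun_eq_infinitePi_map fun i => h.measurable _]
  congr 1
  ext1 x
  exact (h.ident _).map_eq

lemma identDistrib_env {σ : (Fin d → ℤ) → Fin d → ℤ} (hσ : Function.Injective σ) :
    IdentDistrib (fun ω x => X (σ x) ω) (fun ω x => X x ω) μ μ where
  aemeasurable_fst := (measurable_pi_iff.2 fun x => h.measurable _).aemeasurable
  aemeasurable_snd := (measurable_pi_iff.2 fun x => h.measurable _).aemeasurable
  map_eq := by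
    rw [h.map_env_comp hσ]
    exact (h.map_env_comp Function.injective_id).symm

lemma identDistrib_hit_add (x y z : Fin d → ℤ) :
    IdentDistrib (fun ω => hit (fun u => X u ω) (x + z) (y + z))
      (fun ω => hit (fun u => X u ω) x y) μ μ := by
  have := (h.identDistrib_env (add_left_injective z)).comp (measurable_hit_env x y)
  simp only [Function.comp_def] at this
  convert! this using 2 with ω
  exact (hit_comp_add (X := fun u => X u ω) x y z).symm

lemma identDistrib_hit_neg (x y : Fin d → ℤ) :
    IdentDistrib (fun ω => hit (fun u => X u ω) (-x) (-y))
      (fun ω => hit (fun u => X u ω) x y) μ μ := by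
  have := (h.identDistrib_env neg_injective).comp (measurable_hit_env x y)
  simp only [Function.comp_def] at this
  convert! this using 2 with ω
  exact (hit_comp_neg (X := fun u => X u ω) x y).symm

lemma integrable_log_weight (x : Fin d → ℤ) : Integrable (fun ω => Real.log (X x ω)) μ :=
  (((h.ident x).comp Real.measurable_log).integrable_iff).2 h.integrable_log

/-- For every displacement `y` the hitting weight within a suitable number of steps is positive
with integrable logarithm. -/
lemma exists_integrable_log_hitW (hd : 1 ≤ d) (y : Fin d → ℤ) :
    ∃ N, ∀ x, (∀ ω, 0 < hitW (fun z => X z ω) (x + y) N x) ∧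
      Integrable (fun ω => Real.log (hitW (fun z => X z ω) (x + y) N x)) μ := by
  -- Concatenation of walks makes the good displacements a submonoid; it contains the unit steps in
  -- both directions, hence everything.
  let S : AddSubmonoid (Fin d → ℤ) :=
    { carrier := {y | ∃ N, ∀ x, (∀ ω, 0 < hitW (fun z => X z ω) (x + y) N x) ∧
        Integrable (fun ω => Real.log (hitW (fun z => X z ω) (x + y) N x)) μ}
      zero_mem' := ⟨0, fun x => by simp⟩
      add_mem' := by
        rintro y y' ⟨N, hN⟩ ⟨N', hN'⟩
        refine ⟨N + N', fun x => ?_⟩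
        have hle : ∀ ω, hitW (fun z => X z ω) (x + y) N x *
            hitW (fun z => X z ω) (x + y + y') N' (x + y) ≤
            hitW (fun z => X z ω) (x + (y + y')) (N + N') x := fun ω => by
          rw [← add_assoc]
          exact hitW_mul_le hd (h.isWeight ω) N N' x (x + y) (x + y + y')
        have hpos : ∀ ω, 0 < hitW (fun z => X z ω) (x + y) N x *
            hitW (fun z => X z ω) (x + y + y') N' (x + y) := fun ω =>
          mul_pos ((hN x).1 ω) ((hN' (x + y)).1 ω)
        refine ⟨fun ω => (hpos ω).trans_le (hle ω), integrable_log_of_le hpos hle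
          (fun ω => hitW_le_one hd (h.isWeight ω) _) (h.measurable_hitW _ _ _) ?_⟩
        refine ((hN x).2.add (hN' (x + y)).2).congr (ae_of_all _ fun ω => ?_)
        exact (Real.log_mul ((hN x).1 ω).ne' ((hN' (x + y)).1 ω).ne').symm }
  have hd0 : (0 : ℝ) < 2 * d := by
    have : (0 : ℝ) < d := by exact_mod_cast hd
    positivity
  have hstep : ∀ s : Fin d × Bool, stepVec s ∈ S := by
    intro s
    refine ⟨1, fun x => ?_⟩
    have hpos : ∀ ω, 0 < X x ω / (2 * d) := fun ω => div_pos (h.isWeight ω x).1 hd0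
    have hle := fun ω => hitW_one_step (h.isWeight ω) x s
    refine ⟨fun ω => (hpos ω).trans_le (hle ω), integrable_log_of_le hpos hle
      (fun ω => hitW_le_one hd (h.isWeight ω) _) (h.measurable_hitW _ _ _) ?_⟩
    refine ((h.integrable_log_weight x).sub (integrable_const (Real.log (2 * d)))).congr
      (ae_of_all _ fun ω => ?_)
    exact (Real.log_div (h.isWeight ω x).1.ne' hd0.ne').symm
  suffices y ∈ S from this
  rw [← Finset.univ_sum_single y]
  refine S.sum_mem fun i _ => ?_
  obtain ⟨n, hn | hn⟩ := Int.eq_nat_or_neg (y i)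
  · have : (Pi.single i (y i) : Fin d → ℤ) = n • stepVec (i, true) := by
      rw [hn, stepVec, if_pos rfl, ← Pi.single_smul]; simp
    rw [this]
    exact S.nsmul_mem (hstep _) n
  · have : (Pi.single i (y i) : Fin d → ℤ) = n • stepVec (i, false) := by
      rw [hn, stepVec, if_neg (by simp), smul_neg, ← Pi.single_smul, ← Pi.single_neg]; simp
    rw [this]
    exact S.nsmul_mem (hstep _) n

lemma hit_pos (hd : 1 ≤ d) (x y : Fin d → ℤ) (ω : Ω) : 0 < hit (fun z => X z ω) x y := by
  obtain ⟨N, hN⟩ := h.exists_integrable_log_hitW hd (y - x)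
  have := (hN x).1 ω
  rw [add_sub_cancel] at this
  exact this.trans_le (hitW_le_hit hd (h.isWeight ω) N)

lemma integrable_log_hit (hd : 1 ≤ d) (x y : Fin d → ℤ) :
    Integrable (fun ω => Real.log (hit (fun z => X z ω) x y)) μ := by
  obtain ⟨N, hN⟩ := h.exists_integrable_log_hitW hd (y - x)
  have := hN x
  rw [add_sub_cancel] at this
  exact integrable_log_of_le this.1 (fun ω => hitW_le_hit hd (h.isWeight ω) N)
    (fun ω => hit_le_one hd (h.isWeight ω)) (h.measurable_hit hd x y) this.2

lemma integral_hit_pos (hd : 1 ≤ d) (x y : Fin d → ℤ) :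
    0 < ∫ ω, hit (fun z => X z ω) x y ∂μ := by
  rw [integral_pos_iff_support_of_nonneg (fun ω => (h.hit_pos hd x y ω).le)
    (h.integrable_hit hd x y)]
  have : Function.support (fun ω => hit (fun z => X z ω) x y) = Set.univ :=
    Set.eq_univ_of_forall fun ω => (h.hit_pos hd x y ω).ne'
  simp [this]

lemma integral_hit_le_one (hd : 1 ≤ d) (x y : Fin d → ℤ) :
    ∫ ω, hit (fun z => X z ω) x y ∂μ ≤ 1 := by
  have := integral_mono (h.integrable_hit hd x y) (integrable_const (1 : ℝ))
    fun ω => hit_le_one hd (h.isWeight ω)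
  simpa using this

omit h in
/-- The mean of `-ln` of the hitting weight from `y` to `0`. -/
noncomputable def meanCost (μ : Measure Ω) (X : (Fin d → ℤ) → Ω → ℝ) (y : Fin d → ℤ) : ℝ :=
  -∫ ω, Real.log (hit (fun z => X z ω) y 0) ∂μ

omit h in
/-- `-ln` of the mean of the hitting weight from `y` to `0`. -/
noncomputable def costMean (μ : Measure Ω) (X : (Fin d → ℤ) → Ω → ℝ) (y : Fin d → ℤ) : ℝ :=
  -Real.log (∫ ω, hit (fun z => X z ω) y 0 ∂μ)

lemma meanCost_nonneg (hd : 1 ≤ d) (y : Fin d → ℤ) : 0 ≤ meanCost μ X y :=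
  neg_nonneg.2 (integral_nonpos fun ω =>
    Real.log_nonpos (hit_nonneg hd (h.isWeight ω)) (hit_le_one hd (h.isWeight ω)))

lemma costMean_nonneg (hd : 1 ≤ d) (y : Fin d → ℤ) : 0 ≤ costMean μ X y :=
  neg_nonneg.2 (Real.log_nonpos (h.integral_hit_pos hd y 0).le (h.integral_hit_le_one hd y 0))

omit h in
lemma meanCost_zero : meanCost μ X 0 = 0 := by simp [meanCost]

omit h in
lemma costMean_zero : costMean μ X 0 = 0 := by simp [costMean]

lemma meanCost_neg (y : Fin d → ℤ) : meanCost μ X (-y) = meanCost μ X y := by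
  have := ((h.identDistrib_hit_neg y 0).comp Real.measurable_log).integral_eq
  simpa [meanCost] using this

lemma costMean_neg (y : Fin d → ℤ) : costMean μ X (-y) = costMean μ X y := by
  have := (h.identDistrib_hit_neg y 0).integral_eq
  rw [neg_zero] at this
  rw [costMean, this, costMean]

lemma integral_log_hit_eq (x y : Fin d → ℤ) :
    ∫ ω, Real.log (hit (fun z => X z ω) x y) ∂μ = -meanCost μ X (x - y) := by
  have := ((h.identDistrib_hit_add (x - y) 0 y).comp Real.measurable_log).integral_eq
  simpa [meanCost] using this

lemma integral_hit_eq (x y : Fin d → ℤ) :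
    ∫ ω, hit (fun z => X z ω) x y ∂μ = ∫ ω, hit (fun z => X z ω) (x - y) 0 ∂μ := by
  have := (h.identDistrib_hit_add (x - y) 0 y).integral_eq
  simpa using this

lemma meanCost_add_le (hd : 1 ≤ d) (x y : Fin d → ℤ) :
    meanCost μ X (x + y) ≤ meanCost μ X x + meanCost μ X y := by
  have h1 : ∫ ω, (Real.log (hit (fun z => X z ω) (x + y) y) +
      Real.log (hit (fun z => X z ω) y 0)) ∂μ ≤
      ∫ ω, Real.log (hit (fun z => X z ω) (x + y) 0) ∂μ := by
    refine integral_mono ((h.integrable_log_hit hd _ _).add (h.integrable_log_hit hd _ _))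
      (h.integrable_log_hit hd _ _) fun ω => ?_
    simp only
    rw [← Real.log_mul (h.hit_pos hd _ _ ω).ne' (h.hit_pos hd _ _ ω).ne']
    exact Real.log_le_log (mul_pos (h.hit_pos hd _ _ ω) (h.hit_pos hd _ _ ω))
      (hit_mul_le hd (h.isWeight ω) _ _ _)
  rw [integral_add (h.integrable_log_hit hd _ _) (h.integrable_log_hit hd _ _),
    h.integral_log_hit_eq, add_sub_cancel_right] at h1
  simp only [meanCost] at h1 ⊢
  linarith

/-- Here the logarithm is outside the expectation, so concatenation alone does not suffice. Positive
association bounds the mean of the product from below by the product of the means. -/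
lemma costMean_add_le (hd : 1 ≤ d) (x y : Fin d → ℤ) :
    costMean μ X (x + y) ≤ costMean μ X x + costMean μ X y := by
  have h1 := h.integral_hit_mul_le hd (x + y) y y 0
  have hi : Integrable (fun ω => hit (fun z => X z ω) (x + y) y * hit (fun z => X z ω) y 0) μ :=
    integrable_of_mem_unit
      ((h.measurable_hit hd _ _).mul (h.measurable_hit hd _ _)).aestronglyMeasurable
      (fun ω => mul_nonneg (h.hit_pos hd _ _ ω).le (h.hit_pos hd _ _ ω).le)
      (fun ω => mul_le_one₀ (hit_le_one hd (h.isWeight ω)) (h.hit_pos hd _ _ ω).le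
        (hit_le_one hd (h.isWeight ω)))
  have h2 := h1.trans (integral_mono hi (h.integrable_hit hd (x + y) 0) fun ω =>
    hit_mul_le hd (h.isWeight ω) _ _ _)
  rw [h.integral_hit_eq (x + y) y, add_sub_cancel_right] at h2
  have p1 := h.integral_hit_pos hd x 0
  have p2 := h.integral_hit_pos hd y 0
  have h3 := Real.log_le_log (mul_pos p1 p2) h2
  rw [Real.log_mul p1.ne' p2.ne'] at h3
  simp only [costMean]
  linarith

/-- Jensen's inequality for the hitting weights. -/
lemma costMean_le_meanCost (hd : 1 ≤ d) (y : Fin d → ℤ) : costMean μ X y ≤ meanCost μ X y := by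
  set m := ∫ ω, hit (fun z => X z ω) y 0 ∂μ with hm
  have hmpos : 0 < m := h.integral_hit_pos hd y 0
  have hi := h.integrable_hit hd y 0
  have h1 : ∫ ω, Real.log (hit (fun z => X z ω) y 0) ∂μ ≤
      ∫ ω, (hit (fun z => X z ω) y 0 / m + (Real.log m - 1)) ∂μ := by
    refine integral_mono (h.integrable_log_hit hd y 0)
      ((hi.div_const m).add (integrable_const _)) fun ω => ?_
    have hp := h.hit_pos hd y 0 ω
    have := Real.log_le_sub_one_of_pos (div_pos hp hmpos)
    rw [Real.log_div hp.ne' hmpos.ne'] at this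
    simp only
    linarith
  rw [integral_add (hi.div_const m) (integrable_const _), integral_div, ← hm,
    div_self hmpos.ne'] at h1
  simp only [integral_const, probReal_univ, one_smul] at h1
  simp only [costMean, meanCost, ← hm]
  linarith

/-- The total survival weight from the origin is integrable, also against hitting weights. -/
lemma exists_integral_hit_mul_surv_le (hd : 1 ≤ d) {θ : ℝ} (hθ0 : 0 ≤ θ) (hθ1 : θ < 1) :
    ∃ C, 0 < C ∧ ∀ y, ∫ ω, hit (fun z => X z ω) y 0 * ∑' n, surv (fun z => X z ω) (n + 1) 0 ∂μ ≤
      C * (∫ ω, hit (fun z => X z ω) y 0 ∂μ) ^ θ := by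
  set q := siteMoment μ X 1 ^ (1 - θ) with hq
  have hm0 := h.isMomentSeq.nonneg 1
  have hq0 : 0 ≤ q := Real.rpow_nonneg hm0 _
  have hq1 : q < 1 := Real.rpow_lt_one hm0 h.siteMoment_one_lt (by linarith)
  have hsum := summable_walkAvg_pow_card hd hq0 hq1 (0 : Fin d → ℤ)
  refine ⟨(∑' n, walkAvg n (0 : Fin d → ℤ) fun l => q ^ l.toFinset.card) + 1, ?_, fun y => ?_⟩
  · have : 0 ≤ ∑' n, walkAvg n (0 : Fin d → ℤ) fun l => q ^ l.toFinset.card :=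
      tsum_nonneg fun n => walkAvg_nonneg fun l => by positivity
    linarith
  set m := ∫ ω, hit (fun z => X z ω) y 0 ∂μ with hm
  have hmpos : 0 < m := h.integral_hit_pos hd y 0
  have hil : ∀ l : List (Fin d → ℤ), Integrable (fun ω => hit (fun z => X z ω) y 0 *
      (l.map fun z => X z ω).prod) μ := fun l =>
    integrable_of_mem_unit ((h.measurable_hit hd y 0).mul (h.measurable_prod l)).aestronglyMeasurable
      (fun ω => mul_nonneg (h.hit_pos hd y 0 ω).le (h.prod_mem_unit l ω).1)
      (fun ω => mul_le_one₀ (hit_le_one hd (h.isWeight ω)) (h.prod_mem_unit l ω).1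
        (h.prod_mem_unit l ω).2)
  have hterm : ∀ n, ∫ ω, hit (fun z => X z ω) y 0 * surv (fun z => X z ω) (n + 1) 0 ∂μ ≤
      m ^ θ * walkAvg n (0 : Fin d → ℤ) fun l => q ^ l.toFinset.card := by
    intro n
    simp only [surv_eq_walkAvg hd, ← walkAvg_mul_left]
    rw [integral_walkAvg hil]
    refine walkAvg_mono fun l => ?_
    have a1 : ∫ ω, hit (fun z => X z ω) y 0 * (l.map fun z => X z ω).prod ∂μ ≤ m :=
      integral_mono (hil l) (h.integrable_hit hd y 0) fun ω =>
        mul_le_of_le_one_right (h.hit_pos hd y 0 ω).le (h.prod_mem_unit l ω).2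
    have a2 : ∫ ω, hit (fun z => X z ω) y 0 * (l.map fun z => X z ω).prod ∂μ ≤
        siteMoment μ X 1 ^ l.toFinset.card := by
      refine le_trans ?_ (annW_le_pow_card h.isMomentSeq l)
      rw [← h.integral_prod]
      exact integral_mono (hil l) (h.integrable_prod l) fun ω =>
        mul_le_of_le_one_left (h.prod_mem_unit l ω).1 (hit_le_one hd (h.isWeight ω))
    have a0 : 0 ≤ ∫ ω, hit (fun z => X z ω) y 0 * (l.map fun z => X z ω).prod ∂μ :=
      integral_nonneg fun ω => mul_nonneg (h.hit_pos hd y 0 ω).le (h.prod_mem_unit l ω).1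
    set I := ∫ ω, hit (fun z => X z ω) y 0 * (l.map fun z => X z ω).prod ∂μ
    -- Interpolation between two bounds: `I ≤ m` drops the path weight, and `I ≤ Λ 1 ^ card` drops
    -- the hitting weight. The first keeps the decay in `y` up to the power `θ < 1`, while the
    -- second still gives summability over the paths.
    calc I = I ^ θ * I ^ (1 - θ) := by
          rcases a0.eq_or_lt with h0 | h0
          · rw [← h0, Real.zero_rpow (by linarith : 1 - θ ≠ 0), mul_zero]
          · rw [← Real.rpow_add h0]; simp
      _ ≤ m ^ θ * (siteMoment μ X 1 ^ l.toFinset.card) ^ (1 - θ) :=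
          mul_le_mul (Real.rpow_le_rpow a0 a1 hθ0)
            (Real.rpow_le_rpow a0 a2 (by linarith)) (by positivity) (by positivity)
      _ = m ^ θ * q ^ l.toFinset.card := by
          rw [hq, ← Real.rpow_natCast, ← Real.rpow_natCast, ← Real.rpow_mul hm0,
            ← Real.rpow_mul hm0, mul_comm (1 - θ)]
  have hinteg : ∀ n, Integrable (fun ω => hit (fun z => X z ω) y 0 *
      surv (fun z => X z ω) (n + 1) 0) μ := fun n =>
    integrable_of_mem_unit
      ((h.measurable_hit hd y 0).mul (h.measurable_surv (n + 1) 0)).aestronglyMeasurable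
      (fun ω => mul_nonneg (h.hit_pos hd y 0 ω).le (surv_nonneg (h.isWeight ω) _))
      (fun ω => mul_le_one₀ (hit_le_one hd (h.isWeight ω)) (surv_nonneg (h.isWeight ω) _)
        (h.surv_le_one hd _ _ ω))
  have hnn : ∀ n, 0 ≤ ∫ ω, hit (fun z => X z ω) y 0 * surv (fun z => X z ω) (n + 1) 0 ∂μ :=
    fun n => integral_nonneg fun ω =>
      mul_nonneg (h.hit_pos hd y 0 ω).le (surv_nonneg (h.isWeight ω) _)
  have hsum' : Summable fun n => ∫ ω, hit (fun z => X z ω) y 0 *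
      surv (fun z => X z ω) (n + 1) 0 ∂μ :=
    Summable.of_nonneg_of_le hnn hterm (hsum.mul_left _)
  have hkey := integral_tsum_of_summable_integral_norm hinteg (by
    refine hsum'.congr fun n => integral_congr_ae (ae_of_all _ fun ω => ?_)
    exact (Real.norm_of_nonneg (mul_nonneg (h.hit_pos hd y 0 ω).le
      (surv_nonneg (h.isWeight ω) _))).symm)
  simp only [tsum_mul_left] at hkey
  rw [← hkey]
  calc ∑' n, ∫ ω, hit (fun z => X z ω) y 0 * surv (fun z => X z ω) (n + 1) 0 ∂μ
      ≤ ∑' n, m ^ θ * walkAvg n (0 : Fin d → ℤ) fun l => q ^ l.toFinset.card :=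
        hsum'.tsum_le_tsum hterm (hsum.mul_left _)
    _ ≤ _ := by
        rw [tsum_mul_left, mul_comm]
        refine mul_le_mul_of_nonneg_right (by linarith) (by positivity)

lemma integrable_tsum_surv (hd : 1 ≤ d) :
    Integrable (fun ω => ∑' n, surv (fun z => X z ω) (n + 1) 0) μ := by
  refine ⟨(Measurable.tsum fun n => h.measurable_surv (n + 1) 0).aestronglyMeasurable, ?_⟩
  have hs := (summable_nat_add_iff 1).2 (h.summable_integral_surv hd 0)
  rw [hasFiniteIntegral_iff_norm]
  have h1 : ∀ᵐ ω ∂μ, ENNReal.ofReal ‖∑' n, surv (fun z => X z ω) (n + 1) 0‖ =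
      ∑' n, ENNReal.ofReal (surv (fun z => X z ω) (n + 1) 0) := by
    filter_upwards [h.ae_summableSurv hd] with ω hω
    rw [Real.norm_of_nonneg (tsum_nonneg fun n => surv_nonneg (h.isWeight ω) _)]
    exact ENNReal.ofReal_tsum_of_nonneg (fun n => surv_nonneg (h.isWeight ω) _)
      ((summable_nat_add_iff 1).2 (hω 0))
  rw [lintegral_congr_ae h1,
    lintegral_tsum fun n => (h.measurable_surv (n + 1) 0).ennreal_ofReal.aemeasurable]
  have : ∀ n, ∫⁻ ω, ENNReal.ofReal (surv (fun z => X z ω) (n + 1) 0) ∂μ =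
      ENNReal.ofReal (∫ ω, surv (fun z => X z ω) (n + 1) 0 ∂μ) := fun n =>
    (ofReal_integral_eq_lintegral_ofReal (h.integrable_surv hd _ 0)
      (ae_of_all _ fun ω => surv_nonneg (h.isWeight ω) _)).symm
  simp only [this]
  exact hs.tsum_ofReal_lt_top

lemma green_self_le_tsum (hd : 1 ≤ d) {ω : Ω} (hω : SummableSurv fun z => X z ω) :
    green (fun z => X z ω) 0 0 ≤ ∑' n, surv (fun z => X z ω) (n + 1) 0 :=
  (summable_greenTerm hd (h.isWeight ω) hω).tsum_le_tsum
    (fun n => greenTerm_le_surv hd (h.isWeight ω) n) ((summable_nat_add_iff 1).2 (hω 0))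

lemma integrable_green (hd : 1 ≤ d) (y : Fin d → ℤ) :
    Integrable (fun ω => green (fun z => X z ω) y 0) μ := by
  refine (h.integrable_tsum_surv hd).mono (h.measurable_green y 0).aestronglyMeasurable ?_
  filter_upwards [h.ae_summableSurv hd] with ω hω
  rw [Real.norm_of_nonneg (green_nonneg (h.isWeight ω)),
    Real.norm_of_nonneg (tsum_nonneg fun n => surv_nonneg (h.isWeight ω) _)]
  exact (green_le_self hd (h.isWeight ω) hω).trans (h.green_self_le_tsum hd hω)

/-- `X 0 ≤ green 0 0` bounds the logarithm below by an integrable one, and `ln G ≤ G - 1` bounds it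
above. -/
lemma integrable_log_green_self (hd : 1 ≤ d) :
    Integrable (fun ω => Real.log (green (fun z => X z ω) 0 0)) μ := by
  refine ((h.integrable_green hd 0).add (h.integrable_log_weight 0).norm).mono'
    (h.measurable_green 0 0).log.aestronglyMeasurable ?_
  filter_upwards [h.ae_summableSurv hd] with ω hω
  have hX := (h.isWeight ω 0).1
  have h1 := weight_le_green_self (y := 0) hd (h.isWeight ω) hω
  have h2 := Real.log_le_log hX h1
  have h3 := Real.log_le_sub_one_of_pos (hX.trans_le h1)
  have h4 : 0 ≤ green (fun z => X z ω) 0 0 := green_nonneg (h.isWeight ω)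
  have h5 := neg_abs_le (Real.log (X 0 ω))
  have h6 := abs_nonneg (Real.log (X 0 ω))
  simp only [Pi.add_apply, Real.norm_eq_abs]
  rw [abs_le]
  constructor <;> linarith

lemma log_green_eq (hd : 1 ≤ d) {ω : Ω} (hω : SummableSurv fun z => X z ω) (y : Fin d → ℤ) :
    Real.log (green (fun z => X z ω) y 0) =
      Real.log (hit (fun z => X z ω) y 0) + Real.log (green (fun z => X z ω) 0 0) := by
  rw [green_eq_hit_mul hd (h.isWeight ω) hω, Real.log_mul (h.hit_pos hd y 0 ω).ne']
  exact ((h.isWeight ω 0).1.trans_le (weight_le_green_self hd (h.isWeight ω) hω)).ne'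

end RandomWeights

/-! ### The lower bound in the subadditive ergodic theorem -/

section Subadditive

variable {Ω : Type*} {T : Ω → Ω} {a : ℕ → Ω → ℝ}

/-- If every orbit point outside `B` starts a short block of average cost at most `K`, then so does
the whole orbit, up to the cost of the points in `B` and of the final block. -/
lemma subadditive_cover (h0 : ∀ n ω, 0 ≤ a n ω) (hzero : ∀ ω, a 0 ω = 0)
    (hsub : ∀ m n ω, a (m + n) ω ≤ a m ω + a n (T^[m] ω)) (B : Set Ω) (N : ℕ) {K : ℝ} (hK : 0 ≤ K)
    (m : ℕ) (ω : Ω) (hgood : ∀ i, T^[i] ω ∉ B → ∃ n, 1 ≤ n ∧ n ≤ N ∧ a n (T^[i] ω) ≤ n * K) :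
    a m ω ≤ m * K + ∑ i ∈ Finset.range m, B.indicator (a 1) (T^[i] ω) +
      ∑ i ∈ Finset.Ico (m - N) m, a 1 (T^[i] ω) := by
  have hind : ∀ ω, 0 ≤ B.indicator (a 1) ω := fun ω => Set.indicator_nonneg (fun ω _ => h0 1 ω) ω
  induction m using Nat.strong_induction_on generalizing ω with
  | _ m ih =>
    have hshift : ∀ n, 1 ≤ n → n ≤ m → a (m - n) (T^[n] ω) ≤ (m - n : ℝ) * K +
        ∑ i ∈ Finset.Ico n m, B.indicator (a 1) (T^[i] ω) +
        ∑ i ∈ Finset.Ico (m - N) m, a 1 (T^[i] ω) := by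
      intro n hn hnm
      have h1 := ih (m - n) (by omega) (T^[n] ω) fun i => by
        rw [← Function.iterate_add_apply]; exact hgood (i + n)
      simp only [← Function.iterate_add_apply] at h1
      have e1 : ∑ i ∈ Finset.range (m - n), B.indicator (a 1) (T^[i + n] ω) =
          ∑ i ∈ Finset.Ico n m, B.indicator (a 1) (T^[i] ω) := by
        rw [Finset.sum_Ico_eq_sum_range]
        simp only [add_comm]
      have e2 : ∑ i ∈ Finset.Ico (m - n - N) (m - n), a 1 (T^[i + n] ω) ≤
          ∑ i ∈ Finset.Ico (m - N) m, a 1 (T^[i] ω) := by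
        rw [Finset.sum_Ico_add' (fun i => a 1 (T^[i] ω)) (m - n - N) (m - n) n]
        exact Finset.sum_le_sum_of_subset_of_nonneg
          (Finset.Ico_subset_Ico (by omega) (by omega)) fun i _ _ => h0 _ _
      rw [e1, Nat.cast_sub hnm] at h1
      linarith
    have hsplit : ∀ n, n ≤ m → ∑ i ∈ Finset.range m, B.indicator (a 1) (T^[i] ω) =
        ∑ i ∈ Finset.range n, B.indicator (a 1) (T^[i] ω) +
        ∑ i ∈ Finset.Ico n m, B.indicator (a 1) (T^[i] ω) := fun n hn =>
      (Finset.sum_range_add_sum_Ico _ hn).symm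
    rcases Nat.eq_zero_or_pos m with rfl | hm
    · simp [hzero]
    by_cases hB : ω ∈ B
    · have h1 := hsub 1 (m - 1) ω
      rw [Nat.add_sub_cancel' hm] at h1
      have h2 := hshift 1 le_rfl hm
      rw [hsplit 1 hm]
      simp only [Finset.range_one, Finset.sum_singleton, Function.iterate_zero, id,
        Set.indicator_of_mem hB]
      push_cast at h2
      linarith
    · obtain ⟨n, hn1, hnN, hn⟩ := hgood 0 hB
      simp only [Function.iterate_zero, id] at hn
      rcases le_or_gt n m with hnm | hnm
      · have h1 := hsub n (m - n) ω
        rw [Nat.add_sub_cancel' hnm] at h1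
        have h2 := hshift n hn1 hnm
        have h3 : 0 ≤ ∑ i ∈ Finset.range n, B.indicator (a 1) (T^[i] ω) :=
          Finset.sum_nonneg fun i _ => hind _
        rw [hsplit n hnm]
        linarith
      -- The block would overrun the end. Then `m < n ≤ N`, so the final window is all of `[0, m)`
      -- and pays for single steps.
      · have h4 : ∀ k ω, a k ω ≤ ∑ i ∈ Finset.range k, a 1 (T^[i] ω) := by
          intro k
          induction k with
          | zero => intro ω; simp [hzero]
          | succ k ihk =>
            intro ω
            rw [Finset.sum_range_succ]
            linarith [hsub k 1 ω, ihk ω]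
        have h5 := h4 m ω
        rw [show m - N = 0 by omega, ← Finset.range_eq_Ico]
        have h6 : 0 ≤ ∑ i ∈ Finset.range m, B.indicator (a 1) (T^[i] ω) :=
          Finset.sum_nonneg fun i _ => hind _
        have h7 : 0 ≤ (m : ℝ) * K := by positivity
        linarith

variable [MeasurableSpace Ω] {μ : Measure Ω} [IsProbabilityMeasure μ]

/-- `T ⁻¹' D` is contained in `D` and has the same finite measure, so the two differ by a null set;
this passes to all iterates. -/
lemma ae_iterate_mem_iff (hT : MeasurePreserving T μ μ) {D : Set Ω} (hD : MeasurableSet D)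
    (hsub : T ⁻¹' D ⊆ D) : ∀ᵐ ω ∂μ, ∀ i, T^[i] ω ∈ D ↔ ω ∈ D := by
  have h1 : T ⁻¹' D =ᵐ[μ] D := ae_eq_of_subset_of_measure_ge hsub
    (hT.measure_preimage hD.nullMeasurableSet).ge
    (hT.measurable hD).nullMeasurableSet (measure_ne_top _ _)
  have h2 : ∀ᵐ ω ∂μ, T ω ∈ D ↔ ω ∈ D := by
    filter_upwards [h1] with ω hω
    exact iff_of_eq hω
  have h3 : ∀ᵐ ω ∂μ, ∀ i, (T (T^[i] ω) ∈ D ↔ T^[i] ω ∈ D) :=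
    ae_all_iff.2 fun i => (hT.iterate i).quasiMeasurePreserving.ae h2
  filter_upwards [h3] with ω hω i
  induction i with
  | zero => simp
  | succ i ih => rw [Function.iterate_succ_apply', hω i, ih]

/-- Integrate the covering bound with threshold `φ + ε`, which is legitimate because `φ` is constant
along orbits. The final window costs at most `N ∫ a 1`, negligible after division by `m`. The points
without a good block of length at most `N` cost `∫ a 1` over a set that shrinks away as `N → ∞`. -/
lemma integral_le_of_invariant_threshold (hT : MeasurePreserving T μ μ)
    (hm : ∀ n, Measurable (a n)) (h0 : ∀ n ω, 0 ≤ a n ω) (hzero : ∀ ω, a 0 ω = 0)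
    (hi : ∀ n, Integrable (a n) μ) (hsub : ∀ m n ω, a (m + n) ω ≤ a m ω + a n (T^[m] ω))
    {A : ℝ} (hA : Tendsto (fun n : ℕ => (∫ ω, a n ω ∂μ) / n) atTop (𝓝 A))
    {φ : Ω → ℝ} (hφm : Measurable φ) (hφ0 : ∀ ω, 0 ≤ φ ω) (hφi : Integrable φ μ)
    (hinv : ∀ᵐ ω ∂μ, ∀ i, φ (T^[i] ω) = φ ω) {ε : ℝ} (hε : 0 < ε)
    (hgood : ∀ᵐ ω ∂μ, ∃ n, 1 ≤ n ∧ a n ω ≤ n * (φ ω + ε)) : A ≤ ∫ ω, φ ω ∂μ + ε := by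
  let B : ℕ → Set Ω := fun N => {ω | ∀ n, 1 ≤ n → n ≤ N → n * (φ ω + ε) < a n ω}
  have hBm : ∀ N, MeasurableSet (B N) := by
    intro N
    have : B N = ⋂ n ∈ Set.Icc 1 N, {ω | (n : ℝ) * (φ ω + ε) < a n ω} := by
      ext ω; simp [B]
    rw [this]
    exact MeasurableSet.biInter (Set.to_countable _) fun n _ =>
      measurableSet_lt ((hφm.add_const ε).const_mul _) (hm n)
  have hBi : ∀ N, Integrable ((B N).indicator (a 1)) μ := fun N => (hi 1).indicator (hBm N)
  have hstep : ∀ N : ℕ, A ≤ ∫ ω, φ ω ∂μ + ε + ∫ ω, (B N).indicator (a 1) ω ∂μ := by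
    intro N
    have hm' : ∀ m : ℕ, ∫ ω, a m ω ∂μ ≤ m * (∫ ω, φ ω ∂μ + ε) +
        m * ∫ ω, (B N).indicator (a 1) ω ∂μ + N * ∫ ω, a 1 ω ∂μ := by
      intro m
      have hcov : ∀ᵐ ω ∂μ, a m ω ≤ m * (φ ω + ε) +
          ∑ i ∈ Finset.range m, (B N).indicator (a 1) (T^[i] ω) +
          ∑ i ∈ Finset.Ico (m - N) m, a 1 (T^[i] ω) := by
        filter_upwards [hinv] with ω hω
        refine subadditive_cover h0 hzero hsub (B N) N (by linarith [hφ0 ω]) m ω fun i hiB => ?_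
        simp only [B, Set.mem_ofPred_eq, not_forall, not_lt] at hiB
        obtain ⟨n, hn1, hnN, hn⟩ := hiB
        exact ⟨n, hn1, hnN, by rwa [hω i] at hn⟩
      have i1 : Integrable (fun ω => (m : ℝ) * (φ ω + ε)) μ :=
        (hφi.add (integrable_const ε)).const_mul _
      have i2 : ∀ i, Integrable (fun ω => (B N).indicator (a 1) (T^[i] ω)) μ := fun i =>
        (hT.iterate i).integrable_comp_of_integrable (hBi N)
      have i3 : ∀ i, Integrable (fun ω => a 1 (T^[i] ω)) μ := fun i =>
        (hT.iterate i).integrable_comp_of_integrable (hi 1)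
      have i4 := integrable_finsetSum (Finset.range m) fun i _ => i2 i
      have i5 := integrable_finsetSum (Finset.Ico (m - N) m) fun i _ => i3 i
      have i6 : Integrable (fun ω => (m : ℝ) * (φ ω + ε) +
          ∑ i ∈ Finset.range m, (B N).indicator (a 1) (T^[i] ω)) μ := i1.add i4
      have e := integral_mono_ae (hi m) (i6.add i5) hcov
      simp only [Pi.add_apply] at e
      rw [integral_add i6 i5, integral_add i1 i4, integral_const_mul,
        integral_add hφi (integrable_const ε), integral_finsetSum _ fun i _ => i2 i,
        integral_finsetSum _ fun i _ => i3 i] at e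
      have e2 : ∀ i, ∫ ω, (B N).indicator (a 1) (T^[i] ω) ∂μ =
          ∫ ω, (B N).indicator (a 1) ω ∂μ := fun i => by
        have := (hT.iterate i).map_eq
        conv_rhs => rw [← this]
        exact (integral_map (hT.iterate i).measurable.aemeasurable
          (by rw [this]; exact (hBi N).aestronglyMeasurable)).symm
      have e3 : ∀ i, ∫ ω, a 1 (T^[i] ω) ∂μ = ∫ ω, a 1 ω ∂μ := fun i => by
        have := (hT.iterate i).map_eq
        conv_rhs => rw [← this]
        exact (integral_map (hT.iterate i).measurable.aemeasurable
          (by rw [this]; exact (hi 1).aestronglyMeasurable)).symm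
      simp only [e2, e3, Finset.sum_const, Finset.card_range, Nat.card_Ico, nsmul_eq_mul,
        integral_const, probReal_univ, one_smul] at e
      refine e.trans ?_
      gcongr
      · exact integral_nonneg fun ω => h0 1 ω
      · omega
    have hlim : Tendsto (fun m : ℕ => ∫ ω, φ ω ∂μ + ε + ∫ ω, (B N).indicator (a 1) ω ∂μ +
        (N * ∫ ω, a 1 ω ∂μ) / m) atTop
        (𝓝 (∫ ω, φ ω ∂μ + ε + ∫ ω, (B N).indicator (a 1) ω ∂μ + 0)) :=
      tendsto_const_nhds.add (tendsto_const_div_atTop_nhds_zero_nat _)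
    rw [add_zero] at hlim
    refine le_of_tendsto_of_tendsto hA hlim ?_
    filter_upwards [eventually_gt_atTop 0] with m hmpos
    have : (0 : ℝ) < m := by exact_mod_cast hmpos
    rw [div_le_iff₀ this, add_mul, div_mul_cancel₀ _ this.ne']
    linarith [hm' m]
  have hB0 : Tendsto (fun N => ∫ ω, (B N).indicator (a 1) ω ∂μ) atTop (𝓝 (∫ _, (0 : ℝ) ∂μ)) := by
    refine tendsto_integral_of_dominated_convergence (a 1)
      (fun N => (hBi N).aestronglyMeasurable) (hi 1) (fun N => ae_of_all _ fun ω => ?_) ?_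
    · rw [Real.norm_of_nonneg (Set.indicator_nonneg (fun ω _ => h0 1 ω) ω)]
      exact Set.indicator_le_self' (fun _ _ => h0 1 ω) ω
    · filter_upwards [hgood] with ω ⟨n, hn1, hn⟩
      refine tendsto_const_nhds.congr' ?_
      filter_upwards [eventually_ge_atTop n] with N hN
      rw [Set.indicator_of_notMem]
      exact fun hω => absurd (hω n hn1 hN) (not_lt.2 hn)
  rw [integral_zero] at hB0
  have := ge_of_tendsto' (tendsto_const_nhds.add hB0) hstep
  simpa using this

/-- A nonnegative subadditive process that is asymptotically almost surely at most its mean growth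
rate converges to it almost surely. -/
theorem ae_tendsto_of_subadditive (hT : MeasurePreserving T μ μ)
    (hm : ∀ n, Measurable (a n)) (h0 : ∀ n ω, 0 ≤ a n ω) (hzero : ∀ ω, a 0 ω = 0)
    (hi : ∀ n, Integrable (a n) μ) (hsub : ∀ m n ω, a (m + n) ω ≤ a m ω + a n (T^[m] ω))
    {A : ℝ} (hA : Tendsto (fun n : ℕ => (∫ ω, a n ω ∂μ) / n) atTop (𝓝 A))
    (hup : ∀ᵐ ω ∂μ, ∀ ε : ℝ, 0 < ε → ∀ᶠ n : ℕ in atTop, a n ω ≤ n * (A + ε)) :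
    ∀ᵐ ω ∂μ, Tendsto (fun n : ℕ => a n ω / n) atTop (𝓝 A) := by
  have hA0 : 0 ≤ A := ge_of_tendsto' hA fun n =>
    div_nonneg (integral_nonneg fun ω => h0 n ω) (by positivity)
  -- `D c` is the event that the lower limit of `a n / n` is at most `c`. It contains its preimage
  -- because the single cost `a 1` disappears on division by `n`.
  let D : ℝ → Set Ω := fun c =>
    {ω | ∀ j N : ℕ, ∃ n, N ≤ n ∧ a n ω ≤ n * (c + 1 / ((j : ℝ) + 1))}
  have hDm : ∀ c, MeasurableSet (D c) := by
    intro c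
    have : D c = ⋂ (j : ℕ) (N : ℕ), ⋃ (n : ℕ) (_ : N ≤ n),
        {ω | a n ω ≤ n * (c + 1 / ((j : ℝ) + 1))} := by
      ext ω; simp [D]
    rw [this]
    exact MeasurableSet.iInter fun j => MeasurableSet.iInter fun N => MeasurableSet.iUnion fun n =>
      MeasurableSet.iUnion fun _ => measurableSet_le (hm n) measurable_const
  have hDsub : ∀ c, 0 ≤ c → T ⁻¹' D c ⊆ D c := by
    intro c hc ω hω j N
    have hj : (0 : ℝ) < (j : ℝ) + 1 := by positivity
    obtain ⟨n, hn, hna⟩ := hω (2 * j + 1) (max N ⌈a 1 ω * (2 * (j + 1))⌉₊)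
    refine ⟨1 + n, by omega, ?_⟩
    have h1 := hsub 1 n ω
    simp only [Function.iterate_one] at h1
    have h2 : a 1 ω * (2 * (j + 1)) ≤ n :=
      (Nat.le_ceil _).trans (by exact_mod_cast (le_max_right _ _).trans hn)
    have h3 : a 1 ω ≤ n * (1 / (2 * ((j : ℝ) + 1))) := by
      rw [mul_one_div, le_div_iff₀ (by positivity)]
      exact h2
    have h4 : (((2 * j + 1 : ℕ) : ℝ) + 1) = 2 * ((j : ℝ) + 1) := by push_cast; ring
    rw [h4] at hna
    have h5 : (1 : ℝ) / ((j : ℝ) + 1) = 1 / (2 * ((j : ℝ) + 1)) + 1 / (2 * ((j : ℝ) + 1)) := by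
      field_simp; norm_num
    have h6 : (0 : ℝ) < 1 / ((j : ℝ) + 1) := by positivity
    push_cast
    rw [add_mul, one_mul]
    rw [h5] at h6 ⊢
    linarith
  have hDnull : ∀ c, 0 ≤ c → c < A → μ (D c) = 0 := by
    intro c hc hcA
    classical
    -- Blocks of average cost near `c` exist on `D c`, and the upper bound provides blocks of cost
    -- near `A` elsewhere. If `D c` had positive measure, the mean of this invariant threshold would
    -- be below `A`. No ergodicity of `T` is needed.
    let φ : Ω → ℝ := fun ω => if ω ∈ D c then c else A
    have hφm : Measurable φ := Measurable.ite (hDm c) measurable_const measurable_const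
    have hφ : ∀ ω, φ ω = A - (D c).indicator (fun _ => A - c) ω := by
      intro ω
      by_cases h : ω ∈ D c <;> simp [φ, h]
    have hind : Integrable ((D c).indicator fun _ => A - c) μ :=
      (integrable_const (A - c)).indicator (hDm c)
    have hφi : Integrable φ μ := by
      rw [show φ = fun ω => A - (D c).indicator (fun _ => A - c) ω from funext hφ]
      exact (integrable_const A).sub hind
    have hφint : ∫ ω, φ ω ∂μ = A - μ.real (D c) * (A - c) := by
      simp only [hφ]
      rw [integral_sub (integrable_const A) hind, integral_indicator_const _ (hDm c)]
      simp
    have key : ∀ ε : ℝ, 0 < ε → A ≤ ∫ ω, φ ω ∂μ + ε := by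
      intro ε hε
      refine integral_le_of_invariant_threshold hT hm h0 hzero hi hsub hA hφm (fun ω => ?_) hφi
        ?_ hε ?_
      · simp only [φ]; split_ifs <;> assumption
      · filter_upwards [ae_iterate_mem_iff hT (hDm c) (hDsub c hc)] with ω hω i
        simp only [φ, hω i]
      · filter_upwards [hup] with ω hω
        by_cases h : ω ∈ D c
        · obtain ⟨j, hj⟩ := exists_nat_one_div_lt hε
          obtain ⟨n, hn1, hn⟩ := h j 1
          refine ⟨n, hn1, hn.trans ?_⟩
          simp only [φ, if_pos h]
          gcongr
        · obtain ⟨n, hn⟩ := ((hω ε hε).and (eventually_ge_atTop 1)).exists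
          refine ⟨n, hn.2, ?_⟩
          simpa only [φ, if_neg h] using hn.1
    have h1 : A ≤ ∫ ω, φ ω ∂μ := le_of_forall_pos_le_add key
    rw [hφint] at h1
    have h2 : μ.real (D c) = 0 := by
      have h3 : 0 ≤ μ.real (D c) := measureReal_nonneg
      nlinarith
    rwa [measureReal_eq_zero_iff] at h2
  have hlow : ∀ᵐ ω ∂μ, ∀ j : ℕ, 0 ≤ A - 1 / ((j : ℝ) + 1) → ω ∉ D (A - 1 / ((j : ℝ) + 1)) := by
    refine ae_all_iff.2 fun j => ?_
    by_cases hj : 0 ≤ A - 1 / ((j : ℝ) + 1)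
    · have := hDnull _ hj (by have : (0 : ℝ) < 1 / ((j : ℝ) + 1) := by positivity
                              linarith)
      filter_upwards [measure_eq_zero_iff_ae_notMem.1 this] with ω hω _
      exact hω
    · exact ae_of_all _ fun ω h => absurd h hj
  filter_upwards [hup, hlow] with ω h1 h2
  rw [Metric.tendsto_atTop']
  intro ε hε
  obtain ⟨j, hj⟩ := exists_nat_one_div_lt hε
  have hupper : ∀ᶠ n : ℕ in atTop, a n ω / n < A + ε := by
    filter_upwards [h1 (ε / 2) (by linarith), eventually_gt_atTop 0] with n hn hn0
    have : (0 : ℝ) < n := by exact_mod_cast hn0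
    rw [div_lt_iff₀ this]
    nlinarith
  have hlower : ∀ᶠ n : ℕ in atTop, A - ε < a n ω / n := by
    by_cases hc : 0 ≤ A - 1 / ((j : ℝ) + 1)
    · have := h2 j hc
      simp only [D, Set.mem_ofPred_eq, not_forall, not_exists, not_and, not_le] at this
      obtain ⟨j', N, hN⟩ := this
      filter_upwards [eventually_ge_atTop N, eventually_gt_atTop 0] with n hn hn0
      have hn' : (0 : ℝ) < n := by exact_mod_cast hn0
      rw [lt_div_iff₀ hn']
      have h3 := hN n hn
      have h4 : (0 : ℝ) < 1 / ((j' : ℝ) + 1) := by positivity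
      nlinarith
    · filter_upwards with n
      have : 0 ≤ a n ω / n := div_nonneg (h0 n ω) (by positivity)
      linarith
  obtain ⟨N, hN⟩ := eventually_atTop.1 (hupper.and hlower)
  refine ⟨N, fun n hn => ?_⟩
  rw [Real.dist_eq, abs_lt]
  have := hN n hn.le
  constructor <;> linarith [this.1, this.2]

end Subadditive

/-! ### The quenched limit of hitting weights -/

section FiniteRange

variable {d : ℕ}

/-- A walk of `n` steps sees only the box of radius `n` around its start. Passages with starting
points far apart are therefore independent. -/
lemma hitW_congr {X X' : (Fin d → ℤ) → ℝ} {y : Fin d → ℤ} {n : ℕ} {x : Fin d → ℤ}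
    (h : ∀ z, (∀ i, |z i - x i| ≤ n) → X z = X' z) : hitW X y n x = hitW X' y n x := by
  induction n generalizing x with
  | zero => simp [hitW_zero]
  | succ n ih =>
    by_cases hxy : x = y
    · subst hxy; simp
    · rw [hitW_succ_of_ne hxy, hitW_succ_of_ne hxy, h x (fun i => by simp; omega)]
      congr 1
      unfold nbrAvg
      congr 1
      refine Finset.sum_congr rfl fun s _ => ih fun z hz => h z fun i => ?_
      have h1 := hz i
      have h2 := abs_stepVec_apply_le s i
      rw [Pi.add_apply] at h1
      push_cast
      rw [abs_le] at h1 h2 ⊢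
      omega

end FiniteRange

namespace RandomWeights

variable {d : ℕ} {Ω : Type*} [MeasurableSpace Ω] {μ : Measure Ω} [IsProbabilityMeasure μ]
  {X : (Fin d → ℤ) → Ω → ℝ} (h : RandomWeights μ X)
include h

lemma indepFun_hitW {n : ℕ} {x x' : Fin d → ℤ} (y y' : Fin d → ℤ) {i : Fin d}
    (hx : 2 * (n : ℤ) < |x i - x' i|) :
    IndepFun (fun ω => hitW (fun z => X z ω) y n x) (fun ω => hitW (fun z => X z ω) y' n x') μ := by
  classical
  let S : (Fin d → ℤ) → Finset (Fin d → ℤ) := fun x => Finset.Icc (x - fun _ => (n : ℤ))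
    (x + fun _ => (n : ℤ))
  have hS : ∀ x z, z ∈ S x ↔ ∀ i, |z i - x i| ≤ n := by
    intro x z
    simp only [S, Finset.mem_Icc, Pi.le_def, Pi.sub_apply, Pi.add_apply, abs_le]
    constructor
    · rintro ⟨h1, h2⟩ i
      have := h1 i
      have := h2 i
      omega
    · intro hz
      constructor <;> intro i <;> have := hz i <;> omega
  have hdisj : Disjoint (S x) (S x') := by
    rw [Finset.disjoint_left]
    intro z hz hz'
    have h1 := (hS x z).1 hz i
    have h2 := (hS x' z).1 hz' i
    rw [abs_le] at h1 h2
    rw [lt_abs] at hx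
    omega
  let ext : ∀ x, (S x → ℝ) → (Fin d → ℤ) → ℝ := fun x v z => if hz : z ∈ S x then v ⟨z, hz⟩ else 0
  have hext : ∀ x, Measurable (ext x) := by
    intro x
    refine measurable_pi_iff.2 fun z => ?_
    by_cases hz : z ∈ S x
    · simp only [ext, dif_pos hz]; exact measurable_pi_apply _
    · simp only [ext, dif_neg hz]; exact measurable_const
  have hrep : ∀ x y ω, hitW (fun z => X z ω) y n x =
      hitW (ext x fun z : S x => X z ω) y n x := by
    intro x y ω
    refine hitW_congr fun z hz => ?_
    simp only [ext, dif_pos ((hS x z).2 hz)]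
  simp only [hrep x y, hrep x' y']
  exact (h.indep.indepFun_finset (S x) (S x') hdisj h.measurable).comp
    ((measurable_hitW_env y n x).comp (hext x)) ((measurable_hitW_env y' n x').comp (hext x'))

lemma identDistrib_hitW_add (n : ℕ) (x y z : Fin d → ℤ) :
    IdentDistrib (fun ω => hitW (fun u => X u ω) (y + z) n (x + z))
      (fun ω => hitW (fun u => X u ω) y n x) μ μ := by
  have := (h.identDistrib_env (add_left_injective z)).comp (measurable_hitW_env y n x)
  simp only [Function.comp_def] at this
  convert! this using 2 with ω
  exact (hitW_comp_add (X := fun u => X u ω) n x y z).symm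

/-- Upper bound for the quenched cost in terms of passages within finitely many steps. -/
lemma ae_cost_le_of_hitW (hd : 1 ≤ d) {l : Fin d → ℤ} (hl : l ≠ 0) {m N : ℕ} (hm : 0 < m)
    (hpos : ∀ ω x, 0 < hitW (fun z => X z ω) x N (x + m • l))
    (hinteg : Integrable (fun ω => Real.log (hitW (fun z => X z ω) 0 N (m • l))) μ) :
    ∀ᵐ ω ∂μ, ∀ ε : ℝ, 0 < ε → ∀ᶠ k : ℕ in atTop, -Real.log (hit (fun z => X z ω) (k • l) 0) ≤
      k * ((-∫ ω, Real.log (hitW (fun z => X z ω) 0 N (m • l)) ∂μ) / m + ε) := by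
  set c := -∫ ω, Real.log (hitW (fun z => X z ω) 0 N (m • l)) ∂μ with hc
  have hc0 : 0 ≤ c := neg_nonneg.2 (integral_nonpos fun ω => Real.log_nonpos
    (hitW_nonneg (h.isWeight ω) N) (hitW_le_one hd (h.isWeight ω) N))
  let Z : ℕ → Ω → ℝ := fun u ω => -Real.log (hitW (fun z => X z ω) (u • l) N (u • l + m • l))
  -- Passages whose indices differ by a multiple of `P` start more than `2 N` apart in a coordinate
  -- where `l` does not vanish. In each residue class modulo `P` they are pairwise independent with
  -- the same law, so the strong law applies to the `p` classes that make up a stretch of length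
  -- `P`.
  set p := 2 * N + 1 with hp
  set P := m * p with hP
  have hPpos : 0 < P := by positivity
  have hident : ∀ u u', IdentDistrib (Z u) (Z u') μ μ := by
    have : ∀ u, IdentDistrib (Z u) (fun ω => -Real.log (hitW (fun z => X z ω) 0 N (m • l))) μ μ := by
      intro u
      have := (h.identDistrib_hitW_add N (m • l) 0 (u • l)).comp Real.measurable_log.neg
      simpa [Z, Function.comp_def, add_comm] using this
    exact fun u u' => (this u).trans (this u').symm
  have hZint : ∀ u, Integrable (Z u) μ := by
    intro u
    refine (hident u 0).integrable_iff.2 ?_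
    simpa [Z] using hinteg.neg
  have hZmean : ∀ u, ∫ ω, Z u ω ∂μ = c := by
    intro u
    rw [(hident u 0).integral_eq]
    simp [Z, hc, integral_neg]
  obtain ⟨i, hi⟩ : ∃ i, l i ≠ 0 := by
    by_contra! hcon
    exact hl (funext hcon)
  have hslln : ∀ u0, ∀ᵐ ω ∂μ, Tendsto (fun Q : ℕ => (∑ j ∈ Finset.range Q, Z (u0 + j * P) ω) / Q)
      atTop (𝓝 c) := by
    intro u0
    have := strong_law_ae_real (fun j => Z (u0 + j * P)) (hZint _) ?_ fun j => hident _ _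
    · simpa only [hZmean] using this
    · intro j j' hjj'
      refine (h.indepFun_hitW _ _ (i := i) ?_).comp Real.measurable_log.neg Real.measurable_log.neg
      have e1 : ((u0 + j * P) • l + m • l) i - ((u0 + j' * P) • l + m • l) i =
          ((j : ℤ) - j') * (P * l i) := by
        simp only [Pi.add_apply, Pi.smul_apply]
        simp only [nsmul_eq_mul]
        push_cast
        ring
      rw [e1, abs_mul, abs_mul]
      have h1 : 1 ≤ |(j : ℤ) - j'| := Int.one_le_abs (sub_ne_zero.2 (by exact_mod_cast hjj'))
      have h2 : 1 ≤ |l i| := Int.one_le_abs hi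
      have h3 : 2 * (N : ℤ) + 1 ≤ |(P : ℤ)| := by
        rw [abs_of_nonneg (by positivity), hP, hp]
        push_cast
        have : (1 : ℤ) ≤ m := by exact_mod_cast hm
        nlinarith
      calc 2 * (N : ℤ) < |(P : ℤ)| := by omega
        _ ≤ |(j : ℤ) - j'| * (|(P : ℤ)| * |l i|) := by
          have h4 : |(P : ℤ)| ≤ |(P : ℤ)| * |l i| := le_mul_of_one_le_right (abs_nonneg _) h2
          exact h4.trans (le_mul_of_one_le_left (by positivity) h1)
  have hall : ∀ᵐ ω ∂μ, ∀ u0, Tendsto (fun Q : ℕ => (∑ j ∈ Finset.range Q, Z (u0 + j * P) ω) / Q)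
      atTop (𝓝 c) := ae_all_iff.2 hslln
  filter_upwards [hall] with ω hω ε hε
  let b : ℕ → ℝ := fun k => -Real.log (hit (fun z => X z ω) (k • l) 0)
  have hb1 : ∀ u, b (u + m) ≤ b u + Z u ω := by
    intro u
    have h1 : hitW (fun z => X z ω) (u • l) N (u • l + m • l) * hit (fun z => X z ω) (u • l) 0 ≤
        hit (fun z => X z ω) ((u + m) • l) 0 := by
      rw [add_smul]
      exact (mul_le_mul_of_nonneg_right (hitW_le_hit hd (h.isWeight ω) N)
        (h.hit_pos hd _ _ ω).le).trans (hit_mul_le hd (h.isWeight ω) _ _ _)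
    have h2 := Real.log_le_log (mul_pos (hpos ω _) (h.hit_pos hd _ _ ω)) h1
    rw [Real.log_mul (hpos ω _).ne' (h.hit_pos hd _ _ ω).ne'] at h2
    simp only [b, Z]
    linarith
  have hb2 : ∀ u q, b (u + q * m) ≤ b u + ∑ s ∈ Finset.range q, Z (u + s * m) ω := by
    intro u q
    induction q with
    | zero => simp
    | succ q ih =>
      rw [Finset.sum_range_succ]
      have := hb1 (u + q * m)
      rw [show u + (q + 1) * m = u + q * m + m by ring]
      linarith
  have hb3 : ∀ r Q, b (r + Q * P) ≤ b r +
      ∑ s ∈ Finset.range p, ∑ j ∈ Finset.range Q, Z (r + s * m + j * P) ω := by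
    intro r Q
    induction Q with
    | zero => simp
    | succ Q ih =>
      simp only [Finset.sum_range_succ _ Q, Finset.sum_add_distrib]
      have := hb2 (r + Q * P) p
      rw [show r + (Q + 1) * P = r + Q * P + p * m by rw [hP]; ring]
      have e : ∑ s ∈ Finset.range p, Z (r + Q * P + s * m) ω =
          ∑ s ∈ Finset.range p, Z (r + s * m + Q * P) ω :=
        Finset.sum_congr rfl fun s _ => by rw [add_right_comm]
      rw [e] at this
      linarith
  have hev : ∀ r ∈ Finset.range P, ∀ᶠ Q : ℕ in atTop, b (r + Q * P) ≤ Q * P * (c / m + ε) := by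
    intro r _
    have h1 : Tendsto (fun Q : ℕ => b r / Q +
        ∑ s ∈ Finset.range p, (∑ j ∈ Finset.range Q, Z (r + s * m + j * P) ω) / Q) atTop
        (𝓝 (0 + ∑ s ∈ Finset.range p, c)) :=
      (tendsto_const_div_atTop_nhds_zero_nat _).add (tendsto_finsetSum _ fun s _ => hω _)
    have h2 : 0 + ∑ s ∈ Finset.range p, c < P * (c / m + ε) := by
      have hm' : (m : ℝ) ≠ 0 := by positivity
      have hP' : (0 : ℝ) < P := by exact_mod_cast hPpos
      have : (P : ℝ) * (c / m) = p * c := by rw [hP]; push_cast; field_simp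
      rw [mul_add, this]
      simp only [Finset.sum_const, Finset.card_range, nsmul_eq_mul, zero_add]
      nlinarith [mul_pos hP' hε]
    filter_upwards [h1.eventually (gt_mem_nhds h2), eventually_gt_atTop 0] with Q hQ hQ0
    have hQ' : (0 : ℝ) < Q := by exact_mod_cast hQ0
    refine (hb3 r Q).trans ?_
    rw [← Finset.sum_div, ← add_div, div_lt_iff₀ hQ'] at hQ
    linarith
  have hev' : ∀ᶠ Q : ℕ in atTop, ∀ r ∈ Finset.range P, b (r + Q * P) ≤ Q * P * (c / m + ε) :=
    (Finset.eventually_all _).2 hev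
  have hdiv : Tendsto (fun k : ℕ => k / P) atTop atTop := Nat.tendsto_div_const_atTop hPpos.ne'
  filter_upwards [hdiv.eventually hev'] with k hk
  have h1 := hk (k % P) (Finset.mem_range.2 (Nat.mod_lt _ hPpos))
  have h2 : k % P + k / P * P = k := Nat.mod_add_div' k P
  rw [h2] at h1
  refine h1.trans (mul_le_mul_of_nonneg_right ?_ (by positivity))
  have : k / P * P ≤ k := Nat.div_mul_le_self k P
  exact_mod_cast this

lemma tendsto_integral_log_hitW (hd : 1 ≤ d) (x y : Fin d → ℤ) {N : ℕ}
    (hpos : ∀ ω, 0 < hitW (fun z => X z ω) y N x)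
    (hinteg : Integrable (fun ω => Real.log (hitW (fun z => X z ω) y N x)) μ) :
    Tendsto (fun n => ∫ ω, Real.log (hitW (fun z => X z ω) y (N + n) x) ∂μ) atTop
      (𝓝 (∫ ω, Real.log (hit (fun z => X z ω) x y) ∂μ)) := by
  refine tendsto_integral_of_dominated_convergence
    (fun ω => ‖Real.log (hitW (fun z => X z ω) y N x)‖)
    (fun n => (h.measurable_hitW _ _ _).log.aestronglyMeasurable) hinteg.norm
    (fun n => ae_of_all _ fun ω => ?_) (ae_of_all _ fun ω => ?_)
  · have h1 := Real.log_le_log (hpos ω) (hitW_mono (h.isWeight ω) (Nat.le_add_right N n))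
    have h2 := Real.log_nonpos (hitW_nonneg (x := x) (y := y) (h.isWeight ω) (N + n))
      (hitW_le_one hd (h.isWeight ω) (N + n))
    rw [Real.norm_of_nonpos h2, Real.norm_of_nonpos (h1.trans h2)]
    exact neg_le_neg h1
  · refine (Real.continuousAt_log (h.hit_pos hd x y ω).ne').tendsto.comp ?_
    have := (tendsto_add_atTop_iff_nat N).2 (tendsto_hitW hd (h.isWeight ω) x y)
    simpa only [add_comm] using this

/-- First `m` is chosen so that `meanCost (m • l) / m` is close to `A`, then so many steps are
allowed that the finite-range passage costs nearly as little. -/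
lemma ae_cost_le (hd : 1 ≤ d) (l : Fin d → ℤ) {A : ℝ}
    (hA : Tendsto (fun k : ℕ => meanCost μ X (k • l) / k) atTop (𝓝 A)) :
    ∀ᵐ ω ∂μ, ∀ ε : ℝ, 0 < ε → ∀ᶠ k : ℕ in atTop,
      -Real.log (hit (fun z => X z ω) (k • l) 0) ≤ k * (A + ε) := by
  have hA0 : 0 ≤ A := ge_of_tendsto' hA fun k =>
    div_nonneg (h.meanCost_nonneg hd _) (by positivity)
  rcases eq_or_ne l 0 with rfl | hl
  · refine ae_of_all _ fun ω ε hε => Eventually.of_forall fun k => ?_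
    simp only [smul_zero, hit_self, Real.log_one, neg_zero]
    positivity
  have hex : ∀ m : ℕ, ∃ N, (∀ ω x, 0 < hitW (fun z => X z ω) x N (x + m • l)) ∧
      Integrable (fun ω => Real.log (hitW (fun z => X z ω) 0 N (m • l))) μ := by
    intro m
    obtain ⟨N, hN⟩ := h.exists_integrable_log_hitW hd (-(m • l))
    refine ⟨N, fun ω x => ?_, ?_⟩
    · simpa using (hN (x + m • l)).1 ω
    · simpa using (hN (m • l)).2
  choose N hNpos hNint using hex
  have hmono : ∀ m n ω x, 0 < hitW (fun z => X z ω) x (N m + n) (x + m • l) := fun m n ω x =>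
    (hNpos m ω x).trans_le (hitW_mono (h.isWeight ω) (Nat.le_add_right _ _))
  have hinteg : ∀ m n, Integrable (fun ω => Real.log (hitW (fun z => X z ω) 0 (N m + n) (m • l))) μ :=
    fun m n => integrable_log_of_le (fun ω => by simpa using hNpos m ω 0)
      (fun ω => hitW_mono (h.isWeight ω) (Nat.le_add_right (N m) n))
      (fun ω => hitW_le_one hd (h.isWeight ω) _) (h.measurable_hitW _ _ _) (hNint m)
  have hall : ∀ᵐ ω ∂μ, ∀ m n : ℕ, 0 < m → ∀ ε : ℝ, 0 < ε → ∀ᶠ k : ℕ in atTop,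
      -Real.log (hit (fun z => X z ω) (k • l) 0) ≤
      k * ((-∫ ω, Real.log (hitW (fun z => X z ω) 0 (N m + n) (m • l)) ∂μ) / m + ε) := by
    refine ae_all_iff.2 fun m => ae_all_iff.2 fun n => ?_
    by_cases hm : 0 < m
    · filter_upwards [h.ae_cost_le_of_hitW hd hl hm (hmono m n) (hinteg m n)] with ω hω _
      exact hω
    · exact ae_of_all _ fun ω hm' => absurd hm' hm
  filter_upwards [hall] with ω hω ε hε
  obtain ⟨m, hmA, hm0⟩ := ((hA.eventually (gt_mem_nhds (show A < A + ε / 3 by linarith))).and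
    (eventually_gt_atTop 0)).exists
  have hm' : (0 : ℝ) < m := by exact_mod_cast hm0
  have hlim := ((h.tendsto_integral_log_hitW hd (m • l) 0 (fun ω => by simpa using hNpos m ω 0)
    (hNint m)).neg).div_const (m : ℝ)
  obtain ⟨n, hn⟩ := (hlim.eventually (gt_mem_nhds hmA)).exists
  filter_upwards [hω m n hm0 (ε / 3) (by linarith)] with k hk
  refine hk.trans (mul_le_mul_of_nonneg_left ?_ (by positivity))
  linarith

/-- The environment shifted by a lattice vector is a measure preserving transformation of the
space of environments. -/
lemma measurePreserving_shift (l : Fin d → ℤ) :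
    MeasurePreserving (fun (v : (Fin d → ℤ) → ℝ) x => v (x + l)) (μ.map fun ω x => X x ω)
      (μ.map fun ω x => X x ω) where
  measurable := measurable_pi_iff.2 fun x => measurable_pi_apply _
  map_eq := by
    have hm : Measurable fun ω x => X x ω := measurable_pi_iff.2 fun x => h.measurable x
    rw [Measure.map_map (measurable_pi_iff.2 fun x => measurable_pi_apply _) hm]
    exact (h.identDistrib_env (add_left_injective l)).map_eq

/-- The quenched limit. -/
theorem ae_tendsto_cost (hd : 1 ≤ d) (l : Fin d → ℤ) {A : ℝ}
    (hA : Tendsto (fun k : ℕ => meanCost μ X (k • l) / k) atTop (𝓝 A)) :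
    ∀ᵐ ω ∂μ, Tendsto (fun k : ℕ => -Real.log (hit (fun z => X z ω) (k • l) 0) / k) atTop (𝓝 A) := by
  have hm : Measurable fun ω x => X x ω := measurable_pi_iff.2 fun x => h.measurable x
  set ν := μ.map fun ω x => X x ω with hν
  have : IsProbabilityMeasure ν := Measure.isProbabilityMeasure_map hm.aemeasurable
  -- On the space of environments the shift is a genuine measure preserving map. `E` is a
  -- shift-invariant set of full measure on which the inequalities hold; costs are set to `0` off
  -- `E` to make subadditivity hold pointwise.
  let E : Set ((Fin d → ℤ) → ℝ) := {v | IsWeight v ∧ ∀ x y, 0 < hit v x y}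
  have hTE : ∀ v ∈ E, ∀ z, (fun x => v (x + z)) ∈ E := by
    rintro v ⟨hv1, hv2⟩ z
    refine ⟨fun x => hv1 (x + z), fun x y => ?_⟩
    rw [hit_comp_add]
    exact hv2 _ _
  have hEm : MeasurableSet E := by
    have : E = (⋂ x, {v | 0 < v x ∧ v x ≤ 1}) ∩ ⋂ (x) (y), {v | 0 < hit v x y} := by
      ext v; simp [E, IsWeight]
    rw [this]
    refine (MeasurableSet.iInter fun x => ?_).inter (MeasurableSet.iInter fun x =>
      MeasurableSet.iInter fun y => measurableSet_lt measurable_const (measurable_hit_env x y))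
    exact (measurableSet_lt measurable_const (measurable_pi_apply x)).inter
      (measurableSet_le (measurable_pi_apply x) measurable_const)
  classical
  let a : ℕ → ((Fin d → ℤ) → ℝ) → ℝ := fun k v =>
    if v ∈ E then -Real.log (hit v (k • l) 0) else 0
  have haX : ∀ k ω, a k (fun x => X x ω) = -Real.log (hit (fun z => X z ω) (k • l) 0) := by
    intro k ω
    exact if_pos ⟨h.isWeight ω, fun x y => h.hit_pos hd x y ω⟩
  have ham : ∀ k, Measurable (a k) := fun k =>
    Measurable.ite hEm (measurable_hit_env _ _).log.neg measurable_const
  have hai : ∀ k, Integrable (a k) ν := by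
    intro k
    rw [hν, integrable_map_measure (ham k).aestronglyMeasurable hm.aemeasurable]
    simp only [Function.comp_def, haX]
    exact (h.integrable_log_hit hd _ _).neg
  have haint : ∀ k, ∫ v, a k v ∂ν = meanCost μ X (k • l) := by
    intro k
    rw [hν, integral_map hm.aemeasurable (ham k).aestronglyMeasurable]
    simp only [haX, integral_neg, meanCost]
  have hiter : ∀ (k : ℕ) (v : (Fin d → ℤ) → ℝ),
      (fun (v : (Fin d → ℤ) → ℝ) x => v (x + l))^[k] v = fun x => v (x + k • l) := by
    intro k
    induction k with
    | zero => intro v; simp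
    | succ k ih =>
      intro v
      rw [Function.iterate_succ_apply, ih]
      ext x
      rw [succ_nsmul, add_assoc]
  have hT : MeasurePreserving (fun (v : (Fin d → ℤ) → ℝ) x => v (x + l)) ν ν :=
    h.measurePreserving_shift l
  have key := ae_tendsto_of_subadditive hT ham (fun k v => ?_)
    (fun v => ?_) hai (fun m n v => ?_) (A := A) (by simpa only [haint] using hA) ?_
  · rw [ae_map_iff hm.aemeasurable (measurableSet_tendsto _ fun k => (ham k).div_const _)] at key
    simpa only [haX] using key
  · simp only [a]
    split_ifs with hv
    · exact neg_nonneg.2 (Real.log_nonpos (hv.2 _ _).le (hit_le_one hd hv.1))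
    · rfl
  · simp [a]
  · rw [hiter]
    by_cases hv : v ∈ E
    · simp only [a, if_pos hv, if_pos (hTE v hv (m • l)), hit_comp_add, zero_add]
      have h1 := hit_mul_le hd hv.1 ((m + n) • l) (m • l) 0
      have h2 := Real.log_le_log (mul_pos (hv.2 _ _) (hv.2 _ _)) h1
      rw [Real.log_mul (hv.2 _ _).ne' (hv.2 _ _).ne'] at h2
      rw [← add_smul, add_comm n m]
      linarith
    · have hv' : (fun x => v (x + m • l)) ∉ E := by
        intro hcon
        have := hTE _ hcon (-(m • l))
        simp only [neg_add_cancel_right] at this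
        exact hv this
      simp only [a, if_neg hv, if_neg hv', add_zero, le_refl]
  · have hset : MeasurableSet {v : (Fin d → ℤ) → ℝ | ∀ j : ℕ, ∃ K : ℕ, ∀ k, K ≤ k →
        a k v ≤ k * (A + 1 / ((j : ℝ) + 1))} := by
      have : {v : (Fin d → ℤ) → ℝ | ∀ j : ℕ, ∃ K : ℕ, ∀ k, K ≤ k →
          a k v ≤ k * (A + 1 / ((j : ℝ) + 1))} = ⋂ (j : ℕ), ⋃ (K : ℕ), ⋂ (k : ℕ), ⋂ (_ : K ≤ k),
          {v | a k v ≤ k * (A + 1 / ((j : ℝ) + 1))} := by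
        ext v; simp
      rw [this]
      exact MeasurableSet.iInter fun j => MeasurableSet.iUnion fun K => MeasurableSet.iInter fun k =>
        MeasurableSet.iInter fun _ => measurableSet_le (ham k) measurable_const
    have hae : ∀ᵐ v ∂ν, ∀ j : ℕ, ∃ K : ℕ, ∀ k, K ≤ k → a k v ≤ k * (A + 1 / ((j : ℝ) + 1)) := by
      rw [hν, ae_map_iff hm.aemeasurable hset]
      filter_upwards [h.ae_cost_le hd l hA] with ω hω j
      simp only [haX]
      exact eventually_atTop.1 (hω _ (by positivity))
    filter_upwards [hae] with v hv ε hε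
    obtain ⟨j, hj⟩ := exists_nat_one_div_lt hε
    obtain ⟨K, hK⟩ := hv j
    filter_upwards [eventually_ge_atTop K] with k hk
    refine (hK k hk).trans ?_
    gcongr

end RandomWeights

/-! ### Decay of averaged hitting weights through slabs -/

section Slabs

variable {d : ℕ} {Λ : ℕ → ℝ} {v : Fin d → ℝ}

/-- The part in the slab `a ≤ ⟨v, x⟩ < a + R` of a path before it first reaches `⟨v, x⟩ ≥ a + R`. -/
noncomputable def slabPart (v : Fin d → ℝ) (a R : ℝ) (l : List (Fin d → ℤ)) : List (Fin d → ℤ) :=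
  (l.takeWhile fun x => decide (height v x < a + R)).filter fun x => decide (a ≤ height v x)

/-- The averaged weight of the crossing of a slab by a path, `0` if the path does not cross it. -/
noncomputable def crossW (Λ : ℕ → ℝ) (v : Fin d → ℝ) (a R : ℝ) (l : List (Fin d → ℤ)) : ℝ :=
  if l.all fun x => decide (height v x < a + R) then 0 else annW Λ (slabPart v a R l)

/-- Strong Markov inequality at the first entrance into `⟨v, x⟩ ≥ a + R`. Discarding later visits
below that level only increases the weight; what remains before and after the entrance uses disjoint
sites, so the averaged weights multiply. A step raises the height by at most `1`, whence starting
heights in `[a, a + 1]`. -/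
lemma walkAvg_hit_le_pow (hd : 1 ≤ d) (hΛ : IsMomentSeq Λ) (hv : ∀ i, |v i| ≤ 1) {R β : ℝ}
    (hR : 0 ≤ R) (hβ : 0 ≤ β)
    (hslab : ∀ (a : ℝ) (n : ℕ) (x : Fin d → ℤ), a ≤ height v x → height v x ≤ a + 1 →
      walkAvg n x (crossW Λ v a R) ≤ β)
    (y : Fin d → ℤ) (k : ℕ) (a : ℝ) (hy : a + k * R ≤ height v y) (n : ℕ) (x : Fin d → ℤ)
    (hx : a ≤ height v x) (hx' : height v x ≤ a + 1) :
    walkAvg n x (fun l => if y ∈ l then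
      annW Λ ((l.takeWhile (· ≠ y)).filter fun x => decide (a ≤ height v x)) else 0) ≤ β ^ k := by
  induction k generalizing a n x with
  | zero =>
    rw [pow_zero, ← walkAvg_const hd (n := n) (x := x) 1]
    refine walkAvg_mono fun l => ?_
    split_ifs
    · exact annW_le_one hΛ _
    · exact zero_le_one
  | succ k ih =>
    push_cast at hy
    set p : (Fin d → ℤ) → Bool := fun x => decide (height v x < a + R) with hp
    set F : ℝ → List (Fin d → ℤ) → ℝ := fun a l => if y ∈ l then
      annW Λ ((l.takeWhile (· ≠ y)).filter fun x => decide (a ≤ height v x)) else 0 with hF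
    have hF0 : ∀ a l, 0 ≤ F a l := by
      intro a l
      simp only [hF]
      split_ifs
      · exact annW_nonneg hΛ _
      · exact le_rfl
    have hpt : ∀ l, F a l ≤ annW Λ ((l.takeWhile p).filter fun x => decide (a ≤ height v x)) *
        F (a + R) (l.dropWhile p) := by
      intro l
      by_cases hyl : y ∈ l
      · have hyp : ¬ p y := by
          simp only [hp, decide_eq_true_eq, not_lt]
          nlinarith [mul_nonneg (Nat.cast_nonneg k : (0 : ℝ) ≤ k) hR]
        have htw : ∀ z ∈ l.takeWhile p, p z := fun z hz => List.mem_takeWhile_imp hz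
        have hyt : y ∉ l.takeWhile p := fun hc => hyp (htw y hc)
        have hyd : y ∈ l.dropWhile p := by
          rw [← List.takeWhile_append_dropWhile (p := p) (l := l), List.mem_append] at hyl
          exact hyl.resolve_left hyt
        have hsplit : l.takeWhile (fun z => decide (z ≠ y)) =
            l.takeWhile p ++ (l.dropWhile p).takeWhile (fun z => decide (z ≠ y)) := by
          conv_lhs => rw [← List.takeWhile_append_dropWhile (p := p) (l := l)]
          rw [List.takeWhile_append_of_pos]
          intro z hz
          have : z ≠ y := fun hc => hyt (hc ▸ hz)
          simpa using this
        simp only [hF, if_pos hyl, if_pos hyd]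
        rw [hsplit, List.filter_append]
        refine (annW_le_of_sublist hΛ (List.Sublist.append (List.Sublist.refl _)
          (List.monotone_filter_right _ (p := fun x => decide (a + R ≤ height v x))
            fun z hz => ?_))).trans ?_
        · simp only [decide_eq_true_eq] at hz ⊢
          linarith
        · rw [annW_append_of_disjoint]
          intro z hz1 hz2
          have h1 := htw z (List.mem_filter.1 hz1).1
          have h2 := (List.mem_filter.1 hz2).2
          simp only [hp, decide_eq_true_eq] at h1 h2
          linarith
      · have : F a l = 0 := by simp [hF, hyl]
        rw [this]
        exact mul_nonneg (annW_nonneg hΛ _) (hF0 _ _)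
    calc walkAvg n x (F a) ≤ walkAvg n x (fun l =>
          annW Λ ((l.takeWhile p).filter fun x => decide (a ≤ height v x)) *
          F (a + R) (l.dropWhile p)) := walkAvg_mono hpt
      _ ≤ β ^ k * walkAvg n x (crossW Λ v a R) := by
        refine walkAvg_exit_le hd (p := p) (I := fun z => height v z ≤ a + R + 1)
          (fun z _ hz s => ?_) (by simp [hF]) (fun j z hz hzp => ?_)
          (Ψ := fun l => annW Λ (l.filter fun x => decide (a ≤ height v x)))
          (fun l => annW_nonneg hΛ _) n x (by linarith)
        · simp only [hp, decide_eq_true_eq] at hz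
          have := (abs_le.1 (abs_height_stepVec hv s)).2
          rw [height_add]
          linarith
        · simp only [hp, decide_eq_true_eq, not_lt] at hzp
          exact ih (a + R) (by linarith) j z hzp hz
      _ ≤ β ^ k * β := mul_le_mul_of_nonneg_left (hslab a n x hx hx') (by positivity)
      _ = β ^ (k + 1) := (pow_succ _ _).symm

lemma IsWalk.eq_cons {n : ℕ} {x : Fin d → ℤ} {l : List (Fin d → ℤ)} (h : IsWalk n x l) :
    ∃ l', l = x :: l' := by
  cases l with
  | nil => simpa using h.2.1
  | cons a l => exact ⟨l, by rw [show a = x by simpa using h.2.1]⟩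

/-- The starting site lies in the slab and alone costs a factor `Λ 1`. This crude slab estimate is
enough for definiteness of the exponents. -/
lemma walkAvg_crossW_le_one_moment (hd : 1 ≤ d) (hΛ : IsMomentSeq Λ) (a : ℝ) (n : ℕ) (x : Fin d → ℤ)
    (hx : a ≤ height v x) (hx' : height v x ≤ a + 1) :
    walkAvg n x (crossW Λ v a 2) ≤ Λ 1 := by
  rw [← walkAvg_const hd (n := n) (x := x) (Λ 1)]
  refine walkAvg_mono_of_isWalk fun l hl => ?_
  obtain ⟨l', rfl⟩ := hl.eq_cons
  unfold crossW
  split_ifs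
  · exact hΛ.nonneg 1
  have h1 : (height v x < a + 2) := by linarith
  have : [x].Sublist (slabPart v a 2 (x :: l')) := by
    simp [slabPart, h1, hx]
  refine (annW_le_of_sublist hΛ this).trans (le_of_eq ?_)
  simp [annW]

end Slabs

/-! ### Lower bounds for the annealed cost from slab estimates -/

namespace RandomWeights

variable {d : ℕ} {Ω : Type*} [MeasurableSpace Ω] {μ : Measure Ω} [IsProbabilityMeasure μ]
  {X : (Fin d → ℤ) → Ω → ℝ} (h : RandomWeights μ X)
include h

lemma mul_neg_log_le_costMean (hd : 1 ≤ d) {v : Fin d → ℝ} (hv : ∀ i, |v i| ≤ 1) {R β : ℝ}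
    (hR : 0 ≤ R) (hβ : 0 < β)
    (hslab : ∀ (a : ℝ) (n : ℕ) (x : Fin d → ℤ), a ≤ height v x → height v x ≤ a + 1 →
      walkAvg n x (crossW (siteMoment μ X) v a R) ≤ β)
    (y : Fin d → ℤ) (k : ℕ) (hy : k * R ≤ height v y) :
    k * -Real.log β ≤ costMean μ X y := by
  have hle : ∫ ω, hit (fun z => X z ω) 0 y ∂μ ≤ β ^ k := by
    refine le_of_tendsto' (h.tendsto_integral_hitW hd 0 y) fun n => ?_
    rw [h.integral_hitW hd]
    refine le_trans (walkAvg_mono fun l => ?_) (walkAvg_hit_le_pow hd h.isMomentSeq hv hR hβ.le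
      hslab y k 0 (by linarith) n 0 (by simp [height_zero]) (by simp [height_zero]))
    split_ifs
    · exact annW_le_of_sublist h.isMomentSeq List.filter_sublist
    · exact le_rfl
  rw [h.integral_hit_eq 0 y, zero_sub] at hle
  have h1 := Real.log_le_log (h.integral_hit_pos hd (-y) 0) hle
  rw [Real.log_pow] at h1
  rw [← h.costMean_neg, costMean]
  linarith

/-- A path to `k • y` crosses `⌊k ⟨v, y⟩ / R⌋` slabs, each at a cost of at least `-ln β`. -/
lemma height_mul_le_seminorm (hd : 1 ≤ d) {v : Fin d → ℝ} (hv : ∀ i, |v i| ≤ 1) {R β : ℝ}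
    (hR : 0 < R) (hβ : 0 < β) (hβ1 : β ≤ 1)
    (hslab : ∀ (a : ℝ) (n : ℕ) (x : Fin d → ℤ), a ≤ height v x → height v x ≤ a + 1 →
      walkAvg n x (crossW (siteMoment μ X) v a R) ≤ β)
    {p : Seminorm ℝ (EuclideanSpace ℝ (Fin d))} {y : Fin d → ℤ}
    (hp : Tendsto (fun k : ℕ => costMean μ X (k • y) / k) atTop (𝓝 (p (latticeVec y)))) :
    -Real.log β / R * height v y ≤ p (latticeVec y) := by
  have hlog : 0 ≤ -Real.log β := neg_nonneg.2 (Real.log_nonpos hβ.le hβ1)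
  rcases le_or_gt (height v y) 0 with hneg | hpos
  · exact (mul_nonpos_of_nonneg_of_nonpos (by positivity) hneg).trans (apply_nonneg p _)
  set t := height v y / R with ht
  have htpos : 0 < t := by positivity
  have hr : Tendsto (fun k : ℕ => ((⌊(t * k)⌋₊ : ℕ) : ℝ) / k * -Real.log β) atTop
      (𝓝 (t * -Real.log β)) :=
    ((tendsto_nat_floor_mul_div_atTop (R := ℝ) htpos.le).comp
      (tendsto_natCast_atTop_atTop (R := ℝ))).mul_const _
  have := le_of_tendsto_of_tendsto' hr hp fun k => ?_
  · rw [ht] at this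
    calc _ = height v y / R * -Real.log β := by ring
      _ ≤ _ := this
  · rw [div_mul_eq_mul_div]
    gcongr
    refine h.mul_neg_log_le_costMean hd hv hR.le hβ hslab _ _ ?_
    have h1 := Nat.floor_le (by positivity : 0 ≤ t * k)
    rw [height_nsmul]
    calc ((⌊t * k⌋₊ : ℕ) : ℝ) * R ≤ t * k * R := by gcongr
      _ = k * height v y := by rw [ht]; field_simp

lemma definite_of_tendsto (hd : 1 ≤ d) {p : Seminorm ℝ (EuclideanSpace ℝ (Fin d))}
    (hp : ∀ y : Fin d → ℤ,
      Tendsto (fun k : ℕ => costMean μ X (k • y) / k) atTop (𝓝 (p (latticeVec y))))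
    (x : EuclideanSpace ℝ (Fin d)) (hx : p x = 0) : x = 0 := by
  have hq1 := h.siteMoment_one_lt
  have hq0 : 0 < siteMoment μ X 1 := by
    have := h.integral_hit_pos hd 0 (Pi.single ⟨0, hd⟩ 1)
    refine this.trans_le ?_
    have h1 := integral_mono (h.integrable_hit hd 0 (Pi.single ⟨0, hd⟩ 1)) (h.integrable_pow 0 1)
      fun ω => by
        simpa using hit_le_weight (x := 0) (y := Pi.single ⟨0, hd⟩ 1) hd (h.isWeight ω)
          (fun hc => by simpa using congrFun hc ⟨0, hd⟩)
    exact h1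
  have hlog : 0 < -Real.log (siteMoment μ X 1) / 2 := by
    have := Real.log_neg hq0 hq1
    linarith
  have key : ∀ (i : Fin d) (z : EuclideanSpace ℝ (Fin d)),
      -Real.log (siteMoment μ X 1) / 2 * z i ≤ p z := by
    intro i z
    refine le_seminorm_of_lattice p (g := fun z => -Real.log (siteMoment μ X 1) / 2 * z i)
      (by fun_prop) (fun c _ x => by simp only [PiLp.smul_apply, smul_eq_mul]; ring)
      (fun y => ?_) z
    have := h.height_mul_le_seminorm hd (v := Pi.single i 1) (fun j => ?_) two_pos hq0 hq1.le
      (fun a n x => walkAvg_crossW_le_one_moment hd h.isMomentSeq a n x) (hp y)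
    · rwa [height_of_single] at this
    · by_cases hj : j = i
      · subst hj; simp
      · simp [hj]
  ext i
  have h1 := key i x
  have h2 := key i (-x)
  rw [map_neg_eq_map, hx] at h2
  rw [hx] at h1
  simp only [PiLp.neg_apply, mul_neg] at h2
  have : -Real.log (siteMoment μ X 1) / 2 * x i = 0 := by linarith
  simpa using (mul_eq_zero.1 this).resolve_left hlog.ne'

end RandomWeights

/-! ### Existence and uniqueness of the Lyapunov exponents -/

section Exponents

variable {d : ℕ} {Ω : Type*} [MeasurableSpace Ω] {μ : Measure Ω} [IsProbabilityMeasure μ]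
  {W : (Fin d → ℤ) → Ω → ℝ}

lemma IsQuenchedExponent.unique {A A' : Seminorm ℝ (EuclideanSpace ℝ (Fin d))}
    (hA : IsQuenchedExponent μ W A) (hA' : IsQuenchedExponent μ W A') : A = A' :=
  seminorm_ext_lattice fun y => tendsto_nhds_unique (hA.mean_tendsto y) (hA'.mean_tendsto y)

lemma IsAnnealedExponent.unique {B B' : Seminorm ℝ (EuclideanSpace ℝ (Fin d))}
    (hB : IsAnnealedExponent μ W B) (hB' : IsAnnealedExponent μ W B') : B = B' :=
  seminorm_ext_lattice fun y => tendsto_nhds_unique (hB.tendsto y) (hB'.tendsto y)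

lemma IsQuenchedExponent.existsUnique {A : Seminorm ℝ (EuclideanSpace ℝ (Fin d))}
    (hA : IsQuenchedExponent μ W A) : ∃! A, IsQuenchedExponent μ W A :=
  ⟨A, hA, fun _ hA' => hA'.unique hA⟩

lemma IsAnnealedExponent.existsUnique {B : Seminorm ℝ (EuclideanSpace ℝ (Fin d))}
    (hB : IsAnnealedExponent μ W B) : ∃! B, IsAnnealedExponent μ W B :=
  ⟨B, hB, fun _ hB' => hB'.unique hB⟩

lemma IsQuenchedExponent.eq_quenchedExponent {A : Seminorm ℝ (EuclideanSpace ℝ (Fin d))}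
    (hA : IsQuenchedExponent μ W A) : quenchedExponent μ W = A := by
  rw [quenchedExponent, dif_pos hA.existsUnique]
  exact hA.existsUnique.choose_spec.1.unique hA

lemma IsAnnealedExponent.eq_annealedExponent {B : Seminorm ℝ (EuclideanSpace ℝ (Fin d))}
    (hB : IsAnnealedExponent μ W B) : annealedExponent μ W = B := by
  rw [annealedExponent, dif_pos hB.existsUnique]
  exact hB.existsUnique.choose_spec.1.unique hB

variable (hd : 1 ≤ d) (hW : ∀ x ω, 0 ≤ W x ω)
  (h : RandomWeights μ fun x ω => siteWeight (fun z => W z ω) x)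

include hd hW h

lemma ae_operatorGreen_eq :
    ∀ᵐ ω ∂μ, ∀ y, operatorGreen (fun x => W x ω) y = green (siteWeight fun z => W z ω) y 0 := by
  filter_upwards [h.ae_summableSurv hd] with ω hω y
  exact operatorGreen_eq hd (fun x => hW x ω) hω y

/-- With `m k` the mean hitting weight, the mean Green's function lies between `c * m k` and `C * m
k ^ θ` for every `θ < 1`. Letting `θ → 1` gives it the exponent of `costMean`. -/
theorem exists_isAnnealedExponent :
    ∃ B, IsAnnealedExponent μ W B ∧ ∀ y : Fin d → ℤ, Tendsto (fun k : ℕ => RandomWeights.costMean μ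
      (fun x ω => siteWeight (fun z => W z ω) x) (k • y) / k) atTop (𝓝 (B (latticeVec y))) := by
  obtain ⟨B, hB, -⟩ := exists_seminorm_of_subadditive (RandomWeights.costMean_zero (μ := μ)
    (X := fun x ω => siteWeight (fun z => W z ω) x)) (h.costMean_nonneg hd) h.costMean_neg
    (h.costMean_add_le hd)
  refine ⟨B, ⟨h.definite_of_tendsto hd hB, fun y => ?_, fun l => ?_⟩, hB⟩
  · refine (h.integrable_green hd y).congr ?_
    filter_upwards [ae_operatorGreen_eq hd hW h] with ω hω
    exact (hω y).symm
  set X : (Fin d → ℤ) → Ω → ℝ := fun x ω => siteWeight (fun z => W z ω) x with hX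
  set m : ℕ → ℝ := fun k => ∫ ω, hit (fun z => X z ω) (k • l) 0 ∂μ with hm
  have hmpos : ∀ k, 0 < m k := fun k => h.integral_hit_pos hd _ _
  have hGeq : ∀ y, ∫ ω, operatorGreen (fun x => W x ω) y ∂μ = ∫ ω, green (fun z => X z ω) y 0 ∂μ := by
    intro y
    refine integral_congr_ae ?_
    filter_upwards [ae_operatorGreen_eq hd hW h] with ω hω
    exact hω y
  simp only [hGeq]
  set e : Fin d → ℤ := Pi.single ⟨0, hd⟩ 1 with he
  have hne : (0 : Fin d → ℤ) ≠ e := fun hc => by simpa [he] using congrFun hc ⟨0, hd⟩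
  -- `green 0 0 ≥ X 0 ≥ hit 0 e`: replacing the Green's function by a hitting weight makes positive
  -- association available.
  set c := ∫ ω, hit (fun z => X z ω) 0 e ∂μ with hc
  have hcpos : 0 < c := h.integral_hit_pos hd _ _
  have hlow : ∀ k, m k * c ≤ ∫ ω, green (fun z => X z ω) (k • l) 0 ∂μ := by
    intro k
    refine (h.integral_hit_mul_le hd (k • l) 0 0 e).trans ?_
    refine integral_mono_ae (integrable_of_mem_unit
      ((h.measurable_hit hd _ _).mul (h.measurable_hit hd _ _)).aestronglyMeasurable
      (fun ω => mul_nonneg (h.hit_pos hd _ _ ω).le (h.hit_pos hd _ _ ω).le)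
      (fun ω => mul_le_one₀ (hit_le_one hd (h.isWeight ω)) (h.hit_pos hd _ _ ω).le
        (hit_le_one hd (h.isWeight ω)))) (h.integrable_green hd _) ?_
    filter_upwards [h.ae_summableSurv hd] with ω hω
    rw [green_eq_hit_mul hd (h.isWeight ω) hω]
    exact mul_le_mul_of_nonneg_left ((hit_le_weight hd (h.isWeight ω) hne).trans
      (weight_le_green_self hd (h.isWeight ω) hω)) (h.hit_pos hd _ _ ω).le
  have hGpos : ∀ k, 0 < ∫ ω, green (fun z => X z ω) (k • l) 0 ∂μ := fun k =>
    (mul_pos (hmpos k) hcpos).trans_le (hlow k)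
  have hup : ∀ θ : ℝ, 0 ≤ θ → θ < 1 → ∃ C, 0 < C ∧
      ∀ k, ∫ ω, green (fun z => X z ω) (k • l) 0 ∂μ ≤ C * m k ^ θ := by
    intro θ h0 h1
    obtain ⟨C, hC, hCm⟩ := h.exists_integral_hit_mul_surv_le hd h0 h1
    refine ⟨C, hC, fun k => le_trans ?_ (hCm (k • l))⟩
    have hi : Integrable (fun ω => hit (fun z => X z ω) (k • l) 0 *
        ∑' n, surv (fun z => X z ω) (n + 1) 0) μ :=
      (h.integrable_tsum_surv hd).bdd_mul (c := 1) (h.measurable_hit hd _ _).aestronglyMeasurable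
        (ae_of_all _ fun ω => by
          rw [Real.norm_of_nonneg (h.hit_pos hd _ _ ω).le]
          exact hit_le_one hd (h.isWeight ω))
    refine integral_mono_ae (h.integrable_green hd _) hi ?_
    filter_upwards [h.ae_summableSurv hd] with ω hω
    rw [green_eq_hit_mul hd (h.isWeight ω) hω]
    exact mul_le_mul_of_nonneg_left (h.green_self_le_tsum hd hω) (h.hit_pos hd _ _ ω).le
  have hBl := hB l
  have hBnn : 0 ≤ B (latticeVec l) := apply_nonneg B _
  rw [tendsto_order]
  constructor
  · intro b hb
    obtain ⟨θ, hθ0, hθ1, hθb⟩ : ∃ θ : ℝ, 0 ≤ θ ∧ θ < 1 ∧ b < θ * B (latticeVec l) := by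
      have ht : Tendsto (fun θ : ℝ => θ * B (latticeVec l)) (𝓝[<] 1)
          (𝓝 (1 * B (latticeVec l))) :=
        ((continuous_id.mul continuous_const).tendsto 1).mono_left nhdsWithin_le_nhds
      rw [one_mul] at ht
      have hev := ht.eventually (lt_mem_nhds hb)
      have hev2 : ∀ᶠ θ : ℝ in 𝓝[<] 1, 0 < θ ∧ θ < 1 :=
        Ioo_mem_nhdsLT (zero_lt_one' ℝ)
      obtain ⟨θ, h1, h2⟩ := (hev.and hev2).exists
      exact ⟨θ, h2.1.le, h2.2, h1⟩
    obtain ⟨C, hC, hCm⟩ := hup θ hθ0 hθ1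
    have hlim := (hBl.const_mul θ).sub (tendsto_const_div_atTop_nhds_zero_nat (Real.log C))
    rw [sub_zero] at hlim
    filter_upwards [hlim.eventually (lt_mem_nhds hθb)] with k hk
    refine hk.trans_le ?_
    have h1 := Real.log_le_log (hGpos k) (hCm k)
    rw [Real.log_mul hC.ne' (Real.rpow_pos_of_pos (hmpos k) _).ne', Real.log_rpow (hmpos k)] at h1
    rw [← mul_div_assoc, ← sub_div]
    gcongr
    simp only [RandomWeights.costMean]
    linarith
  · intro b hb
    have hlim := hBl.sub (tendsto_const_div_atTop_nhds_zero_nat (Real.log c))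
    rw [sub_zero] at hlim
    filter_upwards [hlim.eventually (gt_mem_nhds hb)] with k hk
    refine lt_of_le_of_lt ?_ hk
    have h1 := Real.log_le_log (mul_pos (hmpos k) hcpos) (hlow k)
    rw [Real.log_mul (hmpos k).ne' hcpos.ne'] at h1
    rw [← sub_div]
    gcongr
    simp only [RandomWeights.costMean]
    linarith

/-- Definiteness is inherited from the annealed norm, which is smaller by Jensen's inequality. The
factor `green 0 0` adds a fixed logarithm with finite mean, negligible after division by `k`. -/
theorem exists_isQuenchedExponent :
    ∃ A, IsQuenchedExponent μ W A ∧ (∀ y : Fin d → ℤ, Tendsto (fun k : ℕ =>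
      RandomWeights.meanCost μ (fun x ω => siteWeight (fun z => W z ω) x) (k • y) / k) atTop
        (𝓝 (A (latticeVec y)))) ∧
      ∀ y, A (latticeVec y) ≤
        RandomWeights.meanCost μ (fun x ω => siteWeight (fun z => W z ω) x) y := by
  obtain ⟨A, hA, hAle⟩ := exists_seminorm_of_subadditive (RandomWeights.meanCost_zero (μ := μ)
    (X := fun x ω => siteWeight (fun z => W z ω) x)) (h.meanCost_nonneg hd) h.meanCost_neg
    (h.meanCost_add_le hd)
  obtain ⟨B, hB, hBlim⟩ := exists_isAnnealedExponent hd hW h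
  have hBA : ∀ x, B x ≤ A x := seminorm_le_of_lattice fun y =>
    le_of_tendsto_of_tendsto' (hBlim y) (hA y) fun k => by
      gcongr
      exact h.costMean_le_meanCost hd _
  have hlog : ∀ᵐ ω ∂μ, ∀ y, Real.log (operatorGreen (fun x => W x ω) y) =
      Real.log (hit (siteWeight fun z => W z ω) y 0) +
      Real.log (green (siteWeight fun z => W z ω) 0 0) := by
    filter_upwards [ae_operatorGreen_eq hd hW h, h.ae_summableSurv hd] with ω h1 h2 y
    rw [h1 y]
    exact h.log_green_eq hd h2 y
  refine ⟨A, ⟨fun x hx => hB.definite x (le_antisymm ((hBA x).trans hx.le) (apply_nonneg B x)),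
    ?_, fun y => ?_, fun l => ?_⟩, hA, hAle⟩
  · filter_upwards [hlog, ae_all_iff.2 fun l => h.ae_tendsto_cost hd l (hA l)] with ω h1 h2 l
    simp only [h1]
    have := (h2 l).sub (tendsto_const_div_atTop_nhds_zero_nat
      (Real.log (green (siteWeight fun z => W z ω) 0 0)))
    rw [sub_zero] at this
    refine this.congr fun k => ?_
    rw [← sub_div, neg_add']
  · refine ((h.integrable_log_hit hd y 0).add (h.integrable_log_green_self hd)).congr ?_
    filter_upwards [hlog] with ω h1
    exact (h1 y).symm
  · have h1 : ∀ y, ∫ ω, Real.log (operatorGreen (fun x => W x ω) y) ∂μ =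
        -RandomWeights.meanCost μ (fun x ω => siteWeight (fun z => W z ω) x) y +
        ∫ ω, Real.log (green (siteWeight fun z => W z ω) 0 0) ∂μ := by
      intro y
      rw [RandomWeights.meanCost, neg_neg, ← integral_add (h.integrable_log_hit hd y 0)
        (h.integrable_log_green_self hd)]
      refine integral_congr_ae ?_
      filter_upwards [hlog] with ω hω
      exact hω y
    simp only [h1]
    have := (hA l).sub (tendsto_const_div_atTop_nhds_zero_nat
      (∫ ω, Real.log (green (siteWeight fun z => W z ω) 0 0) ∂μ))
    rw [sub_zero] at this
    refine this.congr fun k => ?_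
    rw [← sub_div]
    ring

end Exponents

/-! ### The upper bound for the quenched exponent -/

lemma one_add_sq_div_two_le_cosh (t : ℝ) : 1 + t ^ 2 / 2 ≤ Real.cosh t := by
  have h1 : Real.cosh t = 1 + 2 * Real.sinh (t / 2) ^ 2 := by
    have h2 := Real.cosh_two_mul (t / 2)
    have h3 := Real.cosh_sq (t / 2)
    rw [show 2 * (t / 2) = t by ring] at h2
    linarith
  have h4 : (t / 2) ^ 2 ≤ Real.sinh (t / 2) ^ 2 := by
    rw [sq_le_sq, Real.abs_sinh]
    exact Real.self_le_sinh_iff.2 (abs_nonneg _)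
  rw [h1]
  linarith

/-- A real number whose powers grow at most polynomially is at most `1`. -/
lemma le_one_of_pow_le_poly {κ : ℝ} {d : ℕ} (h : ∀ n : ℕ, κ ^ n ≤ (2 * n + 1) ^ d) : κ ≤ 1 := by
  by_contra! hκ
  have h1 : Tendsto (fun n : ℕ => (3 : ℝ) ^ d * ((n : ℝ) ^ d / κ ^ n)) atTop (𝓝 (3 ^ d * 0)) :=
    (tendsto_pow_const_div_const_pow_of_one_lt d hκ).const_mul _
  rw [mul_zero] at h1
  obtain ⟨n, hn, hn1⟩ := ((h1.eventually (gt_mem_nhds zero_lt_one)).and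
    (eventually_ge_atTop 1)).exists
  have hpos : 0 < κ ^ n := by positivity
  rw [← mul_div_assoc, div_lt_one hpos, ← mul_pow] at hn
  have h2 : ((2 * n + 1 : ℝ)) ^ d ≤ (3 * n) ^ d := by
    have : (1 : ℝ) ≤ n := by exact_mod_cast hn1
    gcongr
    linarith
  linarith [h n]

section ExpSum

variable {d : ℕ}

lemma hitW_eq_zero {X : (Fin d → ℤ) → ℝ} {y x : Fin d → ℤ} {n : ℕ} {i : Fin d}
    (h : (n : ℤ) < |x i - y i|) : hitW X y n x = 0 := by
  induction n generalizing x with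
  | zero =>
    rw [hitW_zero, if_neg]
    rintro rfl
    simp at h
  | succ n ih =>
    have hne : x ≠ y := by
      rintro rfl
      simp at h
      omega
    rw [hitW_succ_of_ne hne]
    have : ∀ s, hitW X y n (x + stepVec s) = 0 := by
      intro s
      refine ih ?_
      have h2 := abs_stepVec_apply_le s i
      rw [Pi.add_apply]
      push_cast at h
      rw [abs_le] at h2
      rw [lt_abs] at h ⊢
      omega
    simp [nbrAvg, this]

/-- If the hitting weights of a constant potential are dominated by `exp (-⟨v, ·⟩)`, then
`∑ vᵢ² ≤ 2 d w`. -/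
lemma sum_sq_le_of_hitW_le (hd : 1 ≤ d) {w : ℝ} (hw : 0 ≤ w) {v : Fin d → ℝ}
    (hle : ∀ n x, Real.exp (height v x) * hitW (fun _ => (1 + w)⁻¹) 0 n x ≤ 1) :
    ∑ i, v i ^ 2 ≤ 2 * d * w := by
  have hd0 : (0 : ℝ) < d := by exact_mod_cast hd
  have hX : IsWeight fun _ : Fin d → ℤ => (1 + w)⁻¹ := fun x =>
    ⟨by positivity, inv_le_one_of_one_le₀ (by linarith)⟩
  set X : (Fin d → ℤ) → ℝ := fun _ => (1 + w)⁻¹ with hXdef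
  let F : ℕ → (Fin d → ℤ) → ℝ := fun n x => Real.exp (height v x) * hitW X 0 n x
  let Bx : ℕ → Finset (Fin d → ℤ) := fun n => Finset.Icc (fun _ => -(n : ℤ)) fun _ => (n : ℤ)
  have hF0 : ∀ n x, 0 ≤ F n x := fun n x => mul_nonneg (Real.exp_pos _).le (hitW_nonneg hX n)
  have hsupp : ∀ n x, x ∉ Bx n → F n x = 0 := by
    intro n x hx
    obtain ⟨i, hi⟩ : ∃ i, (n : ℤ) < |x i - (0 : Fin d → ℤ) i| := by
      by_contra! hcon
      refine hx (Finset.mem_Icc.2 ⟨fun i => ?_, fun i => ?_⟩) <;>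
      · have := hcon i
        simp only [Pi.zero_apply, sub_zero, abs_le] at this
        simp only
        omega
    simp [F, hitW_eq_zero hi]
  have hsum : ∀ n, Summable (F n) := fun n => summable_of_ne_finset_zero (hsupp n)
  have hupper : ∀ n : ℕ, ∑' x, F n x ≤ (2 * n + 1) ^ d := by
    intro n
    rw [tsum_eq_sum (hsupp n)]
    refine (Finset.sum_le_card_nsmul _ _ 1 fun x _ => hle n x).trans (le_of_eq ?_)
    rw [Pi.card_Icc]
    simp only [Int.card_Icc, Finset.prod_const, Finset.card_univ, Fintype.card_fin, nsmul_eq_mul,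
      mul_one]
    rw [show ((n : ℤ) + 1 - -(n : ℤ)).toNat = 2 * n + 1 by omega]
    push_cast
    ring
  -- Growth factor of the tilted sum per additional step: shifting the lattice by `e` produces `exp
  -- (-⟨v, e⟩)`. At the origin the recursion is only an inequality, in the direction needed.
  set κ := (1 + w)⁻¹ * ((∑ s : Fin d × Bool, Real.exp (-height v (stepVec s))) / (2 * d)) with hκ
  have hstep : ∀ n, κ * ∑' x, F n x ≤ ∑' x, F (n + 1) x := by
    intro n
    have hshift : ∀ e : Fin d → ℤ, HasSum (fun x => Real.exp (-height v e) * F n (x + e))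
        (Real.exp (-height v e) * ∑' x, F n x) := fun e =>
      (((Equiv.addRight e).hasSum_iff.2 (hsum n).hasSum)).mul_left _
    have h1 := ((hasSum_sum (s := (Finset.univ : Finset (Fin d × Bool))) fun s _ =>
      hshift (stepVec s)).div_const (2 * (d : ℝ))).mul_left (1 + w)⁻¹
    have h2 : κ * ∑' x, F n x = (1 + w)⁻¹ *
        ((∑ s : Fin d × Bool, Real.exp (-height v (stepVec s)) * ∑' x, F n x) / (2 * d)) := by
      rw [hκ, ← Finset.sum_mul]
      ring
    rw [h2]
    refine hasSum_le (fun x => ?_) h1 (hsum (n + 1)).hasSum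
    have h3 : ∀ s : Fin d × Bool, Real.exp (-height v (stepVec s)) * F n (x + stepVec s) =
        Real.exp (height v x) * hitW X 0 n (x + stepVec s) := by
      intro s
      simp only [F]
      rw [← mul_assoc, ← Real.exp_add, height_add]
      congr 2
      ring
    simp only [h3, ← Finset.mul_sum]
    have h4 : (1 + w)⁻¹ * nbrAvg (hitW X 0 n) x ≤ hitW X 0 (n + 1) x := by
      by_cases hx : x = 0
      · subst hx
        rw [hitW_self]
        exact mul_le_one₀ (hX 0).2 (nbrAvg_nonneg fun _ => hitW_nonneg hX n)
          (nbrAvg_le_of_le hd fun _ => hitW_le_one hd hX n)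
      · rw [hitW_succ_of_ne hx]
    calc _ = Real.exp (height v x) * ((1 + w)⁻¹ * nbrAvg (hitW X 0 n) x) := by
          unfold nbrAvg; ring
      _ ≤ _ := mul_le_mul_of_nonneg_left h4 (Real.exp_pos _).le
  have hκ0 : 0 ≤ κ := by
    have := Finset.sum_nonneg fun (s : Fin d × Bool) (_ : s ∈ Finset.univ) =>
      (Real.exp_pos (-height v (stepVec s))).le
    positivity
  have hpow : ∀ n : ℕ, κ ^ n ≤ ∑' x, F n x := by
    intro n
    induction n with
    | zero =>
      have : F 0 0 ≤ ∑' x, F 0 x := (hsum 0).le_tsum 0 fun x _ => hF0 0 x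
      simpa [F, height_zero] using this
    | succ n ih =>
      rw [pow_succ']
      exact (mul_le_mul_of_nonneg_left ih hκ0).trans (hstep n)
  have hκ1 : κ ≤ 1 := le_one_of_pow_le_poly fun n => (hpow n).trans (hupper n)
  rw [hκ, inv_mul_le_iff₀ (by linarith), mul_one, div_le_iff₀ (by positivity),
    sum_step (fun e => Real.exp (-height v e))] at hκ1
  simp only [height_single, height_neg, neg_neg] at hκ1
  have h5 : ∑ i : Fin d, (2 + v i ^ 2) ≤ ∑ i, (Real.exp (-v i) + Real.exp (v i)) := by
    refine Finset.sum_le_sum fun i _ => ?_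
    have := one_add_sq_div_two_le_cosh (v i)
    rw [Real.cosh_eq] at this
    linarith
  rw [Finset.sum_add_distrib] at h5
  simp only [Finset.sum_const, Finset.card_univ, Fintype.card_fin, nsmul_eq_mul] at h5
  nlinarith

end ExpSum

/-- Hahn–Banach extension of `c • x ↦ c * p x` from the line through `x`. -/
lemma exists_linear_le_seminorm {E : Type*} [AddCommGroup E] [Module ℝ E] (p : Seminorm ℝ E)
    (x : E) : ∃ g : E →ₗ[ℝ] ℝ, g x = p x ∧ ∀ y, g y ≤ p y := by
  have H : ∀ c : ℝ, c • x = 0 → (RingHom.id ℝ) c • p x = 0 := by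
    intro c hc
    rcases smul_eq_zero.1 hc with h | h
    · simp [h]
    · simp [h]
  obtain ⟨g, hg1, hg2⟩ := exists_extension_of_le_sublinear
    (LinearPMap.mkSpanSingleton' x (p x) H) p
    (fun c hc y => by rw [map_smul_eq_mul, Real.norm_of_nonneg hc.le]) (map_add_le_add p)
    (by
      rintro ⟨y, hy⟩
      obtain ⟨c, rfl⟩ := Submodule.mem_span_singleton.1 hy
      rw [LinearPMap.mkSpanSingleton'_apply]
      simp only [RingHom.id_apply, smul_eq_mul, map_smul_eq_mul]
      exact mul_le_mul_of_nonneg_right (le_abs_self c) (apply_nonneg p x))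
  · refine ⟨g, ?_, hg2⟩
    have hx : x ∈ (LinearPMap.mkSpanSingleton' x (p x) H).domain :=
      Submodule.mem_span_singleton_self x
    have := hg1 ⟨x, hx⟩
    rwa [LinearPMap.mkSpanSingleton'_apply_self] at this

namespace RandomWeights

variable {d : ℕ} {Ω : Type*} [MeasurableSpace Ω] {μ : Measure Ω} [IsProbabilityMeasure μ]
  {X : (Fin d → ℤ) → Ω → ℝ} (h : RandomWeights μ X)
include h

/-- `exp (-meanCost)` is a supersolution for the constant weight `exp (𝔼[ln X])`. -/
lemma meanCost_super (hd : 1 ≤ d) {x : Fin d → ℤ} (hx : x ≠ 0) :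
    Real.exp (∫ ω, Real.log (X 0 ω) ∂μ) * nbrAvg (fun y => Real.exp (-meanCost μ X y)) x ≤
      Real.exp (-meanCost μ X x) := by
  have hd0 : (0 : ℝ) < 2 * d := by
    have : (0 : ℝ) < d := by exact_mod_cast hd
    positivity
  set φ : (Fin d → ℤ) → ℝ := fun y => Real.exp (-meanCost μ X y) with hφ
  have hφpos : ∀ y, 0 < φ y := fun y => Real.exp_pos _
  set S := nbrAvg φ x with hS
  have hne : (Finset.univ : Finset (Fin d × Bool)).Nonempty := ⟨(⟨0, hd⟩, true), Finset.mem_univ _⟩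
  have hSpos : 0 < S := div_pos (Finset.sum_pos (fun s _ => hφpos _) hne) hd0
  have hNpos : ∀ ω, 0 < nbrAvg (fun y => hit (fun z => X z ω) y 0) x := fun ω =>
    div_pos (Finset.sum_pos (fun s _ => h.hit_pos hd _ _ ω) hne) hd0
  -- Jensen's inequality for the logarithm is used with weights proportional to `φ` on the
  -- neighbours. Since `𝔼[ln hit] = ln φ`, the terms `ln (hit / φ)` have mean zero and only `ln S`
  -- survives.
  set q : Fin d × Bool → ℝ := fun s => φ (x + stepVec s) / (2 * d * S) with hq
  have hqsum : ∑ s, q s = 1 := by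
    have h1 : ∑ s, φ (x + stepVec s) = 2 * d * S := by
      rw [hS, nbrAvg, mul_div_cancel₀ _ hd0.ne']
    rw [hq, ← Finset.sum_div, h1, div_self (by positivity)]
  have hjensen : ∀ ω, Real.log S + ∑ s, q s * (Real.log (hit (fun z => X z ω) (x + stepVec s) 0) +
      meanCost μ X (x + stepVec s)) ≤ Real.log (nbrAvg (fun y => hit (fun z => X z ω) y 0) x) := by
    intro ω
    have h1 := strictConcaveOn_log_Ioi.concaveOn.le_map_sum (t := Finset.univ) (w := q)
      (p := fun s => hit (fun z => X z ω) (x + stepVec s) 0 / φ (x + stepVec s))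
      (fun s _ => div_nonneg (hφpos _).le (by positivity)) hqsum
      (fun s _ => div_pos (h.hit_pos hd _ _ ω) (hφpos _))
    have h2 : ∑ s, q s • (hit (fun z => X z ω) (x + stepVec s) 0 / φ (x + stepVec s)) =
        nbrAvg (fun y => hit (fun z => X z ω) y 0) x / S := by
      rw [nbrAvg, div_div, Finset.sum_div]
      refine Finset.sum_congr rfl fun s _ => ?_
      have := (hφpos (x + stepVec s)).ne'
      simp only [hq, smul_eq_mul]
      field_simp
    rw [h2, Real.log_div (hNpos ω).ne' hSpos.ne'] at h1
    have h3 : ∑ s, q s • Real.log (hit (fun z => X z ω) (x + stepVec s) 0 / φ (x + stepVec s)) =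
        ∑ s, q s * (Real.log (hit (fun z => X z ω) (x + stepVec s) 0) +
          meanCost μ X (x + stepVec s)) := by
      refine Finset.sum_congr rfl fun s _ => ?_
      rw [Real.log_div (h.hit_pos hd _ _ ω).ne' (hφpos _).ne', hφ, Real.log_exp, smul_eq_mul,
        sub_neg_eq_add]
    rw [h3] at h1
    linarith
  have hloghit : ∀ ω, Real.log (hit (fun z => X z ω) x 0) = Real.log (X x ω) +
      Real.log (nbrAvg (fun y => hit (fun z => X z ω) y 0) x) := by
    intro ω
    rw [hit_of_ne hd (h.isWeight ω) hx, Real.log_mul (h.isWeight ω x).1.ne' (hNpos ω).ne']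
  have hi : ∀ s, Integrable (fun ω => q s * (Real.log (hit (fun z => X z ω) (x + stepVec s) 0) +
      meanCost μ X (x + stepVec s))) μ := fun s =>
    ((h.integrable_log_hit hd _ _).add (integrable_const _)).const_mul _
  have hi2 : Integrable (fun ω => Real.log S + ∑ s, q s *
      (Real.log (hit (fun z => X z ω) (x + stepVec s) 0) + meanCost μ X (x + stepVec s))) μ :=
    (integrable_const _).add (integrable_finsetSum _ fun s _ => hi s)
  have hzero : ∀ s, ∫ ω, q s * (Real.log (hit (fun z => X z ω) (x + stepVec s) 0) +
      meanCost μ X (x + stepVec s)) ∂μ = 0 := by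
    intro s
    rw [integral_const_mul, integral_add (h.integrable_log_hit hd _ _) (integrable_const _)]
    simp [meanCost]
  have hmain : ∫ ω, Real.log (X 0 ω) ∂μ + Real.log S ≤ -meanCost μ X x := by
    have h1 := integral_mono ((h.integrable_log_weight x).add hi2) (h.integrable_log_hit hd x 0)
      fun ω => by
        simp only [Pi.add_apply]
        rw [hloghit ω]
        linarith [hjensen ω]
    simp only [Pi.add_apply] at h1
    rw [integral_add (h.integrable_log_weight x) hi2, integral_add (integrable_const _)
      (integrable_finsetSum _ fun s _ => hi s), integral_finsetSum _ fun s _ => hi s] at h1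
    simp only [hzero, Finset.sum_const_zero, add_zero, integral_const, probReal_univ, one_smul]
      at h1
    have h2 : ∫ ω, Real.log (X x ω) ∂μ = ∫ ω, Real.log (X 0 ω) ∂μ :=
      ((h.ident x).comp Real.measurable_log).integral_eq
    rw [h2] at h1
    simpa [meanCost] using h1
  calc _ = Real.exp (∫ ω, Real.log (X 0 ω) ∂μ + Real.log S) := by
        rw [Real.exp_add, Real.exp_log hSpos]
    _ ≤ _ := Real.exp_le_exp.2 hmain

/-- The upper bound for the quenched exponent by the Euclidean norm. -/
theorem seminorm_le_sqrt_mul_norm (hd : 1 ≤ d) {A : Seminorm ℝ (EuclideanSpace ℝ (Fin d))}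
    (hA : ∀ y, A (latticeVec y) ≤ meanCost μ X y) {w : ℝ} (hw : 0 ≤ w)
    (hX : -∫ ω, Real.log (X 0 ω) ∂μ ≤ Real.log (1 + w)) (x : EuclideanSpace ℝ (Fin d)) :
    A x ≤ √(2 * d * w) * ‖x‖ := by
  -- The supporting functional at `x` reduces the bound on `A x` to one on the Euclidean length of
  -- `g`, by Cauchy–Schwarz at the end.
  obtain ⟨g, hgx, hgA⟩ := exists_linear_le_seminorm A x
  set v : Fin d → ℝ := fun i => g (EuclideanSpace.single i 1) with hv
  have hg : ∀ z : EuclideanSpace ℝ (Fin d), g z = ∑ i, v i * z i := by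
    intro z
    have hz : z = ∑ i, z i • EuclideanSpace.single i (1 : ℝ) := by
      ext j
      simp [Pi.single_apply]
    conv_lhs => rw [hz]
    simp [hv, mul_comm]
  have hsuper : ∀ n y, hitW (fun _ => (1 + w)⁻¹) 0 n y ≤ Real.exp (-meanCost μ X y) := by
    refine hitW_le_of_super (fun y => ⟨by positivity, inv_le_one_of_one_le₀ (by linarith)⟩)
      (fun y => (Real.exp_pos _).le) (by simp [meanCost_zero]) fun y hy => ?_
    refine le_trans (mul_le_mul_of_nonneg_right ?_ (nbrAvg_nonneg fun y => (Real.exp_pos _).le))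
      (h.meanCost_super hd hy)
    rw [← Real.exp_log (show (0 : ℝ) < 1 + w by linarith), ← Real.exp_neg]
    exact Real.exp_le_exp.2 (by linarith)
  have hsq : ∑ i, v i ^ 2 ≤ 2 * d * w := by
    refine sum_sq_le_of_hitW_le hd hw fun n y => ?_
    have h1 : height v y ≤ meanCost μ X y := by
      have := (hgA (latticeVec y)).trans (hA y)
      rw [hg] at this
      exact this
    calc _ ≤ Real.exp (height v y) * Real.exp (-meanCost μ X y) :=
          mul_le_mul_of_nonneg_left (hsuper n y) (Real.exp_pos _).le
      _ = Real.exp (height v y - meanCost μ X y) := by rw [← Real.exp_add, sub_eq_add_neg]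
      _ ≤ 1 := Real.exp_le_one_iff.2 (by linarith)
  rw [← hgx, hg, EuclideanSpace.norm_eq]
  refine (Real.sum_mul_le_sqrt_mul_sqrt _ _ _).trans ?_
  simp only [Real.norm_eq_abs, sq_abs]
  exact mul_le_mul_of_nonneg_right (Real.sqrt_le_sqrt hsq) (Real.sqrt_nonneg _)

end RandomWeights

/-! ### The crossing of one slab -/

section Crossing

variable {d : ℕ}

/-- Supersolutions dominate the weights of paths up to their exit from `{x | p x}`. -/
lemma walkAvg_exitWeight_le (hd : 1 ≤ d) {p : (Fin d → ℤ) → Bool} {I : (Fin d → ℤ) → Prop}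
    (hI : ∀ x, I x → p x → ∀ s, I (x + stepVec s)) {c : ℝ} {w φ : (Fin d → ℤ) → ℝ}
    (hw : ∀ x, 0 ≤ w x) (hc : ∀ x, I x → c ≤ φ x) (hout : ∀ x, I x → ¬ p x → 1 ≤ φ x)
    (hin : ∀ x, I x → p x → w x * nbrAvg φ x ≤ φ x) (n : ℕ) (x : Fin d → ℤ) (hx : I x) :
    walkAvg n x (fun l => (if l.all p then c else 1) * ((l.takeWhile p).map w).prod) ≤ φ x := by
  induction n generalizing x with
  | zero =>
    by_cases h : p x
    · refine le_trans ?_ (hin x hx h)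
      have h1 : c ≤ nbrAvg φ x := by
        rw [← nbrAvg_const hd c (x := x)]
        exact nbrAvg_mono_of_step fun s => hc _ (hI x hx h s)
      simpa [walkAvg, h, mul_comm c] using mul_le_mul_of_nonneg_left h1 (hw x)
    · simpa [walkAvg, h] using hout x hx h
  | succ n ih =>
    by_cases h : p x
    · refine le_trans ?_ (hin x hx h)
      simp only [walkAvg, List.takeWhile_cons, h, List.all_cons, Bool.true_and, if_true,
        List.map_cons, List.prod_cons, mul_left_comm _ (w x), walkAvg_mul_left]
      rw [nbrAvg_mul_left]
      exact mul_le_mul_of_nonneg_left (nbrAvg_mono_of_step fun s => ih _ (hI x hx h s)) (hw x)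
    · simpa [walkAvg, h, walkAvg_const hd, nbrAvg_const hd] using hout x hx h

/-- For `t ≥ 0` this is the addition formula; for `t ≤ 0` both positive parts are at most `|s|`.
Flattening `cosh` to the left of `0` thus preserves the supersolution property. -/
lemma cosh_max_add_le (κ t s : ℝ) :
    Real.cosh (κ * max (t + s) 0) + Real.cosh (κ * max (t - s) 0) ≤
      2 * Real.cosh (κ * s) * Real.cosh (κ * max t 0) := by
  have hmax : ∀ u : ℝ, max u 0 ≤ |u| := fun u => max_le (le_abs_self u) (abs_nonneg u)
  have hle : ∀ u w : ℝ, max u 0 ≤ |w| → Real.cosh (κ * max u 0) ≤ Real.cosh (κ * w) := by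
    intro u w h
    rw [Real.cosh_le_cosh, abs_mul, abs_mul, abs_of_nonneg (le_max_right u 0)]
    exact mul_le_mul_of_nonneg_left h (abs_nonneg κ)
  rcases le_total 0 t with ht | ht
  · have h1 := hle (t + s) (t + s) (hmax _)
    have h2 := hle (t - s) (t - s) (hmax _)
    rw [max_eq_left ht]
    rw [mul_add, Real.cosh_add] at h1
    rw [mul_sub, Real.cosh_sub] at h2
    nlinarith
  · have h1 := hle (t + s) s (max_le ((by linarith : t + s ≤ s).trans (le_abs_self s))
      (abs_nonneg s))
    have h2 := hle (t - s) s (max_le ((by linarith : t - s ≤ -s).trans (neg_le_abs s))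
      (abs_nonneg s))
    rw [max_eq_right ht, mul_zero, Real.cosh_zero]
    linarith

variable {v : Fin d → ℝ} {a R : ℝ}

lemma prod_map_slab (r : ℝ) (l : List (Fin d → ℤ)) :
    (l.map fun x => if a ≤ height v x then r else 1).prod =
      r ^ (l.filter fun x => decide (a ≤ height v x)).length := by
  induction l with
  | nil => simp
  | cons x l ih =>
    by_cases h : a ≤ height v x
    · simp [h, ih, pow_succ']
    · simp [h, ih]

lemma prod_map_count (z : Fin d → ℤ) (r : ℝ) (l : List (Fin d → ℤ)) :
    (l.map fun x => if x = z then r else 1).prod = r ^ l.count z := by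
  induction l with
  | nil => simp
  | cons x l ih =>
    by_cases h : x = z
    · subst h
      simp [ih, pow_succ']
    · simp [h, ih]

lemma step_height_le (hv : ∀ i, |v i| ≤ 1) {b : ℝ} {x : Fin d → ℤ}
    (hx : (decide (height v x < b) : Bool) = true) (s : Fin d × Bool) :
    height v (x + stepVec s) ≤ b + 1 := by
  have := (abs_le.1 (abs_height_stepVec hv s)).2
  rw [decide_eq_true_eq] at hx
  rw [height_add]
  linarith

/-- The crossing of a slab with a constant killing rate. -/
lemma walkAvg_cross_const_le (hd : 1 ≤ d) (hv : ∀ i, |v i| ≤ 1) {κ r : ℝ} (hκ : 0 ≤ κ)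
    (hr : 0 ≤ r) (hR : 1 ≤ R) (hκr : r * ((∑ i, Real.cosh (κ * v i)) / d) ≤ 1)
    (n : ℕ) (x : Fin d → ℤ) (hx : height v x ≤ a + 1) :
    walkAvg n x (fun l => if l.all fun x => decide (height v x < a + R) then 0 else
      r ^ (slabPart v a R l).length) ≤ (Real.cosh (κ * (R - 1)))⁻¹ := by
  have hd0 : (0 : ℝ) < d := by exact_mod_cast hd
  set H := Real.cosh (κ * (R - 1)) with hH
  have hHpos : 0 < H := Real.cosh_pos _
  -- The supersolution equals `1 / H` up to height `a + 1`, where the path starts, and is at least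
  -- `1` at exit heights. Below height `a` there is no killing, but all neighbours lie in the flat
  -- part. The choice `c = 0` drops paths that have not crossed.
  have key := walkAvg_exitWeight_le hd (p := fun x => decide (height v x < a + R))
    (I := fun x => height v x ≤ a + R + 1) (fun x _ h s => step_height_le hv h s) (c := 0)
    (w := fun x => if a ≤ height v x then r else 1)
    (φ := fun x => Real.cosh (κ * max (height v x - a - 1) 0) / H)
    (fun x => by positivity) (fun x _ => by positivity) (fun x _ h => ?_) (fun x _ h => ?_) n x
    (by linarith)
  · rw [max_eq_right (by linarith), mul_zero, Real.cosh_zero, one_div] at key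
    refine le_trans (walkAvg_mono fun l => ?_) key
    rw [prod_map_slab, slabPart]
    split_ifs <;> simp
  · rw [decide_eq_true_eq, not_lt] at h
    rw [one_le_div hHpos, hH, Real.cosh_le_cosh, abs_of_nonneg (by nlinarith),
      abs_of_nonneg (by positivity)]
    exact mul_le_mul_of_nonneg_left (le_max_of_le_left (by linarith)) hκ
  · simp only [div_eq_mul_inv _ H, nbrAvg_mul_right]
    rw [← mul_assoc]
    refine mul_le_mul_of_nonneg_right ?_ (inv_nonneg.2 hHpos.le)
    rw [nbrAvg_height fun t => Real.cosh (κ * max (t - a - 1) 0)]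
    split_ifs with hax
    · have h1 : ∑ i, (Real.cosh (κ * max (height v x + v i - a - 1) 0) +
          Real.cosh (κ * max (height v x - v i - a - 1) 0)) ≤
          (∑ i, 2 * Real.cosh (κ * v i)) * Real.cosh (κ * max (height v x - a - 1) 0) := by
        rw [Finset.sum_mul]
        refine Finset.sum_le_sum fun i _ => ?_
        have := cosh_max_add_le κ (height v x - a - 1) (v i)
        rw [show height v x + v i - a - 1 = height v x - a - 1 + v i by ring,
          show height v x - v i - a - 1 = height v x - a - 1 - v i by ring]
        exact this
      calc _ ≤ r * ((∑ i, 2 * Real.cosh (κ * v i)) *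
            Real.cosh (κ * max (height v x - a - 1) 0) / (2 * d)) := by gcongr
        _ = r * ((∑ i, Real.cosh (κ * v i)) / d) * Real.cosh (κ * max (height v x - a - 1) 0) := by
            rw [← Finset.mul_sum]
            field_simp
        _ ≤ 1 * Real.cosh (κ * max (height v x - a - 1) 0) :=
            mul_le_mul_of_nonneg_right hκr (Real.cosh_pos _).le
        _ = _ := one_mul _
    · have h1 : ∀ i, max (height v x + v i - a - 1) 0 = 0 ∧
          max (height v x - v i - a - 1) 0 = 0 := fun i => by
        have := abs_le.1 (hv i)
        exact ⟨max_eq_right (by linarith), max_eq_right (by linarith)⟩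
      simp only [h1, mul_zero, Real.cosh_zero, one_mul, Finset.sum_const, Finset.card_univ,
        Fintype.card_fin, nsmul_eq_mul]
      rw [show (d : ℝ) * (1 + 1) / (2 * d) = 1 by field_simp; norm_num]
      exact Real.one_le_cosh _

/-- Exponential tails for the number of visits to a site of a slab before crossing it. -/
lemma walkAvg_count_gt_le (hd : 1 ≤ d) (hv : ∀ i, |v i| ≤ 1) (hv2 : ∑ i, v i ^ 2 = 1)
    (hR : 0 ≤ R) {z : Fin d → ℤ} (hz : a ≤ height v z)
    (hz' : height v z < a + R) (L n : ℕ) (x : Fin d → ℤ)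
    (hx : height v x ≤ a + R + 1) :
    walkAvg n x (fun l => if L < (slabPart v a R l).count z then 1 else 0) ≤
      (R + 2) * ((1 + 1 / (2 * d * (R + 2))) ^ L)⁻¹ := by
  have hd0 : (0 : ℝ) < d := by exact_mod_cast hd
  -- A reward `θ` per visit to `z` is paid by `φ = a + R + 2 - max ⟨v, x⟩ ⟨v, z⟩`. Averaging lowers
  -- `φ` at `z` by at least `1 / (2 d)`, because `|vᵢ| ≥ vᵢ²` and `∑ vᵢ² = 1`, while `φ ≤ R + 2`.
  -- The exponential moment of the visits is then at most `R + 2`, and Markov's inequality gives the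
  -- tail.
  set θ : ℝ := 1 + 1 / (2 * d * (R + 2)) with hθ
  have hθ1 : 1 ≤ θ := by rw [hθ]; linarith [show 0 ≤ 1 / (2 * d * (R + 2)) by positivity]
  have key := walkAvg_exitWeight_le hd (p := fun x => decide (height v x < a + R))
    (I := fun x => height v x ≤ a + R + 1) (fun x _ h s => step_height_le hv h s) (c := 1)
    (w := fun x => if x = z then θ else 1)
    (φ := fun x => a + R + 2 - max (height v x) (height v z))
    (fun x => by positivity) (fun x hx => ?_) (fun x hx _ => ?_) (fun x hx h => ?_) n x hx
  · simp only [ite_self, one_mul, prod_map_count] at key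
    have hpt : walkAvg n x (fun l => if L < (slabPart v a R l).count z then 1 else 0) ≤
        walkAvg n x (fun l => (θ ^ L)⁻¹ *
          θ ^ (l.takeWhile fun x => decide (height v x < a + R)).count z) := by
      refine walkAvg_mono fun l => ?_
      split_ifs with hL
      · rw [inv_mul_eq_div, one_le_div (by positivity)]
        exact pow_le_pow_right₀ hθ1 (hL.le.trans (List.filter_sublist.count_le z))
      · positivity
    rw [walkAvg_mul_left] at hpt
    refine hpt.trans ?_
    rw [mul_comm]
    refine mul_le_mul_of_nonneg_right (key.trans ?_) (by positivity)
    linarith [le_max_right (height v x) (height v z)]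
  · linarith [max_le hx (by linarith : height v z ≤ a + R + 1)]
  · linarith [max_le hx (by linarith : height v z ≤ a + R + 1)]
  · rw [nbrAvg_height fun t => a + R + 2 - max t (height v z)]
    have hconc : ∀ i, (a + R + 2 - max (height v x + v i) (height v z)) +
        (a + R + 2 - max (height v x - v i) (height v z)) ≤
        2 * (a + R + 2 - max (height v x) (height v z)) := by
      intro i
      rcases le_total (height v x) (height v z) with h1 | h1
      · rw [max_eq_right h1]
        linarith [le_max_right (height v x + v i) (height v z),
          le_max_right (height v x - v i) (height v z)]
      · rw [max_eq_left h1]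
        linarith [le_max_left (height v x + v i) (height v z),
          le_max_left (height v x - v i) (height v z)]
    split_ifs with hxz
    · subst hxz
      have h1 : ∑ i, ((a + R + 2 - max (height v x + v i) (height v x)) +
          (a + R + 2 - max (height v x - v i) (height v x))) ≤
          2 * d * (a + R + 2 - height v x) - 1 := by
        have : ∀ i ∈ Finset.univ, ((a + R + 2 - max (height v x + v i) (height v x)) +
            (a + R + 2 - max (height v x - v i) (height v x))) ≤
            2 * (a + R + 2 - height v x) - v i ^ 2 := by
          intro i _
          have hi := abs_le.1 (hv i)
          rcases le_total 0 (v i) with h2 | h2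
          · have := le_max_left (height v x + v i) (height v x)
            have := le_max_right (height v x - v i) (height v x)
            nlinarith
          · have := le_max_right (height v x + v i) (height v x)
            have := le_max_left (height v x - v i) (height v x)
            nlinarith
        refine (Finset.sum_le_sum this).trans (le_of_eq ?_)
        rw [Finset.sum_sub_distrib, hv2]
        simp
        ring
      rw [max_self]
      set D := a + R + 2 - height v x with hD
      have hD1 : D ≤ R + 2 := by linarith
      have h2 : (∑ i, ((a + R + 2 - max (height v x + v i) (height v x)) +
          (a + R + 2 - max (height v x - v i) (height v x)))) / (2 * d) ≤ D - 1 / (2 * d) := by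
        rw [div_le_iff₀ (by positivity)]
        refine h1.trans (le_of_eq ?_)
        field_simp
      refine (mul_le_mul_of_nonneg_left h2 (by positivity)).trans ?_
      have h3 : D / (2 * d * (R + 2)) ≤ 1 / (2 * d) := by
        rw [div_le_div_iff₀ (by positivity) (by positivity)]
        nlinarith
      have h4 : 0 ≤ 1 / (2 * d * (R + 2)) * (1 / (2 * d)) := by positivity
      calc _ = D + (D / (2 * d * (R + 2)) - 1 / (2 * d)) -
            1 / (2 * d * (R + 2)) * (1 / (2 * d)) := by rw [hθ]; ring
        _ ≤ D := by linarith
    · rw [one_mul, div_le_iff₀ (by positivity)]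
      refine (Finset.sum_le_sum fun i _ => hconc i).trans (le_of_eq ?_)
      simp
      ring

open Classical in
/-- Tails for the largest number of visits to one site of a slab before crossing it. -/
lemma walkAvg_exists_count_gt_le (hd : 1 ≤ d) (hv : ∀ i, |v i| ≤ 1) (hv2 : ∑ i, v i ^ 2 = 1)
    (hR : 0 ≤ R) (L n : ℕ) (x : Fin d → ℤ) (hx : height v x ≤ a + R + 1) :
    walkAvg n x (fun l => if ∃ z, L < (slabPart v a R l).count z then 1 else 0) ≤
      (R + 2) * ((1 + 1 / (2 * d * (R + 2))) ^ L)⁻¹ *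
        (d * ((R + 2) ^ 2 - max (height v x - a + 1) 0 ^ 2)) := by
  have hd0 : (0 : ℝ) < d := by exact_mod_cast hd
  set q := (R + 2) * ((1 + 1 / (2 * d * (R + 2))) ^ L)⁻¹ with hq
  have hq0 : 0 ≤ q := by positivity
  -- `U` bounds the expected time in the slab: averaging lowers it by exactly `1` from height `a`
  -- on, and never raises it. The shift by `1` keeps the neighbours of slab sites in the quadratic
  -- part. A union bound along the path charges one tail `q` to each step spent in the slab.
  set U : ℝ → ℝ := fun t => d * ((R + 2) ^ 2 - max (t - a + 1) 0 ^ 2) with hU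
  have hU0 : ∀ t, t ≤ a + R + 1 → 0 ≤ U t := by
    intro t ht
    refine mul_nonneg hd0.le (sub_nonneg.2 (pow_le_pow_left₀ (le_max_right _ _)
      (max_le (by linarith) (by linarith)) 2))
  have hconc : ∀ x, nbrAvg (fun y => U (height v y)) x ≤ U (height v x) := by
    intro x
    rw [nbrAvg_height U, div_le_iff₀ (by positivity)]
    have : ∀ i ∈ Finset.univ, U (height v x + v i) + U (height v x - v i) ≤ 2 * U (height v x) := by
      intro i _
      set m : ℝ → ℝ := fun t => max (t - a + 1) 0 with hm
      have h1 : 2 * m (height v x) ≤ m (height v x + v i) + m (height v x - v i) := by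
        rcases le_total 0 (height v x - a + 1) with h1 | h1
        · simp only [hm, max_eq_left h1]
          linarith [le_max_left (height v x + v i - a + 1) 0,
            le_max_left (height v x - v i - a + 1) 0]
        · simp only [hm, max_eq_right h1]
          linarith [le_max_right (height v x + v i - a + 1) 0,
            le_max_right (height v x - v i - a + 1) 0]
      have h0 : 0 ≤ m (height v x) := le_max_right _ _
      have h2 : 2 * m (height v x) ^ 2 ≤ m (height v x + v i) ^ 2 + m (height v x - v i) ^ 2 := by
        nlinarith [sq_nonneg (m (height v x + v i) - m (height v x - v i))]
      simp only [hU]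
      nlinarith
    refine (Finset.sum_le_sum this).trans (le_of_eq ?_)
    simp
    ring
  have hstrict : ∀ x, a ≤ height v x →
      nbrAvg (fun y => U (height v y)) x = U (height v x) - 1 := by
    intro x hax
    rw [nbrAvg_height U, div_eq_iff (by positivity)]
    have : ∀ i ∈ Finset.univ, U (height v x + v i) + U (height v x - v i) =
        2 * U (height v x) - 2 * d * v i ^ 2 := by
      intro i _
      have hi := abs_le.1 (hv i)
      simp only [hU]
      rw [max_eq_left (by linarith), max_eq_left (by linarith), max_eq_left (by linarith)]
      ring
    rw [Finset.sum_congr rfl this, Finset.sum_sub_distrib, ← Finset.mul_sum (a := 2 * (d : ℝ)), hv2]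
    simp
    ring
  change _ ≤ q * U (height v x)
  induction n generalizing x with
  | zero =>
    by_cases hxR : height v x < a + R
    · by_cases hax : a ≤ height v x
      · have h1 := walkAvg_count_gt_le hd hv hv2 hR hax hxR L 0 x hx
        have h2 : 1 ≤ U (height v x) := by
          have h3 := hstrict x hax
          have h4 : 0 ≤ nbrAvg (fun y => U (height v y)) x := by
            have := nbrAvg_mono_of_step (f := fun _ => 0) (g := fun y => U (height v y)) (x := x)
              fun s => hU0 _ (step_height_le hv (b := a + R) (by simpa using hxR) s)
            rwa [nbrAvg_const hd] at this
          linarith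
        refine le_trans (le_trans (le_of_eq ?_) h1) (le_mul_of_one_le_right hq0 h2)
        simp only [walkAvg, slabPart, List.takeWhile_cons, hxR, decide_true, if_true,
          List.takeWhile_nil, List.filter_cons, hax, List.filter_nil]
        refine if_congr ⟨?_, fun h => ⟨x, h⟩⟩ rfl rfl
        rintro ⟨z, hz⟩
        by_cases hzx : x = z
        · rwa [← hzx] at hz
        · simp [hzx] at hz
      · simpa [walkAvg, slabPart, hxR, hax] using mul_nonneg hq0 (hU0 _ hx)
    · simpa [walkAvg, slabPart, hxR] using mul_nonneg hq0 (hU0 _ hx)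
  | succ n ih =>
    by_cases hxR : height v x < a + R
    · have hstep : nbrAvg (fun y => walkAvg n y fun l =>
          if ∃ z, L < (slabPart v a R l).count z then 1 else 0) x ≤
          q * nbrAvg (fun y => U (height v y)) x := by
        rw [← nbrAvg_mul_left]
        exact nbrAvg_mono_of_step fun s =>
          ih _ (step_height_le hv (b := a + R) (by simpa using hxR) s)
      by_cases hax : a ≤ height v x
      · have h1 := walkAvg_count_gt_le hd hv hv2 hR hax hxR L (n + 1) x hx
        rw [hstrict x hax] at hstep
        have hpt : walkAvg (n + 1) x (fun l =>
            if ∃ z, L < (slabPart v a R l).count z then (1 : ℝ) else 0) ≤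
            walkAvg (n + 1) x (fun l => if L < (slabPart v a R l).count x then 1 else 0) +
            nbrAvg (fun y => walkAvg n y fun l =>
              if ∃ z, L < (slabPart v a R l).count z then 1 else 0) x := by
          simp only [walkAvg]
          rw [← nbrAvg_add]
          refine nbrAvg_mono_of_step fun s => ?_
          rw [← walkAvg_add]
          refine walkAvg_mono fun l => ?_
          have hcons : slabPart v a R (x :: l) = x :: slabPart v a R l := by
            simp [slabPart, hxR, hax]
          rw [hcons]
          by_cases hex : ∃ z, L < (x :: slabPart v a R l).count z
          · rw [if_pos hex]
            obtain ⟨z, hz⟩ := hex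
            by_cases hzx : x = z
            · subst hzx
              rw [if_pos hz]
              exact le_add_of_nonneg_right (by positivity)
            · rw [List.count_cons_of_ne hzx] at hz
              have hex' : ∃ z, L < (slabPart v a R l).count z := ⟨z, hz⟩
              rw [if_pos hex']
              exact le_add_of_nonneg_left (by positivity)
          · rw [if_neg hex]
            positivity
        linarith
      · have hcons : ∀ l, slabPart v a R (x :: l) = slabPart v a R l := by
          intro l
          simp [slabPart, hxR, hax]
        simp only [walkAvg, hcons]
        exact hstep.trans (mul_le_mul_of_nonneg_left (hconc x) hq0)
    · have hcons : ∀ l, slabPart v a R (x :: l) = [] := by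
        intro l
        simp [slabPart, hxR]
      simp only [walkAvg, hcons]
      simpa [walkAvg_const hd, nbrAvg_const hd] using mul_nonneg hq0 (hU0 _ hx)

lemma annW_le_pow_length {Λ : ℕ → ℝ} (hΛ : IsMomentSeq Λ) {r : ℝ} {L : ℕ}
    (hL : ∀ k ≤ L, Λ k ≤ r ^ k) {l : List (Fin d → ℤ)} (hl : ∀ z, l.count z ≤ L) :
    annW Λ l ≤ r ^ l.length := by
  rw [← List.sum_toFinset_count_eq_length l, ← Finset.prod_pow_eq_pow_sum]
  exact Finset.prod_le_prod (fun _ _ => hΛ.nonneg _) fun z _ => hL _ (hl z)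

open Classical in
/-- The averaged weight of the crossing of one slab. -/
theorem walkAvg_crossW_le (hd : 1 ≤ d) (hv2 : ∑ i, v i ^ 2 = 1) {Λ : ℕ → ℝ}
    (hΛ : IsMomentSeq Λ) {κ r : ℝ} {L : ℕ} (hL : ∀ k ≤ L, Λ k ≤ r ^ k) (hκ : 0 ≤ κ) (hr : 0 ≤ r)
    (hR : 1 ≤ R) (hκr : r * ((∑ i, Real.cosh (κ * v i)) / d) ≤ 1) (n : ℕ) (x : Fin d → ℤ)
    (hx : height v x ≤ a + 1) :
    walkAvg n x (crossW Λ v a R) ≤ (Real.cosh (κ * (R - 1)))⁻¹ +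
      d * (R + 2) ^ 3 * ((1 + 1 / (2 * d * (R + 2))) ^ L)⁻¹ := by
  have hv : ∀ i, |v i| ≤ 1 := fun i => by
    rw [← sq_le_one_iff_abs_le_one, ← hv2]
    exact Finset.single_le_sum (f := fun i => v i ^ 2) (fun j _ => sq_nonneg _) (Finset.mem_univ i)
  have h1 := walkAvg_cross_const_le hd hv hκ hr hR hκr n x hx
  have h2 := walkAvg_exists_count_gt_le hd hv hv2 (by linarith : 0 ≤ R) L n x
    (by linarith : height v x ≤ a + R + 1)
  -- If no site is visited more than `L` times, the path weight is at most that of constant killing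
  -- `r`; otherwise it is bounded by `1` and the tail of the visit numbers takes over.
  have h3 : walkAvg n x (crossW Λ v a R) ≤ walkAvg n x (fun l =>
      if l.all fun x => decide (height v x < a + R) then 0 else
        r ^ (slabPart v a R l).length) +
      walkAvg n x (fun l => if ∃ z, L < (slabPart v a R l).count z then 1 else 0) := by
    rw [← walkAvg_add]
    refine walkAvg_mono fun l => ?_
    unfold crossW
    by_cases hall : l.all fun x => decide (height v x < a + R)
    · simp only [hall, if_true, zero_add]
      positivity
    simp only [hall]
    by_cases hex : ∃ z, L < (slabPart v a R l).count z
    · rw [if_pos hex]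
      exact (annW_le_one hΛ _).trans (le_add_of_nonneg_left (by positivity))
    · rw [if_neg hex, add_zero]
      push Not at hex
      exact annW_le_pow_length hΛ hL hex
  refine h3.trans (add_le_add h1 (h2.trans ?_))
  calc _ ≤ (R + 2) * ((1 + 1 / (2 * d * (R + 2))) ^ L)⁻¹ * (d * (R + 2) ^ 2) := by
        have : (0 : ℝ) ≤ max (height v x - a + 1) 0 ^ 2 := by positivity
        gcongr
        linarith
    _ = _ := by ring

end Crossing

/-! ### Moments of the site weights -/

section Moments

variable {Ω : Type*} [MeasurableSpace Ω] {μ : Measure Ω} [IsProbabilityMeasure μ] {f : Ω → ℝ}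

/-- Monotone convergence. This truncation admits potentials of infinite mean, and provides the
bounded second moment used for small `γ`. -/
lemma exists_lt_lintegral_min (hf : Measurable f) {b : ℝ≥0∞}
    (hb : b < ∫⁻ ω, ENNReal.ofReal (f ω) ∂μ) :
    ∃ M : ℕ, b < ∫⁻ ω, ENNReal.ofReal (min (f ω) M) ∂μ := by
  have ht := lintegral_tendsto_of_tendsto_of_monotone (μ := μ)
    (f := fun (n : ℕ) ω => ENNReal.ofReal (min (f ω) n)) (F := fun ω => ENNReal.ofReal (f ω))
    (fun n => (hf.min measurable_const).ennreal_ofReal.aemeasurable)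
    (ae_of_all _ fun ω i j hij => ENNReal.ofReal_le_ofReal
      (min_le_min_left _ (by exact_mod_cast hij)))
    (ae_of_all _ fun ω => by
      obtain ⟨N, hN⟩ := exists_nat_ge (f ω)
      refine tendsto_const_nhds.congr' ?_
      filter_upwards [eventually_ge_atTop N] with n hn
      rw [min_eq_left (hN.trans (by exact_mod_cast hn))])
  exact (ht.eventually (lt_mem_nhds hb)).exists

lemma inv_one_add_pow_le {u : ℝ} (hu : 0 ≤ u) (k : ℕ) :
    ((1 + u)⁻¹) ^ k ≤ 1 - k * u + (k * u) ^ 2 := by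
  have h1 := one_add_mul_le_pow (by linarith : -2 ≤ u) k
  have h0 : 0 ≤ k * u := by positivity
  rw [inv_pow]
  refine (inv_anti₀ (by linarith) h1).trans ?_
  rw [inv_le_iff_one_le_mul₀ (by linarith)]
  nlinarith [pow_nonneg h0 3]

/-- Exponential decay of the first moments of `(1 + γ f)⁻¹`, at any rate below `γ 𝔼[f]`. -/
lemma exists_integral_inv_pow_le (hf : Measurable f) (hf0 : ∀ ω, 0 ≤ f ω) {c : ℝ} (hc : 0 ≤ c)
    (hcf : ENNReal.ofReal c < ∫⁻ ω, ENNReal.ofReal (f ω) ∂μ) :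
    ∃ δ, 0 < δ ∧ ∀ γ : ℝ, 0 < γ → ∀ k : ℕ, k * γ ≤ δ →
      ∫ ω, ((1 + γ * f ω)⁻¹) ^ k ∂μ ≤ Real.exp (-(c * γ)) ^ k := by
  obtain ⟨M, hM⟩ := exists_lt_lintegral_min hf hcf
  have hg0 : ∀ ω, 0 ≤ min (f ω) M := fun ω => le_min (hf0 ω) (Nat.cast_nonneg M)
  have hgi : Integrable (fun ω => min (f ω) (M : ℝ)) μ :=
    Integrable.of_bound (hf.min measurable_const).aestronglyMeasurable M (ae_of_all _ fun ω => by
      rw [Real.norm_of_nonneg (hg0 ω)]; exact min_le_right _ _)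
  set m := ∫ ω, min (f ω) (M : ℝ) ∂μ with hm
  rw [← ofReal_integral_eq_lintegral_ofReal hgi (ae_of_all _ hg0)] at hM
  have hcm : c < m := (ENNReal.ofReal_lt_ofReal_iff_of_nonneg hc).1 hM
  have hM1 : (0 : ℝ) < (M : ℝ) ^ 2 + 1 := by positivity
  -- With `t = k γ ≤ δ`, the quadratic error `t² M²` is at most `t (m - c)`, so the first-order
  -- decay `t m` still leaves `t c`. The `+ 1` keeps the denominator positive.
  refine ⟨(m - c) / ((M : ℝ) ^ 2 + 1), div_pos (by linarith) hM1, fun γ hγ k hk => ?_⟩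
  rw [le_div_iff₀ hM1] at hk
  have hpt : ∀ ω, ((1 + γ * f ω)⁻¹) ^ k ≤
      1 - k * γ * min (f ω) M + (k * γ) ^ 2 * (M : ℝ) ^ 2 := by
    intro ω
    have h1 : ((1 + γ * f ω)⁻¹) ^ k ≤ ((1 + γ * min (f ω) M)⁻¹) ^ k := by
      have := hg0 ω
      have := hf0 ω
      gcongr
      exact min_le_left _ _
    have h2 := inv_one_add_pow_le (mul_nonneg hγ.le (hg0 ω)) k
    have h3 : (k * γ) ^ 2 * min (f ω) (M : ℝ) ^ 2 ≤ (k * γ) ^ 2 * (M : ℝ) ^ 2 := by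
      have := hg0 ω
      gcongr
      exact min_le_right _ _
    nlinarith
  have hi : Integrable (fun ω => ((1 + γ * f ω)⁻¹) ^ k) μ := by
    refine integrable_of_mem_unit
      (((measurable_const.add (hf.const_mul γ)).inv).pow_const k).aestronglyMeasurable
      (fun ω => ?_) (fun ω => ?_)
    · have := hf0 ω
      positivity
    · have := hf0 ω
      exact pow_le_one₀ (by positivity) (inv_le_one_of_one_le₀ (by nlinarith))
  have hi1 : Integrable (fun ω => 1 - k * γ * min (f ω) (M : ℝ)) μ :=
    (integrable_const _).sub (hgi.const_mul _)
  have h1 := integral_mono hi (hi1.add (integrable_const ((k * γ) ^ 2 * (M : ℝ) ^ 2))) hpt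
  simp only [Pi.add_apply] at h1
  rw [integral_add hi1 (integrable_const _), integral_sub (integrable_const _) (hgi.const_mul _),
    integral_const_mul, ← hm] at h1
  simp only [integral_const, probReal_univ, one_smul] at h1
  refine h1.trans ?_
  rw [← Real.exp_nat_mul]
  refine le_trans ?_ (Real.add_one_le_exp _)
  have hkγ : 0 ≤ k * γ := by positivity
  nlinarith

end Moments

/-! ### The limit of small potentials -/

section SmallPotential

lemma exp_half_le_one_add {u : ℝ} (h0 : 0 ≤ u) (h1 : u ≤ 1) : Real.exp (u / 2) ≤ 1 + u := by
  have h2 := Real.add_one_le_exp (-(u / 2))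
  rw [Real.exp_neg] at h2
  have h3 : 0 < -(u / 2) + 1 := by linarith
  have h4 := inv_anti₀ h3 h2
  rw [inv_inv] at h4
  refine h4.trans ?_
  rw [inv_le_iff_one_le_mul₀ h3]
  nlinarith

/-- The error term for the number of visits is negligible. -/
lemma tendsto_visit_error {d : ℕ} (hd : 1 ≤ d) {K δ : ℝ} (hK : 0 < K) (hδ : 0 < δ) :
    Tendsto (fun γ : ℝ => d * (K / √γ + 2) ^ 3 *
      ((1 + 1 / (2 * d * (K / √γ + 2))) ^ ⌊δ / γ⌋₊)⁻¹) (𝓝[>] 0) (𝓝 0) := by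
  have hd0 : (1 : ℝ) ≤ d := by exact_mod_cast hd
  have hT : Tendsto (fun γ : ℝ => K / √γ + 2) (𝓝[>] 0) atTop := by
    refine tendsto_atTop_add_const_right _ _ ?_
    refine Tendsto.const_mul_atTop hK (tendsto_inv_nhdsGT_zero.comp ?_)
    refine tendsto_nhdsWithin_iff.2 ⟨?_, ?_⟩
    · have := Real.continuous_sqrt.tendsto 0
      rw [Real.sqrt_zero] at this
      exact this.mono_left nhdsWithin_le_nhds
    · filter_upwards [self_mem_nhdsWithin] with γ hγ
      exact Real.sqrt_pos.2 hγ
  -- With `T = K / √γ + 2 ≥ 4`, `(T - 2)² ≥ T² / 4` gives `δ / γ ≥ δ T² / (4 K²)`; rounding down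
  -- costs at most half of this. As `1 + u ≥ exp (u / 2)` with `u = 1 / (2 d T)`, the power is at
  -- least `exp (ε T)`, since `32 = 8 * 4`. This beats `T ^ 3`.
  set ε := δ / (32 * d * K ^ 2) with hε
  have hε0 : 0 < ε := by positivity
  have hlim : Tendsto (fun γ : ℝ => d * (ε⁻¹ ^ 3 * ((ε * (K / √γ + 2)) ^ 3 *
      Real.exp (-(ε * (K / √γ + 2)))))) (𝓝[>] 0) (𝓝 (d * (ε⁻¹ ^ 3 * 0))) :=
    (((Real.tendsto_pow_mul_exp_neg_atTop_nhds_zero 3).comp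
      (hT.const_mul_atTop hε0)).const_mul _).const_mul _
  rw [mul_zero, mul_zero] at hlim
  refine tendsto_of_tendsto_of_tendsto_of_le_of_le' tendsto_const_nhds hlim ?_ ?_
  · filter_upwards [self_mem_nhdsWithin] with γ hγ
    positivity
  · filter_upwards [self_mem_nhdsWithin, hT.eventually_ge_atTop 4,
      hT.eventually_ge_atTop (8 * K ^ 2 / δ)] with γ hγ hT4 hT8
    have hγ0 : 0 < γ := hγ
    set T := K / √γ + 2 with hTdef
    have hT0 : 0 < T := by linarith
    have hγT : δ / γ = δ * (T - 2) ^ 2 / K ^ 2 := by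
      rw [hTdef, add_sub_cancel_right, div_pow, Real.sq_sqrt hγ0.le]
      field_simp
    have h1 : 8 * K ^ 2 ≤ δ * T ^ 2 := by
      rw [div_le_iff₀ hδ] at hT8
      nlinarith
    have h2 : ε * T * (4 * d * T) ≤ (⌊δ / γ⌋₊ : ℝ) := by
      have h3 := (Nat.lt_floor_add_one (δ / γ)).le
      have h4 : δ * T ^ 2 / (4 * K ^ 2) ≤ δ / γ := by
        rw [hγT, div_le_div_iff₀ (by positivity) (by positivity)]
        have : T ^ 2 ≤ 4 * (T - 2) ^ 2 := by nlinarith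
        have hp : 0 < δ * K ^ 2 := by positivity
        nlinarith
      have h5 : 1 ≤ δ * T ^ 2 / (8 * K ^ 2) := (one_le_div (by positivity)).2 h1
      have h6 : δ * T ^ 2 / (4 * K ^ 2) = 2 * (δ * T ^ 2 / (8 * K ^ 2)) := by
        field_simp
        norm_num
      have h7 : ε * T * (4 * d * T) = δ * T ^ 2 / (8 * K ^ 2) := by
        rw [hε]
        field_simp
        norm_num
      linarith
    have h3 : Real.exp (ε * T) ≤ (1 + 1 / (2 * d * T)) ^ ⌊δ / γ⌋₊ := by
      have hu1 : 1 / (2 * d * T) ≤ 1 := (div_le_one (by positivity)).2 (by nlinarith)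
      have h4 := pow_le_pow_left₀ (Real.exp_pos _).le
        (exp_half_le_one_add (by positivity : 0 ≤ 1 / (2 * d * T)) hu1) ⌊δ / γ⌋₊
      rw [← Real.exp_nat_mul] at h4
      refine le_trans (Real.exp_le_exp.2 ?_) h4
      rw [← le_div_iff₀ (by positivity)] at h2
      refine h2.trans (le_of_eq ?_)
      field_simp
      norm_num
    calc _ ≤ d * T ^ 3 * (Real.exp (ε * T))⁻¹ := by gcongr
      _ = _ := by
        rw [Real.exp_neg]
        field_simp

/-- `cosh t ≤ exp (t² / 2)` and `exp u ≤ 1 + u + u²` on `[0, 1]`. Only `∑ vᵢ² = 1` enters the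
leading term, so the limiting rate does not depend on the direction. -/
lemma sum_cosh_le {d : ℕ} {v : Fin d → ℝ} (hv2 : ∑ i, v i ^ 2 = 1) {κ : ℝ}
    (hκ : κ ^ 2 / 2 ≤ 1) :
    ∑ i, Real.cosh (κ * v i) ≤ d + (κ ^ 2 / 2 + (κ ^ 2 / 2) ^ 2) := by
  have h : ∀ i ∈ Finset.univ, Real.cosh (κ * v i) ≤
      1 + (κ ^ 2 / 2 + (κ ^ 2 / 2) ^ 2) * v i ^ 2 := by
    intro i hi
    have hv1 : v i ^ 2 ≤ 1 := by
      rw [← hv2]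
      exact Finset.single_le_sum (f := fun i => v i ^ 2) (fun j _ => sq_nonneg _) hi
    set s := κ ^ 2 / 2 with hs
    have hs0 : 0 ≤ s := by positivity
    have h1 := Real.cosh_le_exp_half_sq (κ * v i)
    rw [show (κ * v i) ^ 2 / 2 = s * v i ^ 2 by rw [hs]; ring] at h1
    have ht0 : 0 ≤ s * v i ^ 2 := by positivity
    have ht1 : s * v i ^ 2 ≤ 1 := mul_le_one₀ hκ (sq_nonneg _) hv1
    have h2 := (abs_le.1 (Real.abs_exp_sub_one_sub_id_le (x := s * v i ^ 2)
      (by rwa [abs_of_nonneg ht0]))).2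
    have h3 : (s * v i ^ 2) ^ 2 ≤ s ^ 2 * v i ^ 2 := by
      have : 0 ≤ s ^ 2 * v i ^ 2 := by positivity
      nlinarith
    nlinarith
  refine (Finset.sum_le_sum h).trans (le_of_eq ?_)
  rw [Finset.sum_add_distrib, ← Finset.mul_sum, hv2]
  simp

variable {d : ℕ} {Ω : Type*} [MeasurableSpace Ω] {μ : Measure Ω} [IsProbabilityMeasure μ]
  {V : (Fin d → ℤ) → Ω → ℝ}

lemma randomWeights_siteWeight (hmeas : ∀ x, Measurable (V x)) (hnonneg : ∀ x ω, 0 ≤ V x ω)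
    (hindep : iIndepFun V μ) (hident : ∀ x, IdentDistrib (V x) (V 0) μ μ)
    (hpos : 0 < μ {ω | 0 < V 0 ω}) (hlog : Integrable (fun ω => Real.log (V 0 ω + 1)) μ)
    {γ : ℝ} (hγ : 0 < γ) :
    RandomWeights μ fun x ω => siteWeight (fun z => γ * V z ω) x := by
  have hφ : Measurable fun t : ℝ => (1 + γ * t)⁻¹ := by fun_prop
  have hW : ∀ ω, IsWeight (siteWeight fun z => γ * V z ω) := fun ω =>
    isWeight_siteWeight fun x => mul_nonneg hγ.le (hnonneg x ω)
  have hm : ∀ x, Measurable fun ω => siteWeight (fun z => γ * V z ω) x := fun x =>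
    hφ.comp (hmeas x)
  refine ⟨hm, hW, hindep.comp (fun _ t => (1 + γ * t)⁻¹) fun _ => hφ,
    fun x => (hident x).comp hφ, ?_, ?_⟩
  · have hi : Integrable (fun ω => siteWeight (fun z => γ * V z ω) 0) μ :=
      integrable_of_mem_unit (hm 0).aestronglyMeasurable (fun ω => (hW ω 0).1.le)
        fun ω => (hW ω 0).2
    have h1 : 0 < ∫ ω, (1 - siteWeight (fun z => γ * V z ω) 0) ∂μ := by
      rw [integral_pos_iff_support_of_nonneg (fun ω => sub_nonneg.2 (hW ω 0).2)
        ((integrable_const _).sub hi)]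
      refine hpos.trans_le (measure_mono fun ω hω => ?_)
      have hω' : 0 < V 0 ω := hω
      have : siteWeight (fun z => γ * V z ω) 0 < 1 :=
        inv_lt_one_of_one_lt₀ (by nlinarith [mul_pos hγ hω'])
      exact (sub_pos.2 this).ne'
    rw [integral_sub (integrable_const _) hi] at h1
    simpa using h1
  · refine ((integrable_const (Real.log (1 + γ))).add hlog).mono'
      (Real.measurable_log.comp (hm 0)).aestronglyMeasurable (ae_of_all _ fun ω => ?_)
    have hV := hnonneg 0 ω
    rw [siteWeight, Real.log_inv, norm_neg, Real.norm_of_nonneg (Real.log_nonneg (by nlinarith)),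
      Pi.add_apply, ← Real.log_mul (by positivity) (by positivity)]
    exact Real.log_le_log (by positivity) (by nlinarith)

/-- The lower bound for the annealed exponent of a small potential. -/
theorem eventually_mul_sqrt_le_annealedExponent (hd : 1 ≤ d) (hmeas : ∀ x, Measurable (V x))
    (hnonneg : ∀ x ω, 0 ≤ V x ω)
    (hW : ∀ γ : ℝ, 0 < γ → RandomWeights μ fun x ω => siteWeight (fun z => γ * V z ω) x)
    {l : EuclideanSpace ℝ (Fin d)} (hl : ‖l‖ = 1) {c m : ℝ} (hc : 0 ≤ c)
    (hcV : ENNReal.ofReal c < potentialMean μ V) (hm0 : 0 ≤ m) (hmc : m < √(2 * d * c)) :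
    ∀ᶠ γ : ℝ in 𝓝[>] 0, m * √γ ≤ annealedExponent μ (fun x ω => γ * V x ω) l := by
  have hd0 : (0 : ℝ) < d := by exact_mod_cast hd
  obtain ⟨κ, hmκ, hκc⟩ := exists_between hmc
  have hκ0 : 0 < κ := hm0.trans_lt hmκ
  have hκ2 : κ ^ 2 < 2 * d * c := (Real.lt_sqrt hκ0.le).1 hκc
  obtain ⟨δ, hδ, hmom⟩ := exists_integral_inv_pow_le (hmeas 0) (hnonneg 0) hc hcV
  -- Large enough that `cosh (κ K) ≥ exp (κ K) / 2` exceeds `exp (m K)`: the rescaled slab width `K`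
  -- absorbs the factor `2` at the price of lowering the rate from `κ` to `m`.
  set K := (Real.log 2 + 1) / (κ - m) with hK
  have hlog2 : 0 < Real.log 2 := Real.log_pos one_lt_two
  have hK0 : 0 < K := div_pos (by linarith) (by linarith)
  have hKm : (κ - m) * K = Real.log 2 + 1 := mul_div_cancel₀ _ (by linarith)
  have hcosh : (Real.cosh (κ * K))⁻¹ < Real.exp (-(m * K)) := by
    rw [Real.exp_neg]
    refine inv_strictAnti₀ (Real.exp_pos _) ?_
    have h1 : Real.exp (κ * K) / 2 ≤ Real.cosh (κ * K) := by
      rw [Real.cosh_eq]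
      linarith [Real.exp_pos (-(κ * K))]
    have h2 : Real.exp (m * K) < Real.exp (κ * K - Real.log 2) := Real.exp_lt_exp.2 (by linarith)
    rw [Real.exp_sub, Real.exp_log two_pos] at h2
    linarith
  set v : Fin d → ℝ := fun i => l i with hv
  have hv2 : ∑ i, v i ^ 2 = 1 := by
    have := EuclideanSpace.norm_sq_eq l
    rw [hl] at this
    simpa using this.symm
  have hsqrt : Tendsto (fun γ : ℝ => √γ) (𝓝[>] 0) (𝓝 0) := by
    have := Real.continuous_sqrt.tendsto 0
    rw [Real.sqrt_zero] at this
    exact this.mono_left nhdsWithin_le_nhds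
  have hβlim : Tendsto (fun γ : ℝ => (Real.cosh (κ * √γ * (K / √γ - 1)))⁻¹ +
      d * (K / √γ + 2) ^ 3 * ((1 + 1 / (2 * d * (K / √γ + 2))) ^ ⌊δ / γ⌋₊)⁻¹) (𝓝[>] 0)
      (𝓝 ((Real.cosh (κ * K))⁻¹ + 0)) := by
    refine Tendsto.add ?_ (tendsto_visit_error hd hK0 hδ)
    have h1 : Tendsto (fun γ : ℝ => (Real.cosh (κ * K - κ * √γ))⁻¹) (𝓝[>] 0)
        (𝓝 (Real.cosh (κ * K - κ * 0))⁻¹) :=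
      ((Real.continuous_cosh.tendsto _).comp (tendsto_const_nhds.sub (hsqrt.const_mul κ))).inv₀
        (Real.cosh_pos _).ne'
    rw [mul_zero, sub_zero] at h1
    refine h1.congr' ?_
    filter_upwards [self_mem_nhdsWithin] with γ hγ
    have : √γ ≠ 0 := (Real.sqrt_pos.2 hγ).ne'
    congr 2
    field_simp
  rw [add_zero] at hβlim
  have hsmall : Tendsto (fun γ : ℝ => κ ^ 2 / 2 * (1 + κ ^ 2 * γ / 2)) (𝓝[>] 0)
      (𝓝 (κ ^ 2 / 2)) := by
    have : Continuous fun γ : ℝ => κ ^ 2 / 2 * (1 + κ ^ 2 * γ / 2) := by fun_prop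
    have := this.tendsto 0
    simp only [mul_zero, zero_div, add_zero, mul_one] at this
    exact this.mono_left nhdsWithin_le_nhds
  have hsmall1 : Tendsto (fun γ : ℝ => κ ^ 2 * γ / 2) (𝓝[>] 0) (𝓝 0) := by
    have : Continuous fun γ : ℝ => κ ^ 2 * γ / 2 := by fun_prop
    have := this.tendsto 0
    simp only [mul_zero, zero_div] at this
    exact this.mono_left nhdsWithin_le_nhds
  filter_upwards [self_mem_nhdsWithin, hβlim.eventually (gt_mem_nhds hcosh),
    hsmall.eventually (gt_mem_nhds (by linarith : κ ^ 2 / 2 < d * c)),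
    hsmall1.eventually (gt_mem_nhds zero_lt_one), hsqrt.eventually (gt_mem_nhds hK0)]
    with γ hγ hβ hsm hsm1 hsK
  have hγ0 : 0 < γ := hγ
  have hs0 : 0 < √γ := Real.sqrt_pos.2 hγ0
  set R := K / √γ with hR
  have hR1 : 1 ≤ R := (one_le_div hs0).2 hsK.le
  set β := (Real.cosh (κ * √γ * (R - 1)))⁻¹ +
    d * (R + 2) ^ 3 * ((1 + 1 / (2 * d * (R + 2))) ^ ⌊δ / γ⌋₊)⁻¹ with hβdef
  have hβ0 : 0 < β := by
    have := Real.cosh_pos (κ * √γ * (R - 1))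
    positivity
  have hβ1 : β ≤ 1 := hβ.le.trans (Real.exp_le_one_iff.2 (by nlinarith))
  have hκγ : (κ * √γ) ^ 2 / 2 = κ ^ 2 * γ / 2 := by rw [mul_pow, Real.sq_sqrt hγ0.le]
  -- The tilt `κ √γ` gains about `κ² γ / (2 d)` per step, less than the killing rate `c γ` since `κ²
  -- < 2 d c`. The strict gap absorbs the second-order term for small `γ`.
  have hkill : Real.exp (-(c * γ)) * ((∑ i, Real.cosh (κ * √γ * v i)) / d) ≤ 1 := by
    have h1 := sum_cosh_le hv2 (κ := κ * √γ) (by rw [hκγ]; exact hsm1.le)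
    rw [hκγ] at h1
    have h2 : (∑ i, Real.cosh (κ * √γ * v i)) / d ≤ c * γ + 1 := by
      rw [div_le_iff₀ hd0]
      nlinarith
    rw [Real.exp_neg, inv_mul_le_iff₀ (Real.exp_pos _), mul_one]
    exact h2.trans (Real.add_one_le_exp _)
  have hWγ := hW γ hγ0
  obtain ⟨B, hB, hBlim⟩ := exists_isAnnealedExponent (μ := μ) hd
    (fun x ω => mul_nonneg hγ0.le (hnonneg x ω)) hWγ
  rw [hB.eq_annealedExponent]
  have hlow : ∀ y, -Real.log β / R * height v y ≤ B (latticeVec y) := by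
    intro y
    refine hWγ.height_mul_le_seminorm hd (fun i => ?_) (by linarith) hβ0 hβ1
      (fun a n x _ hx => ?_) (hBlim y)
    · rw [← sq_le_one_iff_abs_le_one, ← hv2]
      exact Finset.single_le_sum (f := fun i => v i ^ 2) (fun j _ => sq_nonneg _)
        (Finset.mem_univ i)
    · refine walkAvg_crossW_le hd hv2 hWγ.isMomentSeq (L := ⌊δ / γ⌋₊) (fun k hk => ?_)
        (by positivity) (Real.exp_pos _).le hR1 hkill n x hx
      refine hmom γ hγ0 k ?_
      rw [← le_div_iff₀ hγ0]
      exact (Nat.le_floor_iff (by positivity)).1 hk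
  -- The slabs are orthogonal to `l` itself, so the linear lower bound, extended from the lattice to
  -- `ℝ^d`, takes the value `-ln β / R` at `l`, and `R = K / √γ`.
  have hfin := le_seminorm_of_lattice B (g := fun z => -Real.log β / R * ∑ i, v i * z i)
    (by fun_prop)
    (fun t _ x => by simp only [PiLp.smul_apply, smul_eq_mul, Finset.mul_sum]
                     exact Finset.sum_congr rfl fun i _ => by ring)
    (fun y => hlow y) l
  have hvl : ∑ i, v i * l i = 1 := by
    rw [← hv2]
    exact Finset.sum_congr rfl fun i _ => (sq _).symm
  rw [hvl, mul_one] at hfin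
  refine le_trans ?_ hfin
  rw [le_div_iff₀ (by linarith), mul_assoc, hR, mul_div_cancel₀ _ hs0.ne']
  have := Real.log_le_log hβ0 hβ.le
  rw [Real.log_exp] at this
  linarith

lemma integral_log_one_add_le {f : Ω → ℝ} (hf : Integrable f μ) (hf0 : ∀ ω, 0 ≤ f ω)
    (hlog : Integrable (fun ω => Real.log (1 + f ω)) μ) :
    ∫ ω, Real.log (1 + f ω) ∂μ ≤ Real.log (1 + ∫ ω, f ω ∂μ) := by
  set E := ∫ ω, f ω ∂μ with hE
  have hE0 : 0 ≤ E := integral_nonneg hf0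
  have hpt : ∀ ω, Real.log (1 + f ω) ≤ (Real.log (1 + E) - E / (1 + E)) + f ω / (1 + E) := by
    intro ω
    have h0 := hf0 ω
    have h1 := Real.log_le_sub_one_of_pos (show 0 < (1 + f ω) / (1 + E) by positivity)
    rw [Real.log_div (by positivity) (by positivity)] at h1
    have h2 : (1 + f ω) / (1 + E) - 1 = f ω / (1 + E) - E / (1 + E) := by
      field_simp
      ring
    linarith
  have h1 := integral_mono hlog ((integrable_const _).add (hf.div_const (1 + E))) hpt
  simp only [Pi.add_apply] at h1
  rw [integral_add (integrable_const _) (hf.div_const _), integral_div, ← hE] at h1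
  simpa using h1

/-- The upper bound for the quenched exponent. -/
theorem quenchedExponent_le (hd : 1 ≤ d) (hmeas : ∀ x, Measurable (V x))
    (hnonneg : ∀ x ω, 0 ≤ V x ω) {γ : ℝ} (hγ : 0 < γ)
    (hW : RandomWeights μ fun x ω => siteWeight (fun z => γ * V z ω) x)
    (hfin : potentialMean μ V ≠ ⊤) {l : EuclideanSpace ℝ (Fin d)} (hl : ‖l‖ = 1) :
    quenchedExponent μ (fun x ω => γ * V x ω) l ≤
      √(2 * d * (potentialMean μ V).toReal) * √γ := by
  obtain ⟨A, hA, -, hAle⟩ := exists_isQuenchedExponent (μ := μ) hd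
    (fun x ω => mul_nonneg hγ.le (hnonneg x ω)) hW
  rw [hA.eq_quenchedExponent]
  have hVi : Integrable (V 0) μ := by
    refine ⟨(hmeas 0).aestronglyMeasurable, ?_⟩
    rw [hasFiniteIntegral_iff_ofReal (ae_of_all _ (hnonneg 0))]
    exact lt_top_iff_ne_top.2 hfin
  have hE : (potentialMean μ V).toReal = ∫ ω, V 0 ω ∂μ :=
    (integral_eq_lintegral_of_nonneg_ae (ae_of_all _ (hnonneg 0))
      (hmeas 0).aestronglyMeasurable).symm
  have hlogi : Integrable (fun ω => Real.log (1 + γ * V 0 ω)) μ := by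
    refine hW.integrable_log.neg.congr (ae_of_all _ fun ω => ?_)
    simp [siteWeight, Real.log_inv]
  have h1 := integral_log_one_add_le (hVi.const_mul γ)
    (fun ω => mul_nonneg hγ.le (hnonneg 0 ω)) hlogi
  rw [integral_const_mul, ← hE] at h1
  have h2 := hW.seminorm_le_sqrt_mul_norm hd hAle
    (w := γ * (potentialMean μ V).toReal) (by positivity) (by
      simp only [siteWeight, Real.log_inv, integral_neg, neg_neg]
      exact h1) l
  rw [hl, mul_one] at h2
  rwa [← Real.sqrt_mul (by positivity), mul_assoc _ _ γ, mul_comm _ γ]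

lemma annealedExponent_le_quenchedExponent (hd : 1 ≤ d) {W : (Fin d → ℤ) → Ω → ℝ}
    (hW : ∀ x ω, 0 ≤ W x ω) (h : RandomWeights μ fun x ω => siteWeight (fun z => W z ω) x)
    (x : EuclideanSpace ℝ (Fin d)) : annealedExponent μ W x ≤ quenchedExponent μ W x := by
  obtain ⟨A, hA, hAlim, -⟩ := exists_isQuenchedExponent hd hW h
  obtain ⟨B, hB, hBlim⟩ := exists_isAnnealedExponent hd hW h
  rw [hA.eq_quenchedExponent, hB.eq_annealedExponent]
  refine seminorm_le_of_lattice (fun y => ?_) x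
  exact le_of_tendsto_of_tendsto' (hBlim y) (hAlim y) fun k => by
    gcongr
    exact h.costMean_le_meanCost hd _

/-- Any real `c` strictly between `m² / (2 d)` and the mean will do; one exists even if the mean is
infinite. -/
lemma exists_rate_of_lt_limitConstant (hd : 1 ≤ d) {m : ℝ} (hm0 : 0 ≤ m)
    (hm : ENNReal.ofReal m < limitConstant μ V) :
    ∃ c : ℝ, 0 ≤ c ∧ ENNReal.ofReal c < potentialMean μ V ∧ m < √(2 * d * c) := by
  have hd0 : (0 : ℝ) < d := by exact_mod_cast hd
  have h1 : ENNReal.ofReal (m ^ 2 / (2 * d)) < potentialMean μ V := by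
    have h2 := ENNReal.rpow_lt_rpow hm (two_pos : (0 : ℝ) < 2)
    rw [limitConstant, ← ENNReal.rpow_mul] at h2
    norm_num at h2
    rw [ENNReal.ofReal_div_of_pos (by positivity)]
    refine ENNReal.div_lt_of_lt_mul' ?_
    rw [ENNReal.ofReal_pow hm0, ENNReal.ofReal_mul two_pos.le]
    simpa using h2
  obtain ⟨c, h2, h3⟩ := ENNReal.lt_iff_exists_nnreal_btwn.1 h1
  refine ⟨c, c.2, by simpa using h3, ?_⟩
  rw [Real.lt_sqrt hm0]
  rw [← ENNReal.ofReal_coe_nnreal, ENNReal.ofReal_lt_ofReal_iff_of_nonneg (by positivity),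
    div_lt_iff₀ (by positivity)] at h2
  linarith

end SmallPotential

/-! ### The theorem: both limits from the squeeze between the two bounds -/

theorem mainTheorem2 {d : ℕ} (hd : 1 ≤ d) {Ω : Type*} [MeasurableSpace Ω]
    (μ : Measure Ω) [IsProbabilityMeasure μ] (V : (Fin d → ℤ) → Ω → ℝ)
    (hmeas : ∀ x, Measurable (V x)) (hnonneg : ∀ x ω, 0 ≤ V x ω)
    (hindep : iIndepFun V μ) (hident : ∀ x, IdentDistrib (V x) (V 0) μ μ)
    (hpos : 0 < μ {ω | 0 < V 0 ω})
    (hlog : Integrable (fun ω => Real.log (V 0 ω + 1)) μ)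
    (l : EuclideanSpace ℝ (Fin d)) (hl : ‖l‖ = 1) :
    -- the Green's function and both exponents of `-Δ + γ V` are well defined
    (∀ γ : ℝ, 0 < γ →
      (∀ᵐ ω ∂μ, ∃! u, IsBoundedGreenSolution (fun x => γ * V x ω) u) ∧
      (∃! A, IsQuenchedExponent μ (fun x ω => γ * V x ω) A) ∧
      (∃! B, IsAnnealedExponent μ (fun x ω => γ * V x ω) B)) ∧
    -- the two limits, in `[0, ∞]`
    Tendsto (scaledQuenched μ V l) (𝓝[>] 0) (𝓝 (limitConstant μ V : EReal)) ∧
    Tendsto (scaledAnnealed μ V l) (𝓝[>] 0) (𝓝 (limitConstant μ V : EReal)) ∧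
    -- Wang's bounds hold if and only if the mean is finite, and then with every constant below
    -- `√(2 d 𝔼[V(0)])`, so with one that depends only on `d` and `𝔼[V(0)]`
    ((∃ c : ℝ, 0 < c ∧ WangBounds μ V l c) ↔ potentialMean μ V < ⊤) ∧
    (potentialMean μ V < ⊤ →
      ∀ c : ℝ, (c : EReal) < (limitConstant μ V : EReal) → WangBounds μ V l c) := by
  have hW : ∀ γ : ℝ, 0 < γ → RandomWeights μ fun x ω => siteWeight (fun z => γ * V z ω) x :=
    fun γ hγ => randomWeights_siteWeight hmeas hnonneg hindep hident hpos hlog hγ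
  have hmean : 0 < potentialMean μ V := by
    rw [potentialMean, lintegral_pos_iff_support (hmeas 0).ennreal_ofReal]
    refine hpos.trans_le (measure_mono fun ω hω => ?_)
    exact (ENNReal.ofReal_pos.2 hω).ne'
  have hdE : (2 * d : ℝ≥0∞) ≠ 0 := by
    have : (d : ℝ≥0∞) ≠ 0 := by exact_mod_cast (by omega : d ≠ 0)
    exact mul_ne_zero two_ne_zero this
  have hdT : (2 * d : ℝ≥0∞) ≠ ⊤ := ENNReal.mul_ne_top ENNReal.ofNat_ne_top (ENNReal.natCast_ne_top d)
  have hlim0 : 0 < limitConstant μ V :=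
    ENNReal.rpow_pos_of_nonneg (pos_iff_ne_zero.2 (mul_ne_zero hdE hmean.ne')) (by norm_num)
  have hlimT : limitConstant μ V < ⊤ ↔ potentialMean μ V < ⊤ := by
    rw [limitConstant, ENNReal.rpow_lt_top_iff_of_pos (by norm_num)]
    simp only [lt_top_iff_ne_top]
    refine not_congr ?_
    rw [ENNReal.mul_eq_top]
    simp [hdE, hdT]
  have hlow : ∀ b : EReal, b < limitConstant μ V →
      ∀ᶠ γ in 𝓝[>] 0, b < scaledAnnealed μ V l γ := by
    intro b hb
    -- The maximum with `0` makes the intermediate rate positive, as the lower bound for the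
    -- annealed exponent requires, even if `b` is negative or `⊥`.
    obtain ⟨m, hm1, hm2⟩ := EReal.lt_iff_exists_real_btwn.1
      (max_lt hb (EReal.coe_ennreal_pos.2 hlim0))
    obtain ⟨hbm, hm0⟩ := max_lt_iff.1 hm1
    have hm0' : 0 < m := by exact_mod_cast hm0
    have hm3 : ENNReal.ofReal m < limitConstant μ V := by
      rw [← EReal.coe_ennreal_lt_coe_ennreal_iff, EReal.coe_ennreal_ofReal, max_eq_left hm0'.le]
      exact hm2
    obtain ⟨c, hc, hcV, hmc⟩ := exists_rate_of_lt_limitConstant hd hm0'.le hm3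
    filter_upwards [self_mem_nhdsWithin, eventually_mul_sqrt_le_annealedExponent hd hmeas hnonneg
      hW hl hc hcV hm0'.le hmc] with γ hγ hle
    refine hbm.trans_le ?_
    rw [scaledAnnealed, EReal.coe_le_coe_iff, le_div_iff₀ (Real.sqrt_pos.2 hγ)]
    exact hle
  have hBA : ∀ γ : ℝ, 0 < γ → scaledAnnealed μ V l γ ≤ scaledQuenched μ V l γ := by
    intro γ hγ
    rw [scaledAnnealed, scaledQuenched, EReal.coe_le_coe_iff]
    gcongr
    exact annealedExponent_le_quenchedExponent hd
      (fun x ω => mul_nonneg hγ.le (hnonneg x ω)) (hW γ hγ) l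
  have hup : ∀ γ : ℝ, 0 < γ → scaledQuenched μ V l γ ≤ limitConstant μ V := by
    intro γ hγ
    by_cases hfin : potentialMean μ V = ⊤
    · have : limitConstant μ V = ⊤ := by
        by_contra h
        exact (hlimT.1 (lt_top_iff_ne_top.2 h)).ne hfin
      rw [this, EReal.coe_ennreal_top]
      exact le_top
    · have h1 := quenchedExponent_le hd hmeas hnonneg hγ (hW γ hγ) hfin hl
      have h2 : limitConstant μ V = ENNReal.ofReal √(2 * d * (potentialMean μ V).toReal) := by
        rw [limitConstant, Real.sqrt_eq_rpow, ← ENNReal.ofReal_rpow_of_nonneg (by positivity)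
          (by norm_num), ENNReal.ofReal_mul (by positivity), ENNReal.ofReal_mul two_pos.le,
          ENNReal.ofReal_toReal hfin]
        simp
      rw [h2, EReal.coe_ennreal_ofReal, max_eq_left (Real.sqrt_nonneg _), scaledQuenched,
        EReal.coe_le_coe_iff, div_le_iff₀ (Real.sqrt_pos.2 hγ)]
      exact h1
  have hpos' : ∀ᶠ γ : ℝ in 𝓝[>] 0, 0 < γ := self_mem_nhdsWithin
  have hA : Tendsto (scaledQuenched μ V l) (𝓝[>] 0) (𝓝 (limitConstant μ V : EReal)) := by
    refine tendsto_order.2 ⟨fun b hb => ?_, fun b hb => ?_⟩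
    · filter_upwards [hlow b hb, hpos'] with γ h1 h2 using h1.trans_le (hBA γ h2)
    · filter_upwards [hpos'] with γ h2 using (hup γ h2).trans_lt hb
  have hB : Tendsto (scaledAnnealed μ V l) (𝓝[>] 0) (𝓝 (limitConstant μ V : EReal)) := by
    refine tendsto_order.2 ⟨fun b hb => hlow b hb, fun b hb => ?_⟩
    filter_upwards [hpos'] with γ h2 using ((hBA γ h2).trans (hup γ h2)).trans_lt hb
  have hwang : potentialMean μ V < ⊤ →
      ∀ c : ℝ, (c : EReal) < (limitConstant μ V : EReal) → WangBounds μ V l c := by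
    intro hfin c hc
    rw [WangBounds, hA.limsup_eq, hB.liminf_eq]
    refine ⟨hc, le_rfl, ?_⟩
    rw [← EReal.coe_ennreal_top, EReal.coe_ennreal_lt_coe_ennreal_iff]
    exact hlimT.2 hfin
  refine ⟨fun γ hγ => ⟨?_, ?_, ?_⟩, hA, hB, ⟨?_, fun hfin => ?_⟩, hwang⟩
  · filter_upwards [(hW γ hγ).ae_summableSurv hd] with ω hω
    exact existsUnique_green hd (fun x => mul_nonneg hγ.le (hnonneg x ω)) hω
  · obtain ⟨A, hA', -⟩ := exists_isQuenchedExponent (μ := μ) hd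
      (fun x ω => mul_nonneg hγ.le (hnonneg x ω)) (hW γ hγ)
    exact hA'.existsUnique
  · obtain ⟨B, hB', -⟩ := exists_isAnnealedExponent (μ := μ) hd
      (fun x ω => mul_nonneg hγ.le (hnonneg x ω)) (hW γ hγ)
    exact hB'.existsUnique
  · rintro ⟨c, -, -, -, hlt⟩
    rw [hA.limsup_eq, ← EReal.coe_ennreal_top, EReal.coe_ennreal_lt_coe_ennreal_iff] at hlt
    exact hlimT.1 hlt
  · obtain ⟨c, hc1, hc2⟩ := EReal.lt_iff_exists_real_btwn.1 (EReal.coe_ennreal_pos.2 hlim0)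
    exact ⟨c, by exact_mod_cast hc1, hwang hfin c hc2⟩
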